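/- For an even integer $k \geq 4$ and $z$ in the upper half plane $\mathbb{H}$ let $$E_k(z) = \frac12 \sum_{\substack{(c,d)\in\mathbb{Z}^2\\ \gcd(c,d)=1}} (cz+d)^{-k}, \qquad E_{k,5}^{*}(z) = \frac{5^{k/2} E_k(5z) + E_k(z)}{5^{k/2}+1}.$$ Let $$\mathbb{F}^{*}(5) = \{z \in \mathbb{H} : |z| \geq \tfrac{1}{\sqrt5},\ |z+\tfrac12| \geq \tfrac{1}{2\sqrt5},\ -\tfrac12 \leq \operatorname{Re} z \leq 0\} \cup \{z \in \mathbb{H} : |z| > \tfrac{1}{\sqrt5},\ |z-\tfrac12| > \tfrac{1}{2\sqrt5},\ 0 \leq \operatorname{Re} z < \tfrac12\},$$ a fundamental domain for the Fricke group $\Gamma_0^{*}(5)$. Put $\rho_{5,1} = -\frac12 + \frac{i}{2\sqrt5}$, $\rho_{5,2} = -\frac25 + \frac{i}{5}$, $\alpha_5 = \arctan 2$, and $$A_{5,1}^{*} = \{z : |z| = \tfrac{1}{\sqrt5},\ \tfrac{\pi}{2} < \operatorname{Arg} z < \tfrac{\pi}{2}+\alpha_5\}, \qquad A_{5,2}^{*}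 = \{z : |z+\tfrac12| = \tfrac{1}{2\sqrt5},\ \alpha_5 < \operatorname{Arg}(z+\tfrac12) < \tfrac{\pi}{2}\}.$$ Let $v_\infty$ be the order of vanishing of $E_{k,5}^{*}$ at the cusp $\infty$ in the parameter $q = e^{2\pi i z}$, let $v_p$ be its order of vanishing at $p \in \mathbb{H}$, and let $V_{5,n}^{*}$ be the number of simple zeros of $E_{k,5}^{*}$ on $A_{5,n}^{*}$, $n = 1,2$. Then for $k = 4, 6, 8, 10$ these numbers are $$\begin{array}{c|cccccc} k & v_\infty & v_{i/\sqrt5} & v_{\rho_{5,1}} & v_{\rho_{5,2}} & V_{5,1}^{*} & V_{5,2}^{*}\\ \hline 4 & 0&0&0&0&1&0\\ 6&0&1&1&1&0&0\\ 8&0&0&0&0&1&1\\ 10&0&1&1&1&1&0\end{array}$$ and $E_{k,5}^{*}$ has no other zeros in $\mathbb{F}^{*}(5)$: every zero of $E_{k,5}^{*}$ in $\mathbb{F}^{*}(5)$ is one of $i/\sqrt5$, $\rho_{5,1}$, $\rho_{5,2}$, or a simple zero on $A_{5,1}^{*} \cup A_{5,2}^{*}$. -/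

import Mathlib

open UpperHalfPlane

noncomputable section

namespace FrickeEisenstein

/-- The point `p z` of the upper half plane. -/
def scale (p : ℕ) [NeZero p] (z : ℍ) : ℍ :=
  ⟨(p : ℂ) * (z : ℂ), by
    have hp : (0 : ℝ) < p := Nat.cast_pos.mpr (NeZero.pos p)
    have hz : 0 < (z : ℂ).im := z.im_pos
    simpa using mul_pos hp hz⟩

/-- The Eisenstein series `E*_{k,p}(z) = (p^(k/2) E_k(p z) + E_k(z)) / (p^(k/2) + 1)` of even
weight `k` for the Fricke group of level `p`. Here `E_k` is Mathlib's level one Eisenstein series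
with constant term `1`. -/
def eisensteinFricke (p : ℕ) [NeZero p] {k : ℕ} (hk : 3 ≤ k) (z : ℍ) : ℂ :=
  1 / ((p : ℂ) ^ (k / 2) + 1) *
    ((p : ℂ) ^ (k / 2) * ModularForm.E hk (scale p z) + ModularForm.E hk z)

/-- `f` is holomorphic at `z` and vanishes there to order exactly `n`, i.e. `v_z(f) = n`. -/
def HasOrderAt (f : ℍ → ℂ) (z : ℍ) (n : ℕ) : Prop :=
  AnalyticAt ℂ (f ∘ ofComplex) (z : ℂ) ∧ analyticOrderAt (f ∘ ofComplex) (z : ℂ) = n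

/-- `f` has period `1`, is holomorphic at the cusp `∞`, and vanishes there to order exactly `n`
in the local parameter `q = exp (2 π i z)`, i.e. `v_∞(f) = n`. -/
def HasOrderAtInfty (f : ℍ → ℂ) (n : ℕ) : Prop :=
  Function.Periodic (f ∘ ofComplex) (1 : ℂ) ∧
    AnalyticAt ℂ (cuspFunction 1 f) 0 ∧ analyticOrderAt (cuspFunction 1 f) 0 = n

/-- The point `i / √5`. -/
def pointI : ℍ := ⟨⟨0, 1 / √5⟩, by positivity⟩

/-- The point `ρ_{5,1} = -1/2 + i / (2√5)`. -/
def rho1 : ℍ := ⟨⟨-1 / 2, 1 / (2 * √5)⟩, by positivity⟩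

/-- The point `ρ_{5,2} = -2/5 + i/5`. -/
def rho2 : ℍ := ⟨⟨-2 / 5, 1 / 5⟩, by norm_num⟩

/-- The angle `α_5` in `[0, π]` with `tan α_5 = 2`. -/
def alpha : ℝ := Real.arctan 2

/-- The open arc `A*_{5,1}` of the circle `|z| = 1/√5`, from `i/√5` to `ρ_{5,2}`. -/
def arc1 : Set ℍ :=
  {z | ‖(z : ℂ)‖ = 1 / √5 ∧ Real.pi / 2 < (z : ℂ).arg ∧ (z : ℂ).arg < Real.pi / 2 + alpha}

/-- The open arc `A*_{5,2}` of the circle `|z + 1/2| = 1/(2√5)`, from `ρ_{5,2}` to `ρ_{5,1}`. -/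
def arc2 : Set ℍ :=
  {z | ‖(z : ℂ) + 1 / 2‖ = 1 / (2 * √5) ∧
    alpha < ((z : ℂ) + 1 / 2).arg ∧ ((z : ℂ) + 1 / 2).arg < Real.pi / 2}

/-- The fundamental domain `F*(5)` of the Fricke group of level `5`. -/
def fundDomain : Set ℍ :=
  {z | 1 / √5 ≤ ‖(z : ℂ)‖ ∧ 1 / (2 * √5) ≤ ‖(z : ℂ) + 1 / 2‖ ∧ -1 / 2 ≤ z.re ∧ z.re ≤ 0} ∪
  {z | 1 / √5 < ‖(z : ℂ)‖ ∧ 1 / (2 * √5) < ‖(z : ℂ) - 1 / 2‖ ∧ 0 ≤ z.re ∧ z.re < 1 / 2}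

/-- The zeros of `f` in `F*(5)` are located as in the row `(vInf, vI, v1, v2, V1, V2)` of a table:
`f` has orders `vInf, vI, v1, v2` at `∞, i/√5, ρ_{5,1}, ρ_{5,2}`, it has exactly `V1` and `V2`
simple zeros on the arcs `A*_{5,1}` and `A*_{5,2}`, and there is no other zero in `F*(5)`
(in particular no multiple zero on the arcs). -/
def HasZeroTable (f : ℍ → ℂ) (vInf vI v1 v2 V1 V2 : ℕ) : Prop :=
  HasOrderAtInfty f vInf ∧
  HasOrderAt f pointI vI ∧
  HasOrderAt f rho1 v1 ∧
  HasOrderAt f rho2 v2 ∧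
  {z ∈ arc1 | HasOrderAt f z 1}.encard = V1 ∧
  {z ∈ arc2 | HasOrderAt f z 1}.encard = V2 ∧
  ∀ z ∈ fundDomain, f z = 0 →
    z = pointI ∨ z = rho1 ∨ z = rho2 ∨ ((z ∈ arc1 ∨ z ∈ arc2) ∧ HasOrderAt f z 1)

end FrickeEisenstein

end

noncomputable section

namespace FrickeEisenstein

open CongruenceSubgroup Filter Topology Asymptotics
open scoped MatrixGroups Manifold ModularForm

/-! Write D = η(z)⁴η(5z)⁴ (`etaForm`): a form of weight 4 without zeros in ℍ and with a simple zero
at ∞. A form of weight 4m divided by D^m is holomorphic and invariant under Γ₀(5) and the Fricke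
involution. That involution exchanges the cusps 0 and ∞, so if the quotient tends to 0 at ∞ it is
bounded at every cusp, hence constant, hence zero. Thus a form of weight 4m that is O(q^(m+1))
vanishes identically (`IsFrickeForm.eq_zero_of_isBigO`).

Let h = E*₄/D + 36/13 = 1/q + 16 + ⋯ (`hauptmodul`). Comparing the coefficients of 1, q, q², q³ then
proves E*₄ = D(h − 36/13), (E*₆)² = D³h(h² − 44h − 16), E*₈ = D²(h² − (7272/313)h − 1008/313), E*₁₀
= E*₆·D(h − 4212/521). What remains is to know where h takes certain real values, and how often.

On each side of the left half of F*(5) the reflection z ↦ −z̄, which conjugates h, agrees with an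
element of the Fricke group, so h is real there. The maximum principle for exp(ih) gives Im h > 0 in
the interior (`hauptC_im_pos`). A map that sends a sector at a boundary point to the closed upper
half plane has bounded order there (`order_mul_le_pi`), and on a smooth boundary arc its derivative
along the arc is positive (`deriv_mul_re_pos`). So h is real in the left half only on the boundary,
and increases strictly along it: down the line Re z = −1/2 to ρ₁, over the second arc to ρ₂, over
the first arc to i/√5, and up the imaginary axis. No valence formula is needed.

At the three corners the automorphy factor of a fixing element is i, so E*₆ vanishes there because
i⁶ = −1. The corner values of h are therefore the roots 22 − 10√5 < 0 < 22 + 10√5 of the cubic, in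
this order. Hence h maps the two arcs bijectively to the intervals between them, and each factor h −
c above with c in one of these open intervals contributes one simple zero on the corresponding arc.
The corners are right angles, so h − h(p) has order at most 2 there, which makes the corner zeros of
E*₆ simple. -/

/-! ### Forms for the Fricke group of level 5 -/

/-- The Fricke involution `z ↦ -1 / (5 z)`. -/
def fricke (z : ℍ) : ℍ :=
  ⟨-1 / (5 * (z : ℂ)), by
    have h : -1 / (5 * (z : ℂ)) = ((1 / 5 : ℝ) : ℂ) * (-(z : ℂ))⁻¹ := by
      push_cast; field_simp [z.ne_zero]
    rw [h, Complex.im_ofReal_mul]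
    exact mul_pos (by norm_num) z.im_inv_neg_coe_pos⟩

lemma coe_fricke (z : ℍ) : (fricke z : ℂ) = -1 / (5 * (z : ℂ)) := rfl

lemma coe_scale (z : ℍ) : (scale 5 z : ℂ) = 5 * (z : ℂ) := by simp [scale]

/-- Holomorphic functions that transform with weight `k` under `Γ₀(5)` and the Fricke involution. -/
structure IsFrickeForm (k : ℕ) (F : ℍ → ℂ) : Prop where
  mdiff : MDiff F
  gamma0 : ∀ γ ∈ Gamma0 5, ∀ z : ℍ, F (γ • z) = ((γ 1 0 : ℂ) * z + γ 1 1) ^ k * F z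
  fricke : ∀ z : ℍ, F (fricke z) = ((√5 : ℝ) * (z : ℂ)) ^ k * F z

namespace IsFrickeForm

variable {k l : ℕ} {F G : ℍ → ℂ}

lemma mul (hF : IsFrickeForm k F) (hG : IsFrickeForm l G) : IsFrickeForm (k + l) (F * G) where
  mdiff := hF.mdiff.mul hG.mdiff
  gamma0 γ hγ z := by
    rw [Pi.mul_apply, Pi.mul_apply, hF.gamma0 γ hγ, hG.gamma0 γ hγ]; ring
  fricke z := by rw [Pi.mul_apply, Pi.mul_apply, hF.fricke, hG.fricke]; ring

lemma sub (hF : IsFrickeForm k F) (hG : IsFrickeForm k G) : IsFrickeForm k (F - G) where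
  mdiff := hF.mdiff.sub hG.mdiff
  gamma0 γ hγ z := by
    rw [Pi.sub_apply, Pi.sub_apply, hF.gamma0 γ hγ, hG.gamma0 γ hγ]; ring
  fricke z := by rw [Pi.sub_apply, Pi.sub_apply, hF.fricke, hG.fricke]; ring

lemma const_smul (c : ℂ) (hF : IsFrickeForm k F) : IsFrickeForm k (c • F) where
  mdiff := hF.mdiff.const_smul c
  gamma0 γ hγ z := by
    rw [Pi.smul_apply, Pi.smul_apply, hF.gamma0 γ hγ, smul_eq_mul, smul_eq_mul]; ring
  fricke z := by rw [Pi.smul_apply, Pi.smul_apply, hF.fricke, smul_eq_mul, smul_eq_mul]; ring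

end IsFrickeForm

/-! ### Generators of Γ₀(5) -/

lemma SL_mul_apply (A B : SL(2, ℤ)) (i j : Fin 2) :
    (A * B) i j = A i 0 * B 0 j + A i 1 * B 1 j := by
  rw [Matrix.SpecialLinearGroup.coe_mul, Matrix.mul_apply, Fin.sum_univ_two]

lemma SL_det (A : SL(2, ℤ)) : A 0 0 * A 1 1 - A 0 1 * A 1 0 = 1 := by
  rw [← Matrix.det_fin_two, A.det_coe]

lemma mem_Gamma0_five_iff {γ : SL(2, ℤ)} : γ ∈ Gamma0 5 ↔ (5 : ℤ) ∣ γ 1 0 := by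
  rw [Gamma0_mem]
  exact_mod_cast ZMod.intCast_zmod_eq_zero_iff_dvd (γ 1 0) 5

/-- `z ↦ z / (5 z + 1)`. -/
def lowerU : SL(2, ℤ) := ⟨!![1, 0; 5, 1], by simp⟩

/-- The elliptic element of `Γ₀(5)` fixing `(2 + i) / 5`. -/
def ellipticR : SL(2, ℤ) := ⟨!![2, -1; 5, -2], by simp⟩

/-- The elliptic element of `Γ₀(5)` fixing `(-2 + i) / 5`. -/
def ellipticL : SL(2, ℤ) := ⟨!![-2, -1; 5, 2], by simp⟩

/-- `Γ₀(5)` is generated by `z ↦ z + 1`, `z ↦ z / (5 z + 1)` and two elliptic elements. -/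
lemma Gamma0_five_le {G : Subgroup SL(2, ℤ)} (hT : ModularGroup.T ∈ G) (hU : lowerU ∈ G)
    (hR : ellipticR ∈ G) (hL : ellipticL ∈ G) : Gamma0 5 ≤ G := by
  have key : ∀ n : ℕ, ∀ γ : SL(2, ℤ), ∀ c : ℤ, γ 1 0 = 5 * c → c.natAbs = n → γ ∈ G := by
    intro n
    induction n using Nat.strong_induction_on with
    | _ n ih =>
    intro γ c hc hn
    have hdet := SL_det γ
    rcases eq_or_ne c 0 with rfl | hc0
    · have hc' : γ 1 0 = 0 := by simpa using hc
      have had : γ 0 0 * γ 1 1 = 1 := by rw [hc'] at hdet; linarith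
      have hneg : (-1 : SL(2, ℤ)) ∈ G := by
        have h : ellipticR * ellipticR = -1 := by
          ext i j
          rw [SL_mul_apply, Matrix.SpecialLinearGroup.coe_neg]
          fin_cases i <;> fin_cases j <;> simp [ellipticR]
        rw [← h]; exact mul_mem hR hR
      rcases Int.eq_one_or_neg_one_of_mul_eq_one' had with ⟨ha, hd⟩ | ⟨ha, hd⟩
      · have h : γ = ModularGroup.T ^ (γ 0 1) := by
          ext i j
          rw [ModularGroup.coe_T_zpow]
          fin_cases i <;> fin_cases j <;> simp [ha, hd, hc']
        rw [h]; exact zpow_mem hT _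
      · have h : γ = -1 * ModularGroup.T ^ (-(γ 0 1)) := by
          ext i j
          rw [neg_one_mul, Matrix.SpecialLinearGroup.coe_neg, ModularGroup.coe_T_zpow]
          fin_cases i <;> fin_cases j <;> simp [ha, hd, hc']
        rw [h]; exact mul_mem hneg (zpow_mem hT _)
    -- A power of T reduces the upper left entry to a residue of least absolute value modulo 5c.
    · obtain ⟨m, hm1, hm2⟩ : ∃ m : ℤ, 2 * (γ 0 0 + 5 * c * m) ≤ 5 * |c| ∧
          -(5 * |c|) ≤ 2 * (γ 0 0 + 5 * c * m) := by
        obtain ⟨t, h1, h2⟩ : ∃ t : ℤ, 0 ≤ 2 * γ 0 0 + 5 * |c| - 2 * (5 * |c|) * t ∧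
            2 * γ 0 0 + 5 * |c| - 2 * (5 * |c|) * t < 2 * (5 * |c|) := by
          have hpos : 0 < 5 * |c| := by positivity
          refine ⟨(2 * γ 0 0 + 5 * |c|) / (2 * (5 * |c|)), ?_, ?_⟩
          · rw [← Int.emod_def]; exact Int.emod_nonneg _ (by omega)
          · rw [← Int.emod_def]; exact Int.emod_lt_of_pos _ (by omega)
        rcases abs_cases c with ⟨h, -⟩ | ⟨h, -⟩
        · refine ⟨-t, ?_, ?_⟩ <;> rw [h] at h1 h2 ⊢ <;> linarith
        · refine ⟨t, ?_, ?_⟩ <;> rw [h] at h1 h2 ⊢ <;> linarith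
      set δ := ModularGroup.T ^ m * γ with hδ
      have hδ10 : δ 1 0 = 5 * c := by
        rw [hδ, SL_mul_apply, ModularGroup.coe_T_zpow]; simp [hc]
      have hδ00 : δ 0 0 = γ 0 0 + 5 * c * m := by
        rw [hδ, SL_mul_apply, ModularGroup.coe_T_zpow]; simp [hc]; ring
      rw [← hδ00] at hm1 hm2
      suffices δ ∈ G by
        have h : γ = ModularGroup.T ^ (-m) * δ := by rw [hδ, zpow_neg, inv_mul_cancel_left]
        rw [h]; exact mul_mem (zpow_mem hT _) this
      have hδdet := SL_det δ
      -- Otherwise 5 would divide the determinant.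
      have ha0 : δ 0 0 ≠ 0 := by
        intro h
        rw [h, hδ10] at hδdet
        have : (5 : ℤ) ∣ 1 := ⟨-(δ 0 1 * c), by linarith⟩
        norm_num at this
      have step : ∀ τ ∈ G, ∀ c' : ℤ, (τ * δ) 1 0 = 5 * c' → c'.natAbs < n → δ ∈ G := by
        intro τ hτ c' h1 h2
        have := ih _ h2 (τ * δ) c' h1 rfl
        exact (Subgroup.mul_mem_cancel_left G hτ).mp this
      set a := δ 0 0
      -- Descent on |c|. For 0 < |a| < 2|c| the matrix `lowerU` or its inverse replaces c by c ± a,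
      -- with the sign that makes it smaller. In the remaining range 2|c| ≤ |a| ≤ 5|c|/2 an elliptic
      -- generator replaces c by a ∓ 2c, of absolute value at most |c|/2.
      by_cases hbig : |a| < 2 * |c|
      · by_cases hsign : 0 < a * c
        · refine step lowerU⁻¹ (inv_mem hU) (c - a) ?_ ?_
          · rw [SL_mul_apply, Matrix.SpecialLinearGroup.coe_inv, Matrix.adjugate_fin_two]
            simp [lowerU, hδ10]; ring
          · rcases abs_cases a with ⟨h, h'⟩ | ⟨h, h'⟩ <;>
            rcases abs_cases c with ⟨g, g'⟩ | ⟨g, g'⟩ <;>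
            first | omega | (exfalso; nlinarith)
        · have hsign' : a * c < 0 :=
            lt_of_le_of_ne (not_lt.mp hsign) (mul_ne_zero ha0 hc0)
          refine step lowerU hU (c + a) ?_ ?_
          · rw [SL_mul_apply]
            simp [lowerU, hδ10]; ring
          · rcases abs_cases a with ⟨h, h'⟩ | ⟨h, h'⟩ <;>
            rcases abs_cases c with ⟨g, g'⟩ | ⟨g, g'⟩ <;>
            first | omega | (exfalso; nlinarith)
      · by_cases hsign : 0 < a * c
        · refine step ellipticR hR (a - 2 * c) ?_ ?_
          · rw [SL_mul_apply]
            simp [ellipticR, hδ10]; ring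
          · rcases abs_cases a with ⟨h, h'⟩ | ⟨h, h'⟩ <;>
            rcases abs_cases c with ⟨g, g'⟩ | ⟨g, g'⟩ <;>
            first | omega | (exfalso; nlinarith)
        · have hsign' : a * c < 0 :=
            lt_of_le_of_ne (not_lt.mp hsign) (mul_ne_zero ha0 hc0)
          refine step ellipticL hL (a + 2 * c) ?_ ?_
          · rw [SL_mul_apply]
            simp [ellipticL, hδ10]; ring
          · rcases abs_cases a with ⟨h, h'⟩ | ⟨h, h'⟩ <;>
            rcases abs_cases c with ⟨g, g'⟩ | ⟨g, g'⟩ <;>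
            first | omega | (exfalso; nlinarith)
  intro γ hγ
  obtain ⟨c, hc⟩ := mem_Gamma0_five_iff.mp hγ
  exact key _ γ c hc rfl

/-! ### Cusps, and vanishing of invariant functions -/

lemma coe_SL_smul (γ : SL(2, ℤ)) (z : ℍ) :
    ((γ • z : ℍ) : ℂ) = ((γ 0 0 : ℂ) * z + γ 0 1) / ((γ 1 0 : ℂ) * z + γ 1 1) := by
  rw [coe_specialLinearGroup_apply]; simp

lemma SL_denom_ne_zero (γ : SL(2, ℤ)) (z : ℍ) : (γ 1 0 : ℂ) * z + γ 1 1 ≠ 0 := by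
  simpa [ModularGroup.denom_apply] using denom_ne_zero γ z

lemma SL_slash_eq_iff {F : ℍ → ℂ} {k : ℕ} {γ : SL(2, ℤ)} :
    F ∣[(k : ℤ)] γ = F ↔ ∀ z : ℍ, F (γ • z) = ((γ 1 0 : ℂ) * z + γ 1 1) ^ k * F z := by
  rw [funext_iff]
  refine forall_congr' fun z ↦ ?_
  rw [ModularForm.SL_slash_apply, zpow_neg, zpow_natCast, ModularGroup.denom_apply,
    mul_inv_eq_iff_eq_mul₀ (pow_ne_zero _ (SL_denom_ne_zero γ z)), mul_comm]

/-- The point `z / 5`. -/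
def fifth (z : ℍ) : ℍ := ⟨(z : ℂ) / 5, by
  have h : (z : ℂ) / 5 = ((1 / 5 : ℝ) : ℂ) * z := by push_cast; ring
  rw [h, Complex.im_ofReal_mul]; exact mul_pos (by norm_num) z.im_pos⟩

lemma im_fifth (z : ℍ) : (fifth z).im = z.im / 5 := by
  have h : (z : ℂ) / 5 = ((1 / 5 : ℝ) : ℂ) * z := by push_cast; ring
  change ((z : ℂ) / 5).im = _
  rw [h, Complex.im_ofReal_mul, coe_im]; ring

lemma S_smul_eq_fricke_fifth (z : ℍ) : ModularGroup.S • z = fricke (fifth z) := by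
  ext
  rw [coe_SL_smul, coe_fricke]
  change _ = -1 / (5 * ((z : ℂ) / 5))
  simp [ModularGroup.S]
  field_simp [z.ne_zero]

/-- Γ₀(5) has the two cusps ∞ and 0. If 5 divides the lower left entry, γ itself acts trivially on
g; otherwise γ = δ S T^j with δ in Γ₀(5), and S z is the Fricke image of z/5, so the bound at ∞
carries over to heights five times larger. -/
lemma IsFrickeForm.isBoundedAtImInfty_slash {g : ℍ → ℂ} (hg : IsFrickeForm 0 g)
    (hb : IsBoundedAtImInfty g) (γ : SL(2, ℤ)) : IsBoundedAtImInfty (g ∣[(0 : ℤ)] γ) := by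
  have hslash : ∀ z, (g ∣[(0 : ℤ)] γ) z = g (γ • z) := fun z ↦ by
    rw [ModularForm.SL_slash_apply]; simp
  have hinv : ∀ δ ∈ Gamma0 5, ∀ z, g (δ • z) = g z := fun δ hδ z ↦ by
    simpa using hg.gamma0 δ hδ z
  have hfr : ∀ z, g (FrickeEisenstein.fricke z) = g z := fun z ↦ by simpa using hg.fricke z
  rw [isBoundedAtImInfty_iff] at hb ⊢
  obtain ⟨M, A, hA⟩ := hb
  by_cases h5 : (5 : ℤ) ∣ γ 1 0
  · refine ⟨M, A, fun z hz ↦ ?_⟩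
    rw [hslash, hinv γ (mem_Gamma0_five_iff.mpr h5)]
    exact hA z hz
  · have hcop : IsCoprime (γ 1 0) 5 :=
      ((Int.prime_iff_natAbs_prime.mpr (by norm_num : Nat.Prime (Int.natAbs 5))).coprime_iff_not_dvd.mpr
        h5).symm
    obtain ⟨u, v, huv⟩ := hcop
    -- With d = γ 1 1 and c = γ 1 0, the lower right entry of γ T^(−j) is d − udc = 5vd; multiplying
    -- by S⁻¹ moves it, up to sign, to the lower left.
    set j := u * γ 1 1 with hj
    refine ⟨M, 5 * A, fun z hz ↦ ?_⟩
    have hmem : γ * ModularGroup.T ^ (-j) * ModularGroup.S⁻¹ ∈ Gamma0 5 := by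
      rw [mem_Gamma0_five_iff]
      refine ⟨-(γ 1 1 * v), ?_⟩
      rw [SL_mul_apply, SL_mul_apply, SL_mul_apply, ModularGroup.coe_T_zpow,
        Matrix.SpecialLinearGroup.coe_inv, Matrix.adjugate_fin_two]
      simp [ModularGroup.S, hj]
      linear_combination γ 1 1 * huv
    have hγ : γ • z = (γ * ModularGroup.T ^ (-j) * ModularGroup.S⁻¹) •
        (ModularGroup.S • (ModularGroup.T ^ j • z)) := by
      rw [← mul_smul, ← mul_smul]; congr 1
      rw [inv_mul_cancel_right, zpow_neg, inv_mul_cancel_right]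
    rw [hslash, hγ, hinv _ hmem, S_smul_eq_fricke_fifth, hfr]
    apply hA
    rw [im_fifth, modular_T_zpow_smul, vadd_im]
    linarith

/-- A holomorphic function invariant under `Γ₀(5)` and the Fricke involution that vanishes at
infinity is zero. -/
lemma IsFrickeForm.eq_zero_of_isZeroAtImInfty {g : ℍ → ℂ} (hg : IsFrickeForm 0 g)
    (h0 : IsZeroAtImInfty g) : g = 0 := by
  have hb : IsBoundedAtImInfty g := h0.isBoundedAtImInfty
  let G : ModularForm ((Gamma0 5).map (Matrix.SpecialLinearGroup.mapGL ℝ)) 0 :=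
    { toFun := g
      slash_action_eq' := by
        rintro _ ⟨γ, hγ, rfl⟩
        exact SL_slash_eq_iff (k := 0).mpr (hg.gamma0 γ hγ)
      holo' := hg.mdiff
      bdd_at_cusps' := by
        intro c hc
        rw [Subgroup.IsArithmetic.isCusp_iff_isCusp_SL2Z] at hc
        rw [OnePoint.isBoundedAt_iff_forall_SL2Z hc]
        exact fun γ _ ↦ hg.isBoundedAtImInfty_slash hb γ }
  obtain ⟨c, hc⟩ := ModularForm.eq_const_of_weight_zero G
  have hgc : g = Function.const ℍ c := hc
  rw [hgc] at h0 ⊢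
  have : c = 0 := tendsto_nhds_unique tendsto_const_nhds h0
  rw [this]; rfl

/-- Division by the zero-free form D^m reduces weight 4m to weight 0. -/
lemma IsFrickeForm.eq_zero_of_div_tendsto {m : ℕ} {F D : ℍ → ℂ} (hF : IsFrickeForm (4 * m) F)
    (hD : IsFrickeForm 4 D) (hD0 : ∀ z, D z ≠ 0)
    (h0 : Tendsto (fun z ↦ F z / D z ^ m) atImInfty (𝓝 0)) : F = 0 := by
  have hg : IsFrickeForm 0 (fun z ↦ F z / D z ^ m) :=
    { mdiff := by
        have h1 := UpperHalfPlane.mdifferentiable_iff.mp hF.mdiff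
        have h2 := UpperHalfPlane.mdifferentiable_iff.mp hD.mdiff
        rw [UpperHalfPlane.mdifferentiable_iff]
        exact h1.div (h2.pow m) fun z _ ↦ pow_ne_zero _ (hD0 _)
      gamma0 := fun γ hγ z ↦ by
        have := SL_denom_ne_zero γ z
        rw [hF.gamma0 γ hγ, hD.gamma0 γ hγ, mul_pow, ← pow_mul, pow_zero, one_mul,
          mul_div_mul_left _ _ (pow_ne_zero _ this)]
      fricke := fun z ↦ by
        have : ((√5 : ℝ) * (z : ℂ)) ≠ 0 := mul_ne_zero (by norm_num) z.ne_zero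
        rw [hF.fricke, hD.fricke, mul_pow (((√5 : ℝ) * (z : ℂ)) ^ 4), ← pow_mul, pow_zero, one_mul,
          mul_div_mul_left _ _ (pow_ne_zero _ this)] }
  have := hg.eq_zero_of_isZeroAtImInfty h0
  ext z
  simpa [div_eq_zero_iff, hD0 z] using congrFun this z

/-! ### Level one forms, and E* as a Fricke form -/

/-- Weight `k` transformation law under `SL(2, ℤ)`. -/
def IsLevelOne (k : ℕ) (F : ℍ → ℂ) : Prop :=
  ∀ (γ : SL(2, ℤ)) (z : ℍ), F (γ • z) = ((γ 1 0 : ℂ) * z + γ 1 1) ^ k * F z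

lemma isLevelOne_of_modularFormClass {A : Type*} [FunLike A ℍ ℂ] {k : ℕ}
    [SlashInvariantFormClass A 𝒮ℒ (k : ℤ)] (f : A) : IsLevelOne k f := fun γ z ↦
  SL_slash_eq_iff.mp (SlashInvariantForm.slash_action_eqn f _ ⟨γ, rfl⟩) z

namespace IsLevelOne

variable {k : ℕ} {F : ℍ → ℂ}

lemma apply_scale_smul (hF : IsLevelOne k F) {γ : SL(2, ℤ)} (hγ : γ ∈ Gamma0 5) (z : ℍ) :
    F (scale 5 (γ • z)) = ((γ 1 0 : ℂ) * z + γ 1 1) ^ k * F (scale 5 z) := by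
  obtain ⟨c, hc⟩ := mem_Gamma0_five_iff.mp hγ
  have hdet := SL_det γ
  -- The conjugate of γ by z ↦ 5z, integral because 5 divides γ 1 0.
  let γ' : SL(2, ℤ) := ⟨!![γ 0 0, 5 * γ 0 1; c, γ 1 1], by
    rw [Matrix.det_fin_two_of]; rw [hc] at hdet; linarith⟩
  have hden := SL_denom_ne_zero γ z
  have h : scale 5 (γ • z) = γ' • scale 5 z := by
    ext
    have h2 : ((5 * c : ℤ) : ℂ) = 5 * (c : ℂ) := by push_cast; ring
    rw [hc, h2] at hden
    rw [coe_scale, coe_SL_smul, coe_SL_smul, coe_scale, hc, h2]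
    simp only [γ', Matrix.of_apply, Matrix.cons_val', Matrix.cons_val_zero, Matrix.cons_val_one,
      Matrix.cons_val_fin_one]
    have h3 : (c : ℂ) * (5 * z) + γ 1 1 ≠ 0 := by convert hden using 1; ring
    push_cast
    field_simp
  rw [h, hF]
  congr 2
  rw [coe_scale, hc]
  simp only [γ', Matrix.of_apply, Matrix.cons_val', Matrix.cons_val_zero, Matrix.cons_val_one,
    Matrix.cons_val_fin_one]
  push_cast; ring

lemma apply_S (hF : IsLevelOne k F) (z : ℍ) : F (ModularGroup.S • z) = (z : ℂ) ^ k * F z := by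
  rw [hF]; simp [ModularGroup.S]

/-- With W the Fricke involution, W z = S(5z) and 5·W z = S z. So W exchanges F(z) and F(5z) up to
powers of z and 5. -/
lemma apply_fricke (hF : IsLevelOne k F) (z : ℍ) :
    F (fricke z) = (5 * (z : ℂ)) ^ k * F (scale 5 z) := by
  have h : fricke z = ModularGroup.S • scale 5 z := by
    rw [S_smul_eq_fricke_fifth]; congr 1; ext
    change _ = (scale 5 z : ℂ) / 5
    rw [coe_scale]; ring
  rw [h, hF.apply_S, coe_scale]

lemma apply_scale_fricke (hF : IsLevelOne k F) (z : ℍ) :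
    F (scale 5 (fricke z)) = (z : ℂ) ^ k * F z := by
  have h : scale 5 (fricke z) = ModularGroup.S • z := by
    rw [S_smul_eq_fricke_fifth]; ext
    rw [coe_scale, coe_fricke, coe_fricke]
    change _ = -1 / (5 * ((z : ℂ) / 5))
    field_simp [z.ne_zero]
  rw [h, hF.apply_S]

end IsLevelOne

lemma mdifferentiable_comp_scale {F : ℍ → ℂ} (hF : MDiff F) : MDiff fun z ↦ F (scale 5 z) := by
  have h1 := UpperHalfPlane.mdifferentiable_iff.mp hF
  rw [UpperHalfPlane.mdifferentiable_iff]
  have h2 : Set.MapsTo (fun z : ℂ ↦ 5 * z) {z | 0 < z.im} {z | 0 < z.im} := fun z hz ↦ by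
    simpa using hz
  refine (h1.comp (by fun_prop) h2).congr fun z hz ↦ ?_
  simp only [Function.comp_apply]
  congr 1
  ext
  rw [coe_scale, ofComplex_apply_of_im_pos hz, ofComplex_apply_of_im_pos (h2 hz)]

lemma sqrt_five_pow {k : ℕ} (hk : Even k) : ((√5 : ℝ) : ℂ) ^ k = 5 ^ (k / 2) := by
  obtain ⟨m, rfl⟩ := hk
  rw [← two_mul, pow_mul, Nat.mul_div_cancel_left _ two_pos, ← Complex.ofReal_pow,
    Real.sq_sqrt (by norm_num)]
  norm_num

/-- The Fricke involution swaps the two summands; the weight 5^(k/2) on one of them balances the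
factors (5z)^k and z^k into (√5 z)^k. -/
lemma isFrickeForm_eisensteinFricke {k : ℕ} (hk : 3 ≤ k) (hk2 : Even k) :
    IsFrickeForm k (eisensteinFricke 5 hk) := by
  have hE : IsLevelOne k (ModularForm.E hk) := isLevelOne_of_modularFormClass _
  refine ⟨?_, fun γ hγ z ↦ ?_, fun z ↦ ?_⟩
  · have h : eisensteinFricke 5 hk = (1 / ((5 : ℂ) ^ (k / 2) + 1)) •
        ((5 : ℂ) ^ (k / 2) • (fun z ↦ ModularForm.E hk (scale 5 z)) + ⇑(ModularForm.E hk)) := by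
      ext z; simp [eisensteinFricke]
    rw [h]
    have hd : MDiff (⇑(ModularForm.E hk)) := ModularFormClass.holo _
    exact (((mdifferentiable_comp_scale hd).const_smul _).add hd).const_smul _
  · simp only [eisensteinFricke]
    rw [hE.apply_scale_smul hγ, hE γ z]; ring
  · simp only [eisensteinFricke]
    rw [hE.apply_scale_fricke, hE.apply_fricke, mul_pow, mul_pow, sqrt_five_pow hk2]
    have h5 : (5 : ℂ) ^ k = 5 ^ (k / 2) * 5 ^ (k / 2) := by
      rw [← pow_add]; congr 1; obtain ⟨m, rfl⟩ := hk2; omega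
    rw [h5]
    push_cast
    ring

/-! ### The eta product of weight 4 -/

/-- The form `η(z)^4 η(5z)^4`. -/
def etaForm (z : ℍ) : ℂ := ModularForm.eta z ^ 4 * ModularForm.eta (scale 5 z) ^ 4

lemma etaForm_ne_zero (z : ℍ) : etaForm z ≠ 0 :=
  mul_ne_zero (pow_ne_zero _ (ModularForm.eta_ne_zero z.2))
    (pow_ne_zero _ (ModularForm.eta_ne_zero (scale 5 z).2))

lemma mdifferentiable_etaForm : MDiff etaForm := by
  have h : MDiff fun z : ℍ ↦ ModularForm.eta z := by
    rw [UpperHalfPlane.mdifferentiable_iff]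
    refine DifferentiableOn.congr (f := ModularForm.eta) (fun z hz ↦
      (ModularForm.differentiableAt_eta_of_mem_upperHalfPlaneSet hz).differentiableWithinAt)
      fun z hz ↦ ?_
    simp [ofComplex_apply_of_im_pos hz]
  exact (h.pow 4).mul ((mdifferentiable_comp_scale h).pow 4)

/-- The fourth power removes the choice of square root in the transformation law of η. -/
lemma eta_S_smul_pow_four (z : ℍ) :
    ModularForm.eta (ModularGroup.S • z : ℍ) ^ 4 = -(z : ℂ) ^ 2 * ModularForm.eta z ^ 4 := by
  have h := ModularForm.eta_comp_eq_csqrt_I_inv z.2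
  have hS : ((ModularGroup.S • z : ℍ) : ℂ) = -1 / (z : ℂ) := by
    rw [coe_SL_smul]; simp [ModularGroup.S]
  have hsq : ∀ w : ℂ, w ≠ 0 → Complex.sqrt w ^ 4 = w ^ 2 := fun w hw ↦ by
    rw [Complex.sqrt, Complex.cpow_def_of_ne_zero hw, ← Complex.exp_nat_mul]
    conv_rhs => rw [← Complex.exp_log hw, ← Complex.exp_nat_mul]
    congr 1; push_cast; ring
  simp only [Function.comp_apply, Pi.smul_apply, Pi.mul_apply, smul_eq_mul] at h
  rw [hS, h, mul_pow, mul_pow, inv_pow, hsq _ Complex.I_ne_zero, hsq _ z.ne_zero, Complex.I_sq]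
  ring

lemma etaForm_fricke (z : ℍ) : etaForm (fricke z) = ((√5 : ℝ) * (z : ℂ)) ^ 4 * etaForm z := by
  have h1 : fricke z = ModularGroup.S • scale 5 z := by
    rw [S_smul_eq_fricke_fifth]; congr 1; ext
    change _ = (scale 5 z : ℂ) / 5
    rw [coe_scale]; ring
  have h2 : scale 5 (fricke z) = ModularGroup.S • z := by
    rw [S_smul_eq_fricke_fifth]; ext
    rw [coe_scale, coe_fricke, coe_fricke]
    change _ = -1 / (5 * ((z : ℂ) / 5))
    field_simp [z.ne_zero]
  unfold etaForm
  rw [h2, h1, eta_S_smul_pow_four, eta_S_smul_pow_four, mul_pow,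
    sqrt_five_pow (by decide : Even 4), coe_scale]
  ring

/-- The parameter `q = exp (2 π i z)` at infinity. -/
def nome (z : ℍ) : ℂ := Function.Periodic.qParam 1 z

lemma nome_ne_zero (z : ℍ) : nome z ≠ 0 := Function.Periodic.qParam_ne_zero _

lemma norm_nome_lt_one (z : ℍ) : ‖nome z‖ < 1 := by
  simpa [nome] using norm_qParam_lt_one 1 z

lemma tendsto_nome : Tendsto nome atImInfty (𝓝 0) := qParam_tendsto_atImInfty one_pos

lemma nome_scale (z : ℍ) : nome (scale 5 z) = nome z ^ 5 := by
  simp only [nome, Function.Periodic.qParam, coe_scale, ← Complex.exp_nat_mul]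
  congr 1; push_cast; ring

lemma nome_T_smul (z : ℍ) : nome (ModularGroup.T • z) = nome z := by
  have h : ((ModularGroup.T • z : ℍ) : ℂ) = z + 1 := by
    rw [coe_SL_smul]; simp [ModularGroup.T]
  simp only [nome, Function.Periodic.qParam, h]
  rw [Complex.ofReal_one, div_one, div_one, mul_add, mul_one, Complex.exp_periodic]

/-- Euler's product `∏ (1 - q ^ n)`. -/
def eulerProd (q : ℂ) : ℂ := ∏' n : ℕ, (1 - q ^ (n + 1))

lemma etaForm_eq (z : ℍ) :
    etaForm z = nome z * eulerProd (nome z) ^ 4 * eulerProd (nome z ^ 5) ^ 4 := by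
  have h : ∀ w : ℍ, ModularForm.eta w = Function.Periodic.qParam 24 w * eulerProd (nome w) :=
    fun w ↦ rfl
  have h24 : Function.Periodic.qParam 24 z ^ 4 * Function.Periodic.qParam 24 (scale 5 z) ^ 4 =
      nome z := by
    simp only [nome, Function.Periodic.qParam, coe_scale, ← Complex.exp_nat_mul, ← Complex.exp_add]
    congr 1; push_cast; ring
  rw [etaForm, h, h, nome_scale, ← h24]
  ring

/-- Since Δ = η²⁴, the transformation law of D is known up to a sixth root of unity; the generators
of Γ₀(5) serve to show that this root is 1. -/
lemma etaForm_pow_six (z : ℍ) :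
    etaForm z ^ 6 = ModularForm.discriminant z * ModularForm.discriminant (scale 5 z) := by
  simp only [etaForm, ModularForm.discriminant]; ring

lemma isLevelOne_discriminant : IsLevelOne 12 ModularForm.discriminant :=
  isLevelOne_of_modularFormClass CuspForm.discriminant

lemma etaForm_smul_pow_six {γ : SL(2, ℤ)} (hγ : γ ∈ Gamma0 5) (z : ℍ) :
    etaForm (γ • z) ^ 6 = (((γ 1 0 : ℂ) * z + γ 1 1) ^ 4 * etaForm z) ^ 6 := by
  rw [mul_pow, etaForm_pow_six, etaForm_pow_six, isLevelOne_discriminant.apply_scale_smul hγ,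
    isLevelOne_discriminant]
  ring

/-- An element of `Γ₀(5)` with a fixed point at which the automorphy factor is `i` acts trivially
on `etaForm`. -/
lemma etaForm_smul_of_fixed {γ : SL(2, ℤ)} (hγ : γ ∈ Gamma0 5) {p : ℍ} (hp : γ • p = p)
    (hpI : ((γ 1 0 : ℂ) * p + γ 1 1) = Complex.I) (z : ℍ) :
    etaForm (γ • z) = ((γ 1 0 : ℂ) * z + γ 1 1) ^ 4 * etaForm z := by
  set r : ℍ → ℂ := fun z ↦ etaForm (γ • z) / (((γ 1 0 : ℂ) * z + γ 1 1) ^ 4 * etaForm z) with hr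
  have hne : ∀ z : ℍ, ((γ 1 0 : ℂ) * z + γ 1 1) ^ 4 * etaForm z ≠ 0 := fun z ↦
    mul_ne_zero (pow_ne_zero _ (SL_denom_ne_zero γ z)) (etaForm_ne_zero z)
  have hcont : Continuous r := by
    have h1 : Continuous etaForm := mdifferentiable_etaForm.continuous
    refine (h1.comp (continuous_const_smul (γ : GL (Fin 2) ℝ))).div ?_ hne
    exact (((continuous_const.mul continuous_coe).add continuous_const).pow 4).mul h1
  have hr6 : ∀ z, r z ∈ {w : ℂ | w ^ 6 = 1} := fun z ↦ by
    change (etaForm (γ • z) / _) ^ 6 = 1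
    rw [div_pow, etaForm_smul_pow_six hγ, div_self (pow_ne_zero _ (hne z))]
  have hfin : {w : ℂ | w ^ 6 = 1}.Finite := by
    have : {w : ℂ | w ^ 6 = 1} = {w | w ∈ Polynomial.nthRoots 6 (1 : ℂ)} := by
      ext w; simp [Polynomial.mem_nthRoots]
    rw [this]; exact Multiset.finite_toSet _
  -- A continuous function on the connected ℍ with values in a finite set is constant, so its value
  -- at the fixed point p decides.
  have hsub := hfin.countable.isTotallyDisconnected (Set.range r)
    (by rintro _ ⟨z, rfl⟩; exact hr6 z) (isPreconnected_range hcont)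
  have h := hsub ⟨z, rfl⟩ ⟨p, rfl⟩
  have hrp : r p = 1 := by
    simp only [hr, hp, hpI, Complex.I_pow_four, one_mul, div_self (etaForm_ne_zero p)]
  rw [hrp, hr, div_eq_one_iff_eq (hne z)] at h
  exact h

lemma smul_ellipticL_rho2 : ellipticL • rho2 = rho2 := by
  ext
  have h := SL_denom_ne_zero ellipticL rho2
  rw [coe_SL_smul, div_eq_iff h]
  change _ = (⟨-2 / 5, 1 / 5⟩ : ℂ) * _
  have h2 : (rho2 : ℂ) = ⟨-2 / 5, 1 / 5⟩ := rfl
  rw [h2]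
  apply Complex.ext <;> simp [ellipticL] <;> norm_num

lemma denom_ellipticL_rho2 : ((ellipticL 1 0 : ℤ) : ℂ) * rho2 + (ellipticL 1 1 : ℤ) = Complex.I := by
  have h2 : (rho2 : ℂ) = ⟨-2 / 5, 1 / 5⟩ := rfl
  rw [h2]
  apply Complex.ext <;> simp [ellipticL]; norm_num

lemma ellipticL_mem : ellipticL ∈ Gamma0 5 := mem_Gamma0_five_iff.mpr (by simp [ellipticL])

lemma ellipticR_mem : ellipticR ∈ Gamma0 5 := mem_Gamma0_five_iff.mpr (by simp [ellipticR])

lemma etaForm_ellipticR (z : ℍ) :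
    etaForm (ellipticR • z) = ((ellipticR 1 0 : ℂ) * z + ellipticR 1 1) ^ 4 * etaForm z := by
  let p : ℍ := ⟨⟨2 / 5, 1 / 5⟩, by norm_num⟩
  have h2 : (p : ℂ) = ⟨2 / 5, 1 / 5⟩ := rfl
  refine etaForm_smul_of_fixed ellipticR_mem (p := p) ?_ ?_ z
  · ext
    have h := SL_denom_ne_zero ellipticR p
    rw [coe_SL_smul, div_eq_iff h, h2]
    apply Complex.ext <;> simp [ellipticR] <;> norm_num
  · rw [h2]
    apply Complex.ext <;> simp [ellipticR]; norm_num

lemma etaForm_T (z : ℍ) : etaForm (ModularGroup.T • z) = etaForm z := by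
  rw [etaForm_eq, etaForm_eq, nome_T_smul]

/-- As a Möbius map `lowerU` is W T⁻¹ W with W the Fricke involution, so the laws for T and W
suffice. -/
lemma etaForm_lowerU (z : ℍ) :
    etaForm (lowerU • z) = ((lowerU 1 0 : ℂ) * z + lowerU 1 1) ^ 4 * etaForm z := by
  set w : ℍ := ModularGroup.T⁻¹ • fricke z with hw
  have hwc : (w : ℂ) = -1 / (5 * (z : ℂ)) - 1 := by
    rw [hw, ← zpow_neg_one, modular_T_zpow_smul, coe_vadd, coe_fricke]; push_cast; ring
  have hden := SL_denom_ne_zero lowerU z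
  simp only [lowerU, Matrix.of_apply, Matrix.cons_val', Matrix.cons_val_zero, Matrix.cons_val_one,
    Matrix.cons_val_fin_one] at hden
  push_cast at hden
  have h1 : lowerU • z = fricke w := by
    ext
    have hw0 : -1 / (5 * (z : ℂ)) - 1 ≠ 0 := hwc ▸ w.ne_zero
    rw [coe_fricke, coe_SL_smul, hwc]
    simp only [lowerU, Matrix.of_apply, Matrix.cons_val', Matrix.cons_val_zero, Matrix.cons_val_one,
      Matrix.cons_val_fin_one]
    push_cast
    have hz := z.ne_zero
    rw [div_eq_div_iff hden (mul_ne_zero (by norm_num) hw0)]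
    field_simp
    ring
  have h2 : etaForm w = etaForm (fricke z) := by
    rw [← etaForm_T w, hw, smul_inv_smul]
  rw [h1, etaForm_fricke, h2, etaForm_fricke, mul_pow, mul_pow, sqrt_five_pow (by decide : Even 4),
    hwc]
  simp only [lowerU, Matrix.of_apply, Matrix.cons_val', Matrix.cons_val_zero, Matrix.cons_val_one,
      Matrix.cons_val_fin_one]
  push_cast
  have hz := z.ne_zero
  field_simp
  ring

lemma isFrickeForm_etaForm : IsFrickeForm 4 etaForm where
  mdiff := mdifferentiable_etaForm
  gamma0 γ hγ := by
    -- The matrices that fix D under the slash action form a subgroup, so it is enough to test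
    -- generators.
    let G : Subgroup SL(2, ℤ) :=
      { carrier := {γ | etaForm ∣[((4 : ℕ) : ℤ)] γ = etaForm}
        mul_mem' := fun {a b} ha hb ↦ by
          rw [Set.mem_ofPred_eq] at *
          rw [SlashAction.slash_mul, ha, hb]
        one_mem' := SlashAction.slash_one _ _
        inv_mem' := fun {a} ha ↦ by
          rw [Set.mem_ofPred_eq] at *
          conv_lhs => rw [← ha]
          rw [← SlashAction.slash_mul, mul_inv_cancel, SlashAction.slash_one] }
    have hG : Gamma0 5 ≤ G := by
      refine Gamma0_five_le ?_ ?_ ?_ ?_ <;> refine SL_slash_eq_iff.mpr fun z ↦ ?_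
      · rw [etaForm_T]; simp [ModularGroup.T]
      · exact etaForm_lowerU z
      · exact etaForm_ellipticR z
      · exact etaForm_smul_of_fixed ellipticL_mem smul_ellipticL_rho2 denom_ellipticL_rho2 z
    exact SL_slash_eq_iff.mp (hG hγ)
  fricke := etaForm_fricke

/-! ### Reflection in the imaginary axis -/

/-- Reflection `z ↦ -z̄` in the imaginary axis. -/
def mirror (z : ℍ) : ℍ := ⟨-(starRingEnd ℂ) z, by simpa using z.im_pos⟩

lemma coe_mirror (z : ℍ) : (mirror z : ℂ) = -(starRingEnd ℂ) z := rfl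

lemma nome_mirror (z : ℍ) : nome (mirror z) = (starRingEnd ℂ) (nome z) := by
  simp only [nome, Function.Periodic.qParam, coe_mirror, ← Complex.exp_conj]
  simp [map_ofNat]

lemma eulerProd_conj {q : ℂ} (hq : ‖q‖ < 1) :
    eulerProd ((starRingEnd ℂ) q) = (starRingEnd ℂ) (eulerProd q) := by
  rw [eulerProd, eulerProd, Multipliable.map_tprod (ModularForm.multipliable_one_sub_pow hq) _
    Complex.continuous_conj]
  simp

lemma etaForm_mirror (z : ℍ) : etaForm (mirror z) = (starRingEnd ℂ) (etaForm z) := by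
  have h := norm_nome_lt_one z
  have h5 : ‖nome z ^ 5‖ < 1 := by
    rw [norm_pow]; exact pow_lt_one₀ (norm_nonneg _) h (by norm_num)
  rw [etaForm_eq, etaForm_eq, nome_mirror, ← map_pow, eulerProd_conj h, eulerProd_conj h5]
  simp

/-- The q-coefficients of E_k are real, and reflection conjugates q. -/
lemma E_mirror {k : ℕ} (hk : 3 ≤ k) (hk2 : Even k) (z : ℍ) :
    ModularForm.E hk (mirror z) = (starRingEnd ℂ) (ModularForm.E hk z) := by
  have h1 := ModularForm.hasSum_qExpansion (h := 1) (ModularForm.E hk) one_pos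
    one_mem_strictPeriods_SL (mirror z)
  have h2 := ModularForm.hasSum_qExpansion (h := 1) (ModularForm.E hk) one_pos
    one_mem_strictPeriods_SL z
  rw [← Complex.hasSum_conj'] at h2
  refine h1.unique ?_
  convert h2 using 2 with m
  rw [map_mul, map_pow]
  congr 1
  · rw [EisensteinSeries.E_qExpansion_coeff hk hk2]
    split_ifs <;> simp [map_ofNat]
  · exact congrArg (· ^ m) (nome_mirror z)

lemma eisensteinFricke_mirror {k : ℕ} (hk : 3 ≤ k) (hk2 : Even k) (z : ℍ) :
    eisensteinFricke 5 hk (mirror z) = (starRingEnd ℂ) (eisensteinFricke 5 hk z) := by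
  have h : scale 5 (mirror z) = mirror (scale 5 z) := by
    ext; rw [coe_scale, coe_mirror, coe_mirror, coe_scale]; simp [map_ofNat]
  simp only [eisensteinFricke]
  rw [h, E_mirror hk hk2, E_mirror hk hk2]
  simp [map_ofNat]

/-! ### Truncated q-expansions -/

/-- `F` has the `q`-expansion `a + b q + c q² + d q³ + O(q⁴)` at infinity. -/
def HasExpansion (F : ℍ → ℂ) (a b c d : ℂ) : Prop :=
  (fun z ↦ F z - (a + b * nome z + c * nome z ^ 2 + d * nome z ^ 3)) =O[atImInfty]
    fun z ↦ nome z ^ 4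

lemma isBigO_nome_pow {m n : ℕ} (h : m ≤ n) :
    (fun z ↦ nome z ^ n) =O[atImInfty] fun z ↦ nome z ^ m := by
  refine IsBigO.of_bound 1 (Eventually.of_forall fun z ↦ ?_)
  rw [norm_pow, norm_pow, one_mul]
  exact pow_le_pow_of_le_one (norm_nonneg _) (norm_nome_lt_one z).le h

lemma isBigO_one_of_continuous {p : ℂ → ℂ} (hp : Continuous p) :
    (fun z ↦ p (nome z)) =O[atImInfty] fun _ ↦ (1 : ℂ) :=
  ((hp.tendsto 0).comp tendsto_nome).isBigO_one ℂ

namespace HasExpansion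

variable {F G : ℍ → ℂ} {a b c d a' b' c' d' : ℂ}

lemma tendsto (h : HasExpansion F a b c d) : Tendsto F atImInfty (𝓝 a) := by
  have h1 : Tendsto (fun z ↦ nome z ^ 4) atImInfty (𝓝 0) := by
    simpa using tendsto_nome.pow 4
  have h2 := h.trans_tendsto h1
  have h3 : Tendsto (fun z ↦ a + b * nome z + c * nome z ^ 2 + d * nome z ^ 3) atImInfty (𝓝 a) := by
    have hc : Continuous fun q : ℂ ↦ a + b * q + c * q ^ 2 + d * q ^ 3 := by fun_prop
    have := (hc.tendsto 0).comp tendsto_nome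
    simpa [Function.comp_def] using this
  simpa using h2.add h3

lemma congr (h : HasExpansion F a b c d) (ha : a = a') (hb : b = b') (hc : c = c') (hd : d = d') :
    HasExpansion F a' b' c' d' := by
  subst ha hb hc hd; exact h

lemma sub (hF : HasExpansion F a b c d) (hG : HasExpansion G a' b' c' d') :
    HasExpansion (F - G) (a - a') (b - b') (c - c') (d - d') := by
  refine (IsBigO.sub hF hG).congr_left fun z ↦ ?_
  simp only [Pi.sub_apply]; ring

lemma add (hF : HasExpansion F a b c d) (hG : HasExpansion G a' b' c' d') :
    HasExpansion (F + G) (a + a') (b + b') (c + c') (d + d') := by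
  refine (IsBigO.add hF hG).congr_left fun z ↦ ?_
  simp only [Pi.add_apply]; ring

lemma const_smul (r : ℂ) (hF : HasExpansion F a b c d) :
    HasExpansion (r • F) (r * a) (r * b) (r * c) (r * d) := by
  refine (IsBigO.const_mul_left hF r).congr_left fun z ↦ ?_
  simp only [Pi.smul_apply, smul_eq_mul]; ring

lemma mul (hF : HasExpansion F a b c d) (hG : HasExpansion G a' b' c' d') :
    HasExpansion (F * G) (a * a') (a * b' + b * a') (a * c' + b * b' + c * a')
      (a * d' + b * c' + c * b' + d * a') := by
  have hp : Continuous fun q : ℂ ↦ a + b * q + c * q ^ 2 + d * q ^ 3 := by fun_prop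
  -- The terms of degree 4 to 6 in the product of the two cubic polynomials, divided by q⁴.
  have hr : Continuous fun q : ℂ ↦ (b * d' + c * c' + d * b') + (c * d' + d * c') * q +
    d * d' * q ^ 2 := by fun_prop
  have h1 := IsBigO.mul hF (hG.tendsto.isBigO_one ℂ)
  have h2 := IsBigO.mul (isBigO_one_of_continuous hp) hG
  have h3 := (isBigO_one_of_continuous hr).mul (isBigO_refl (fun z ↦ nome z ^ 4) atImInfty)
  simp only [mul_one, one_mul] at h1 h2 h3
  refine ((h1.add h2).add h3).congr_left fun z ↦ ?_
  simp only [Pi.mul_apply]; ring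

lemma isBigO_nome_pow_four (hF : HasExpansion F 0 0 0 0) :
    F =O[atImInfty] fun z ↦ nome z ^ 4 := by
  simpa [HasExpansion] using hF

lemma isBigO_nome_pow_three (hF : HasExpansion F 0 0 0 d) :
    F =O[atImInfty] fun z ↦ nome z ^ 3 := by
  have h1 := (IsBigO.trans hF (isBigO_nome_pow (show 3 ≤ 4 by norm_num))).add
    ((isBigO_refl (fun z ↦ nome z ^ 3) atImInfty).const_mul_left d)
  refine h1.congr_left fun z ↦ ?_
  ring

lemma comp_scale (hF : HasExpansion F a b c d) :
    HasExpansion (fun z ↦ F (scale 5 z)) a 0 0 0 := by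
  have hs : Tendsto (scale 5) atImInfty atImInfty := by
    have h : UpperHalfPlane.im ∘ scale 5 = fun z ↦ 5 * z.im := by
      ext z
      rw [Function.comp_apply, ← coe_im, coe_scale]
      simp
    rw [atImInfty, tendsto_comap_iff, h]
    exact tendsto_comap.const_mul_atTop (by norm_num)
  have h1 := (hF.comp_tendsto hs).trans (k := fun z ↦ nome z ^ 4) (by
    simp only [Function.comp_def, nome_scale, ← pow_mul]
    exact isBigO_nome_pow (by norm_num))
  have hr : Continuous fun q : ℂ ↦ b * q + c * q ^ 6 + d * q ^ 11 := by fun_prop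
  have h3 := (isBigO_one_of_continuous hr).mul (isBigO_refl (fun z ↦ nome z ^ 4) atImInfty)
  simp only [one_mul] at h3
  refine (h1.add h3).congr_left fun z ↦ ?_
  simp only [Function.comp_apply, nome_scale]
  ring

end HasExpansion

/-- For finite products the left side is at most exp(Σ) − 1 ≤ 2Σ, where Σ = Σ |q|^(n+4) ≤ 2|q|⁴ ≤ 1;
then pass to the limit. -/
lemma norm_tprod_one_sub_pow_sub_one_le {q : ℂ} (hq : ‖q‖ ≤ 1 / 2) :
    ‖∏' n : ℕ, (1 - q ^ (n + 4)) - 1‖ ≤ 4 * ‖q‖ ^ 4 := by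
  have hq1 : ‖q‖ < 1 := by linarith
  have hs : Summable fun n : ℕ ↦ ‖q‖ ^ (n + 4) :=
    (summable_nat_add_iff 4).mpr (summable_geometric_of_lt_one (norm_nonneg _) hq1)
  have hmul : Multipliable fun n : ℕ ↦ 1 - q ^ (n + 4) := by
    apply multipliable_one_add_of_summable (f := fun n ↦ -q ^ (n + 4))
    simpa using hs
  have hsum : ∑' n : ℕ, ‖q‖ ^ (n + 4) ≤ 2 * ‖q‖ ^ 4 := by
    simp_rw [pow_add]
    rw [tsum_mul_right, tsum_geometric_of_lt_one (norm_nonneg _) hq1]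
    have : (1 - ‖q‖)⁻¹ ≤ 2 := by
      rw [inv_le_comm₀ (by linarith) (by norm_num)]; linarith
    gcongr
  have hsmall : 2 * ‖q‖ ^ 4 ≤ 1 := by
    have : ‖q‖ ^ 4 ≤ (1 / 2) ^ 4 := by gcongr
    linarith
  have hfin : ∀ t : Finset ℕ, ‖∏ n ∈ t, (1 - q ^ (n + 4)) - 1‖ ≤ 4 * ‖q‖ ^ 4 := fun t ↦ by
    have h1 := t.norm_prod_one_add_sub_one_le (fun n ↦ -q ^ (n + 4))
    simp only [norm_neg, norm_pow, ← sub_eq_add_neg] at h1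
    have h2 : ∑ n ∈ t, ‖q‖ ^ (n + 4) ≤ 2 * ‖q‖ ^ 4 :=
      (hs.sum_le_tsum t fun _ _ ↦ by positivity).trans hsum
    have h0 : 0 ≤ ∑ n ∈ t, ‖q‖ ^ (n + 4) := Finset.sum_nonneg fun _ _ ↦ by positivity
    have h3 := Real.abs_exp_sub_one_le (x := ∑ n ∈ t, ‖q‖ ^ (n + 4))
      (by rw [abs_of_nonneg h0]; linarith)
    rw [abs_of_nonneg h0] at h3
    linarith [le_abs_self (Real.exp (∑ n ∈ t, ‖q‖ ^ (n + 4)) - 1)]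
  have hlim : Tendsto (fun t : Finset ℕ ↦ ‖∏ n ∈ t, (1 - q ^ (n + 4)) - 1‖) atTop
      (𝓝 ‖∏' n : ℕ, (1 - q ^ (n + 4)) - 1‖) := (hmul.hasProd.sub_const 1).norm
  exact le_of_tendsto' hlim hfin

/-- The factors with exponents 1, 2, 3 are multiplied out; the remaining product is 1 + O(q⁴). -/
lemma hasExpansion_eulerProd : HasExpansion (fun z ↦ eulerProd (nome z)) 1 (-1) (-1) 0 := by
  have hev : ∀ᶠ z in atImInfty, ‖nome z‖ ≤ 1 / 2 := by
    have := tendsto_nome.norm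
    rw [norm_zero] at this
    exact (this.eventually_lt_const (by norm_num : (0 : ℝ) < 1 / 2)).mono fun _ h ↦ h.le
  have hR : HasExpansion (fun z ↦ ∏' n : ℕ, (1 - nome z ^ (n + 4))) 1 0 0 0 := by
    refine IsBigO.of_bound 4 (hev.mono fun z hz ↦ ?_)
    simpa [norm_pow] using norm_tprod_one_sub_pow_sub_one_le hz
  have hpoly : HasExpansion (fun z ↦ (1 - nome z) * (1 - nome z ^ 2) * (1 - nome z ^ 3))
      1 (-1) (-1) 0 := by
    have hr : Continuous fun q : ℂ ↦ 1 + q - q ^ 2 := by fun_prop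
    have h3 := (isBigO_one_of_continuous hr).mul (isBigO_refl (fun z ↦ nome z ^ 4) atImInfty)
    simp only [one_mul] at h3
    exact h3.congr_left fun z ↦ by ring
  have h := (hpoly.mul hR).congr (a' := 1) (b' := -1) (c' := -1) (d' := 0)
    (by ring) (by ring) (by ring) (by ring)
  convert h using 1
  ext z
  rw [eulerProd, ← Multipliable.prod_mul_tprod_nat_mul' (k := 3)]
  · simp [Finset.prod_range_succ]
  · apply multipliable_one_add_of_summable (f := fun n ↦ -nome z ^ (n + 3 + 1))
    simpa [add_assoc] using (summable_nat_add_iff 4).mpr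
      (summable_geometric_of_lt_one (norm_nonneg _) (norm_nome_lt_one z))

lemma hasExpansion_nome : HasExpansion nome 0 1 0 0 := by
  refine (isBigO_zero _ _).congr_left fun z ↦ ?_
  ring

lemma hasExpansion_etaForm : HasExpansion etaForm 0 1 (-4) 2 := by
  have h1 := hasExpansion_eulerProd
  have h2 := h1.mul h1
  have h5 : HasExpansion (fun z ↦ eulerProd (nome z ^ 5)) 1 0 0 0 := by
    simpa only [nome_scale] using h1.comp_scale
  have h6 := h5.mul h5
  have h := (hasExpansion_nome.mul (h2.mul h2)).mul (h6.mul h6)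
  have h' := h.congr (a' := 0) (b' := 1) (c' := -4) (d' := 2)
    (by ring) (by ring) (by ring) (by ring)
  convert h' using 1
  ext z
  rw [etaForm_eq]
  simp only [Pi.mul_apply]; ring

lemma hasExpansion_E {k : ℕ} (hk : 3 ≤ k) {a b c d : ℂ}
    (ha : (qExpansion 1 (ModularForm.E hk)).coeff 0 = a)
    (hb : (qExpansion 1 (ModularForm.E hk)).coeff 1 = b)
    (hc : (qExpansion 1 (ModularForm.E hk)).coeff 2 = c)
    (hd : (qExpansion 1 (ModularForm.E hk)).coeff 3 = d) :
    HasExpansion (ModularForm.E hk) a b c d := by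
  have han := ModularFormClass.analyticAt_cuspFunction_zero (h := 1) (ModularForm.E hk) one_pos
    one_mem_strictPeriods_SL
  have hs := ModularForm.hasSum_qExpansion (h := 1) (ModularForm.E hk) one_pos
    one_mem_strictPeriods_SL
  have h1 := (hasFPowerSeriesOnBall_cuspFunction one_pos han hs).hasFPowerSeriesAt.isBigO_sub_partialSum_pow 4
  have h2 := h1.comp_tendsto tendsto_nome
  refine (h2.congr' (EventuallyEq.of_eq ?_) (EventuallyEq.refl _ _)).trans ?_
  · ext z
    have : cuspFunction 1 (ModularForm.E hk) (nome z) = ModularForm.E hk z :=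
      SlashInvariantFormClass.eq_cuspFunction _ z one_mem_strictPeriods_SL one_ne_zero
    simp only [Function.comp_apply, zero_add, this]
    congr 1
    simp [FormalMultilinearSeries.partialSum, Finset.sum_range_succ, ha, hb, hc, hd]
    ring
  · refine IsBigO.of_bound 1 (Eventually.of_forall fun z ↦ ?_)
    simp

lemma hasExpansion_eisensteinFricke {k : ℕ} (hk : 3 ≤ k) {b c d : ℂ} {n : ℕ} (hn : k / 2 = n)
    (hE : HasExpansion (ModularForm.E hk) 1 b c d) :
    HasExpansion (eisensteinFricke 5 hk) 1 (b / (5 ^ n + 1)) (c / (5 ^ n + 1))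
      (d / (5 ^ n + 1)) := by
  have h0 : ((5 : ℂ) ^ n + 1) ≠ 0 := by
    have : ((5 ^ n + 1 : ℕ) : ℂ) ≠ 0 := Nat.cast_ne_zero.mpr (by positivity)
    simpa using this
  have h := ((hE.comp_scale.const_smul (5 ^ n)).add hE).const_smul (1 / (5 ^ n + 1))
  have h' := h.congr (a' := 1) (b' := b / (5 ^ n + 1)) (c' := c / (5 ^ n + 1))
    (d' := d / (5 ^ n + 1)) (by field_simp) (by field_simp; ring) (by field_simp; ring)
    (by field_simp; ring)
  convert h' using 1
  ext z
  simp [eisensteinFricke, hn]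

/-! ### Expansions of E* in weights 4, 6, 8, 10 -/

lemma bernoulli_four : bernoulli 4 = -1 / 30 := by decide +kernel
lemma bernoulli_six : bernoulli 6 = 1 / 42 := by decide +kernel
lemma bernoulli_eight : bernoulli 8 = -1 / 30 := by decide +kernel
lemma bernoulli_ten : bernoulli 10 = 5 / 66 := by decide +kernel

lemma hasExpansion_eisensteinFricke_four :
    HasExpansion (eisensteinFricke 5 (k := 4) (by norm_num)) 1 (120 / 13) (1080 / 13)
      (3360 / 13) := by
  have hE : HasExpansion (ModularForm.E (k := 4) (by norm_num)) 1 240 2160 6720 := by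
    apply hasExpansion_E <;> rw [EisensteinSeries.E_qExpansion_coeff _ (by decide)] <;>
      norm_num [bernoulli_four, show ArithmeticFunction.sigma 3 2 = 9 by decide +kernel,
        show ArithmeticFunction.sigma 3 3 = 28 by decide +kernel]
  exact (hasExpansion_eisensteinFricke _ (n := 2) rfl hE).congr rfl (by norm_num) (by norm_num)
    (by norm_num)

lemma hasExpansion_eisensteinFricke_six :
    HasExpansion (eisensteinFricke 5 (k := 6) (by norm_num)) 1 (-4) (-132) (-976) := by
  have hE : HasExpansion (ModularForm.E (k := 6) (by norm_num)) 1 (-504) (-16632) (-122976) := by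
    apply hasExpansion_E <;> rw [EisensteinSeries.E_qExpansion_coeff _ (by decide)] <;>
      norm_num [bernoulli_six, show ArithmeticFunction.sigma 5 2 = 33 by decide +kernel,
        show ArithmeticFunction.sigma 5 3 = 244 by decide +kernel]
  exact (hasExpansion_eisensteinFricke _ (n := 3) rfl hE).congr rfl (by norm_num) (by norm_num)
    (by norm_num)

lemma hasExpansion_eisensteinFricke_eight :
    HasExpansion (eisensteinFricke 5 (k := 8) (by norm_num)) 1 (240 / 313) (30960 / 313)
      (525120 / 313) := by
  have hE : HasExpansion (ModularForm.E (k := 8) (by norm_num)) 1 480 61920 1050240 := by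
    apply hasExpansion_E <;> rw [EisensteinSeries.E_qExpansion_coeff _ (by decide)] <;>
      norm_num [bernoulli_eight, show ArithmeticFunction.sigma 7 2 = 129 by decide +kernel,
        show ArithmeticFunction.sigma 7 3 = 2188 by decide +kernel]
  exact (hasExpansion_eisensteinFricke _ (n := 4) rfl hE).congr rfl (by norm_num) (by norm_num)
    (by norm_num)

lemma hasExpansion_eisensteinFricke_ten :
    HasExpansion (eisensteinFricke 5 (k := 10) (by norm_num)) 1 (-44 / 521) (-22572 / 521)
      (-866096 / 521) := by
  have hE : HasExpansion (ModularForm.E (k := 10) (by norm_num)) 1 (-264) (-135432)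
      (-5196576) := by
    apply hasExpansion_E <;> rw [EisensteinSeries.E_qExpansion_coeff _ (by decide)] <;>
      norm_num [bernoulli_ten, show ArithmeticFunction.sigma 9 2 = 513 by decide +kernel,
        show ArithmeticFunction.sigma 9 3 = 19684 by decide +kernel]
  exact (hasExpansion_eisensteinFricke _ (n := 5) rfl hE).congr rfl (by norm_num) (by norm_num)
    (by norm_num)

/-! ### Sturm bound, Hauptmodul and polynomial identities -/

lemma tendsto_etaForm_div_nome : Tendsto (fun z ↦ etaForm z / nome z) atImInfty (𝓝 1) := by
  have h5 : HasExpansion (fun z ↦ eulerProd (nome z ^ 5)) 1 0 0 0 := by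
    simpa only [nome_scale] using hasExpansion_eulerProd.comp_scale
  have h := (hasExpansion_eulerProd.tendsto.pow 4).mul (h5.tendsto.pow 4)
  simp only [one_pow, mul_one] at h
  refine h.congr fun z ↦ ?_
  rw [etaForm_eq, mul_assoc, mul_div_cancel_left₀ _ (nome_ne_zero z)]

/-- As D/q → 1, division by D^m costs exactly m powers of q. -/
lemma tendsto_div_etaForm_pow {F : ℍ → ℂ} {m n : ℕ} (hF : F =O[atImInfty] fun z ↦ nome z ^ n)
    (hmn : m < n) : Tendsto (fun z ↦ F z / etaForm z ^ m) atImInfty (𝓝 0) := by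
  have h1 := hF.mul (isBigO_refl (fun z ↦ (etaForm z ^ m)⁻¹) atImInfty)
  simp only [← div_eq_mul_inv] at h1
  refine h1.trans_tendsto ?_
  have h2 : Tendsto (fun z ↦ nome z ^ (n - m) * ((etaForm z / nome z) ^ m)⁻¹) atImInfty
      (𝓝 (0 ^ (n - m) * (1 ^ m)⁻¹)) :=
    (tendsto_nome.pow _).mul ((tendsto_etaForm_div_nome.pow m).inv₀ (by simp))
  rw [zero_pow (by omega), zero_mul] at h2
  refine h2.congr fun z ↦ ?_
  have := nome_ne_zero z
  have := etaForm_ne_zero z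
  rw [div_pow, inv_div, mul_div_assoc', ← pow_add, Nat.sub_add_cancel hmn.le]

/-- Sturm bound: a form of weight `4 m` vanishing to order more than `m` at infinity is zero. -/
lemma IsFrickeForm.eq_zero_of_isBigO {F : ℍ → ℂ} {m n : ℕ} (hF : IsFrickeForm (4 * m) F)
    (h : F =O[atImInfty] fun z ↦ nome z ^ n) (hmn : m < n) : F = 0 :=
  hF.eq_zero_of_div_tendsto isFrickeForm_etaForm etaForm_ne_zero (tendsto_div_etaForm_pow h hmn)

/-- The numerator of the Hauptmodul. -/
def hauptNum : ℍ → ℂ := eisensteinFricke 5 (k := 4) (by norm_num) - (-36 / 13 : ℂ) • etaForm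

/-- The Hauptmodul of the Fricke group of level `5` with simple pole `1/q + 16 + ⋯` at infinity. -/
def hauptmodul (z : ℍ) : ℂ := hauptNum z / etaForm z

lemma isFrickeForm_hauptNum : IsFrickeForm 4 hauptNum :=
  (isFrickeForm_eisensteinFricke _ (by decide)).sub (isFrickeForm_etaForm.const_smul _)

lemma hasExpansion_hauptNum : HasExpansion hauptNum 1 12 72 264 :=
  (hasExpansion_eisensteinFricke_four.sub (hasExpansion_etaForm.const_smul _)).congr
    (by norm_num) (by norm_num) (by norm_num) (by norm_num)

lemma hauptNum_eq (z : ℍ) : hauptNum z = etaForm z * hauptmodul z := by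
  rw [hauptmodul, mul_div_cancel₀ _ (etaForm_ne_zero z)]

lemma eisensteinFricke_four_eq (z : ℍ) : eisensteinFricke 5 (k := 4) (by norm_num) z =
    etaForm z * (hauptmodul z - 36 / 13) := by
  rw [mul_sub, ← hauptNum_eq]
  simp only [hauptNum, Pi.sub_apply, Pi.smul_apply, smul_eq_mul]
  ring

/-- Weight 6 is not a multiple of 4, so the square is used: in weight 12 the Sturm bound asks for
O(q⁴), which the four known coefficients give exactly. The shift 36/13 in the Hauptmodul is what
makes 0 a root of the cubic. -/
lemma eisensteinFricke_six_sq_eq (z : ℍ) : eisensteinFricke 5 (k := 6) (by norm_num) z ^ 2 =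
    etaForm z ^ 3 * (hauptmodul z * (hauptmodul z ^ 2 - 44 * hauptmodul z - 16)) := by
  have h6 := isFrickeForm_eisensteinFricke (k := 6) (by norm_num) (by decide)
  have hG := isFrickeForm_hauptNum
  have hD := isFrickeForm_etaForm
  have e6 := hasExpansion_eisensteinFricke_six
  have eG := hasExpansion_hauptNum
  have eD := hasExpansion_etaForm
  set f := eisensteinFricke 5 (k := 6) (by norm_num)
  have hF : IsFrickeForm (4 * 3) (f * f - (hauptNum * hauptNum * hauptNum -
      (44 : ℂ) • (hauptNum * hauptNum * etaForm) - (16 : ℂ) • (hauptNum * etaForm * etaForm))) :=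
    (h6.mul h6).sub ((((hG.mul hG).mul hG).sub (((hG.mul hG).mul hD).const_smul 44)).sub
      (((hG.mul hD).mul hD).const_smul 16))
  have eF := ((e6.mul e6).sub ((((eG.mul eG).mul eG).sub (((eG.mul eG).mul eD).const_smul 44)).sub
      (((eG.mul eD).mul eD).const_smul 16))).congr (a' := 0) (b' := 0) (c' := 0) (d' := 0)
      (by norm_num) (by norm_num) (by norm_num) (by norm_num)
  have h0 := congrFun (hF.eq_zero_of_isBigO eF.isBigO_nome_pow_four (by norm_num)) z
  simp only [Pi.sub_apply, Pi.mul_apply, Pi.smul_apply, smul_eq_mul, Pi.zero_apply,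
    hauptNum_eq] at h0
  linear_combination h0

lemma eisensteinFricke_eight_eq (z : ℍ) : eisensteinFricke 5 (k := 8) (by norm_num) z =
    etaForm z ^ 2 * (hauptmodul z ^ 2 - 7272 / 313 * hauptmodul z - 1008 / 313) := by
  have h8 := isFrickeForm_eisensteinFricke (k := 8) (by norm_num) (by decide)
  have hG := isFrickeForm_hauptNum
  have hD := isFrickeForm_etaForm
  have e8 := hasExpansion_eisensteinFricke_eight
  have eG := hasExpansion_hauptNum
  have eD := hasExpansion_etaForm
  set f := eisensteinFricke 5 (k := 8) (by norm_num)
  have hF : IsFrickeForm (4 * 2) (f - (hauptNum * hauptNum -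
      (7272 / 313 : ℂ) • (hauptNum * etaForm) - (1008 / 313 : ℂ) • (etaForm * etaForm))) :=
    h8.sub (((hG.mul hG).sub ((hG.mul hD).const_smul _)).sub ((hD.mul hD).const_smul _))
  have eF := (e8.sub (((eG.mul eG).sub ((eG.mul eD).const_smul (7272 / 313))).sub
      ((eD.mul eD).const_smul (1008 / 313)))).congr (a' := 0) (b' := 0) (c' := 0) (d' := 0)
      (by norm_num) (by norm_num) (by norm_num) (by norm_num)
  have h0 := congrFun (hF.eq_zero_of_isBigO eF.isBigO_nome_pow_four (by norm_num)) z
  simp only [Pi.sub_apply, Pi.mul_apply, Pi.smul_apply, smul_eq_mul, Pi.zero_apply,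
    hauptNum_eq] at h0
  linear_combination h0

lemma eisensteinFricke_ten_eq (z : ℍ) : eisensteinFricke 5 (k := 10) (by norm_num) z =
    eisensteinFricke 5 (k := 6) (by norm_num) z *
      (etaForm z * (hauptmodul z - 4212 / 521)) := by
  have h10 := isFrickeForm_eisensteinFricke (k := 10) (by norm_num) (by decide)
  have h6 := isFrickeForm_eisensteinFricke (k := 6) (by norm_num) (by decide)
  have hG := isFrickeForm_hauptNum
  have hD := isFrickeForm_etaForm
  have e10 := hasExpansion_eisensteinFricke_ten
  have e6 := hasExpansion_eisensteinFricke_six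
  have eG := hasExpansion_hauptNum
  have eD := hasExpansion_etaForm
  set f := eisensteinFricke 5 (k := 10) (by norm_num)
  set g := eisensteinFricke 5 (k := 6) (by norm_num)
  have hX : IsFrickeForm 10 (f - g * (hauptNum - (4212 / 521 : ℂ) • etaForm)) :=
    h10.sub (h6.mul (hG.sub (hD.const_smul _)))
  have eX := (e10.sub (e6.mul (eG.sub (eD.const_smul (4212 / 521))))).congr
    (a' := 0) (b' := 0) (c' := 0) (d' := 0)
      (by norm_num) (by norm_num) (by norm_num) (by norm_num)
  -- Weight 10 is not a multiple of 4, so the bound is applied to the square of the difference, of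
  -- weight 20 = 4·5 and size O(q⁸).
  have hO := eX.isBigO_nome_pow_four.mul eX.isBigO_nome_pow_four
  simp only [← pow_add] at hO
  have h0 := congrFun (IsFrickeForm.eq_zero_of_isBigO (m := 5) (hX.mul hX) hO (by norm_num)) z
  have h0 := mul_self_eq_zero.mp h0
  simp only [Pi.sub_apply, Pi.mul_apply, Pi.smul_apply, smul_eq_mul, hauptNum_eq] at h0
  linear_combination h0

/-! ### Symmetries of the Hauptmodul and its reality on the boundary -/

lemma mdifferentiable_hauptmodul : MDiff hauptmodul := by
  have h1 := UpperHalfPlane.mdifferentiable_iff.mp isFrickeForm_hauptNum.mdiff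
  have h2 := UpperHalfPlane.mdifferentiable_iff.mp mdifferentiable_etaForm
  rw [UpperHalfPlane.mdifferentiable_iff]
  exact h1.div h2 fun z _ ↦ etaForm_ne_zero _

lemma hauptmodul_smul {γ : SL(2, ℤ)} (hγ : γ ∈ Gamma0 5) (z : ℍ) :
    hauptmodul (γ • z) = hauptmodul z := by
  rw [hauptmodul, isFrickeForm_hauptNum.gamma0 γ hγ, isFrickeForm_etaForm.gamma0 γ hγ,
    mul_div_mul_left _ _ (pow_ne_zero _ (SL_denom_ne_zero γ z)), hauptmodul]

lemma hauptmodul_fricke (z : ℍ) : hauptmodul (fricke z) = hauptmodul z := by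
  have : ((√5 : ℝ) * (z : ℂ)) ≠ 0 := mul_ne_zero (by norm_num) z.ne_zero
  rw [hauptmodul, isFrickeForm_hauptNum.fricke, isFrickeForm_etaForm.fricke,
    mul_div_mul_left _ _ (pow_ne_zero _ this), hauptmodul]

lemma hauptmodul_mirror (z : ℍ) : hauptmodul (mirror z) = (starRingEnd ℂ) (hauptmodul z) := by
  simp only [hauptmodul, hauptNum, Pi.sub_apply, Pi.smul_apply, smul_eq_mul]
  rw [eisensteinFricke_mirror _ (by decide), etaForm_mirror]
  simp [map_ofNat]

/-- The element `z ↦ (3 z - 1) / (-5 z + 2)` of `Γ₀(5)`. -/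
def gammaV : SL(2, ℤ) := ⟨!![3, -1; -5, 2], by simp⟩

lemma gammaV_mem : gammaV ∈ Gamma0 5 := mem_Gamma0_five_iff.mpr (by simp [gammaV])

lemma T_mem : ModularGroup.T ∈ Gamma0 5 := mem_Gamma0_five_iff.mpr (by simp [ModularGroup.T])

lemma coe_gammaV_smul_fricke (z : ℍ) :
    ((gammaV • fricke z : ℍ) : ℂ) = -(5 * z + 3) / (10 * z + 5) := by
  have h := SL_denom_ne_zero gammaV (fricke z)
  have hz := z.ne_zero
  rw [coe_fricke] at h
  rw [coe_SL_smul, coe_fricke]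
  simp only [gammaV, Matrix.of_apply, Matrix.cons_val', Matrix.cons_val_zero, Matrix.cons_val_one,
      Matrix.cons_val_fin_one] at h ⊢
  push_cast at h ⊢
  have h10 : (10 * z + 5 : ℂ) ≠ 0 := by
    intro h0; apply h; field_simp; linear_combination (1 / 5) * h0
  rw [div_eq_div_iff h h10]
  field_simp
  ring

lemma T_smul_mirror_of_re {z : ℍ} (hz : z.re = -1 / 2) : ModularGroup.T • z = mirror z := by
  ext
  rw [coe_SL_smul, coe_mirror]
  apply Complex.ext
  · simp [ModularGroup.T, hz]; norm_num
  · simp [ModularGroup.T]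

lemma mirror_eq_self_of_re {z : ℍ} (hz : z.re = 0) : mirror z = z := by
  ext
  rw [coe_mirror]
  apply Complex.ext <;> simp [hz]

lemma fricke_eq_mirror {z : ℍ} (hz : z.re ^ 2 + z.im ^ 2 = 1 / 5) : fricke z = mirror z := by
  ext
  have h0 : (5 * (z : ℂ)) ≠ 0 := mul_ne_zero (by norm_num) z.ne_zero
  rw [coe_fricke, coe_mirror, div_eq_iff h0]
  have h := Complex.normSq_eq_conj_mul_self (z := (z : ℂ))
  have h2 : (Complex.normSq z : ℂ) = 1 / 5 := by
    rw [Complex.normSq_apply, coe_re, coe_im, ← sq, ← sq, hz]; push_cast; rfl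
  rw [h2] at h
  linear_combination -5 * h

/-- The composite is z ↦ (5z + 2)/(10z + 5); the equation of the circle says exactly that this
equals −z̄. -/
lemma gammaV_smul_fricke_eq {z : ℍ} (hz : (z.re + 1 / 2) ^ 2 + z.im ^ 2 = 1 / 20) :
    ModularGroup.T • (gammaV • fricke z) = mirror z := by
  ext
  have h0 : (10 * z + 5 : ℂ) ≠ 0 := by
    intro h
    have := congrArg Complex.im h
    simp at this
    exact z.im_pos.ne' this
  have hT : ∀ w : ℍ, ((ModularGroup.T • w : ℍ) : ℂ) = w + 1 := fun w ↦ by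
    rw [coe_SL_smul]; simp [ModularGroup.T]
  have h := Complex.normSq_eq_conj_mul_self (z := (z : ℂ) + 1 / 2)
  have h2 : (Complex.normSq ((z : ℂ) + 1 / 2) : ℂ) = 1 / 20 := by
    rw [Complex.normSq_apply]
    have h1 : ((z : ℂ) + 1 / 2).re = z.re + 1 / 2 := by simp
    have h2 : ((z : ℂ) + 1 / 2).im = z.im := by simp
    rw [h1, h2, ← sq, ← sq, hz]; push_cast; rfl
  rw [h2, map_add, map_div₀, map_one, map_ofNat] at h
  rw [hT, coe_gammaV_smul_fricke, coe_mirror, div_add_one h0, div_eq_iff h0]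
  linear_combination -10 * h

lemma hauptmodul_im_eq_zero_of_mirror {z : ℍ} (h : hauptmodul (mirror z) = hauptmodul z) :
    (hauptmodul z).im = 0 := by
  rw [hauptmodul_mirror] at h
  exact Complex.conj_eq_iff_im.mp h

lemma hauptmodul_im_of_re_eq_zero {z : ℍ} (hz : z.re = 0) : (hauptmodul z).im = 0 :=
  hauptmodul_im_eq_zero_of_mirror (by rw [mirror_eq_self_of_re hz])

lemma hauptmodul_im_of_re_eq_neg_half {z : ℍ} (hz : z.re = -1 / 2) : (hauptmodul z).im = 0 :=
  hauptmodul_im_eq_zero_of_mirror (by rw [← T_smul_mirror_of_re hz, hauptmodul_smul T_mem])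

lemma hauptmodul_im_of_circle {z : ℍ} (hz : z.re ^ 2 + z.im ^ 2 = 1 / 5) :
    (hauptmodul z).im = 0 :=
  hauptmodul_im_eq_zero_of_mirror (by rw [← fricke_eq_mirror hz, hauptmodul_fricke])

lemma hauptmodul_im_of_circle' {z : ℍ} (hz : (z.re + 1 / 2) ^ 2 + z.im ^ 2 = 1 / 20) :
    (hauptmodul z).im = 0 :=
  hauptmodul_im_eq_zero_of_mirror (by
    rw [← gammaV_smul_fricke_eq hz, hauptmodul_smul T_mem, hauptmodul_smul gammaV_mem,
      hauptmodul_fricke])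

/-! ### Forced zeros in weight 6 -/

/-- A form of weight `6` vanishes where the automorphy factor is `i`. -/
lemma IsFrickeForm.apply_pointI {F : ℍ → ℂ} (hF : IsFrickeForm 6 F) : F pointI = 0 := by
  have h5 : (0 : ℝ) < √5 := by positivity
  have hc : (pointI : ℂ) = ⟨0, 1 / √5⟩ := rfl
  have hI : ((√5 : ℝ) : ℂ) * (pointI : ℂ) = Complex.I := by
    rw [hc]; apply Complex.ext <;> simp
  have hfix : FrickeEisenstein.fricke pointI = pointI := by
    rw [fricke_eq_mirror, mirror_eq_self_of_re]
    · rfl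
    · change (0 : ℝ) ^ 2 + (1 / √5) ^ 2 = 1 / 5
      rw [div_pow, Real.sq_sqrt (by norm_num)]; norm_num
  have h := hF.fricke pointI
  rw [hfix, hI] at h
  have : Complex.I ^ 6 = -1 := by
    rw [show 6 = 4 + 2 by norm_num, pow_add, Complex.I_pow_four, Complex.I_sq, one_mul]
  rw [this] at h
  linear_combination (1 / 2) * h

lemma IsFrickeForm.apply_rho2 {F : ℍ → ℂ} (hF : IsFrickeForm 6 F) : F rho2 = 0 := by
  have h := hF.gamma0 _ ellipticL_mem rho2
  have : Complex.I ^ 6 = -1 := by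
    rw [show 6 = 4 + 2 by norm_num, pow_add, Complex.I_pow_four, Complex.I_sq, one_mul]
  rw [smul_ellipticL_rho2, denom_ellipticL_rho2, this] at h
  linear_combination (1 / 2) * h

/-- The stabilizing map is `gammaV` after the Fricke involution. Its total automorphy factor √5(2z +
1) equals i at this corner. -/
lemma IsFrickeForm.apply_rho1 {F : ℍ → ℂ} (hF : IsFrickeForm 6 F) : F rho1 = 0 := by
  have h5 : (0 : ℝ) < √5 := by positivity
  have hc : (rho1 : ℂ) = ⟨-1 / 2, 1 / (2 * √5)⟩ := rfl
  have hre : rho1.re = -1 / 2 := rfl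
  have hcirc : (rho1.re + 1 / 2) ^ 2 + rho1.im ^ 2 = 1 / 20 := by
    change (-1 / 2 + 1 / 2 : ℝ) ^ 2 + (1 / (2 * √5)) ^ 2 = 1 / 20
    rw [div_pow, mul_pow, Real.sq_sqrt (by norm_num)]; norm_num
  have hfix : gammaV • FrickeEisenstein.fricke rho1 = rho1 := by
    have h1 := gammaV_smul_fricke_eq hcirc
    rw [← T_smul_mirror_of_re hre] at h1
    exact (MulAction.injective ModularGroup.T) h1
  have h := hF.gamma0 _ gammaV_mem (FrickeEisenstein.fricke rho1)
  rw [hfix, hF.fricke, ← mul_assoc, ← mul_pow] at h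
  have hI : ((((gammaV 1 0 : ℤ) : ℂ) * (FrickeEisenstein.fricke rho1 : ℂ) + (gammaV 1 1 : ℤ)) *
      (((√5 : ℝ) : ℂ) * (rho1 : ℂ))) = Complex.I := by
    have hz := rho1.ne_zero
    rw [coe_fricke]
    simp only [gammaV, Matrix.of_apply, Matrix.cons_val', Matrix.cons_val_zero,
      Matrix.cons_val_one, Matrix.cons_val_fin_one]
    push_cast
    have h1 : (-5 * (-1 / (5 * (rho1 : ℂ))) + 2) * (((√5 : ℝ) : ℂ) * rho1) =
        ((√5 : ℝ) : ℂ) * (2 * rho1 + 1) := by field_simp; ring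
    rw [h1, hc]
    apply Complex.ext <;> simp
    · ring_nf
    · field_simp
  have : Complex.I ^ 6 = -1 := by
    rw [show 6 = 4 + 2 by norm_num, pow_add, Complex.I_pow_four, Complex.I_sq, one_mul]
  rw [hI, this] at h
  linear_combination (1 / 2) * h

/-! ### Positivity of the imaginary part in the left half -/

/-- With G = hD, the difference h − 1/q − 16 equals (qG − D − 16qD)/D² · (D/q), whose numerator is
O(q³). -/
lemma tendsto_hauptmodul_sub : Tendsto (fun z ↦ hauptmodul z - (nome z)⁻¹) atImInfty (𝓝 16) := by
  have e := ((hasExpansion_nome.mul hasExpansion_hauptNum).sub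
    (hasExpansion_etaForm.add ((hasExpansion_nome.mul hasExpansion_etaForm).const_smul 16))).congr
    (a' := 0) (b' := 0) (c' := 0) (by ring) (by ring) (by ring) rfl
  have h := (tendsto_div_etaForm_pow (m := 2) e.isBigO_nome_pow_three (by norm_num)).mul
    tendsto_etaForm_div_nome
  have h' := h.add_const 16
  rw [mul_one, zero_add] at h'
  refine h'.congr fun z ↦ ?_
  have h1 := nome_ne_zero z
  have h2 := etaForm_ne_zero z
  simp only [Pi.sub_apply, Pi.mul_apply, Pi.add_apply, Pi.smul_apply, smul_eq_mul, hauptNum_eq]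
  field_simp
  ring

/-- The Hauptmodul as a function on `ℂ`. -/
def hauptC : ℂ → ℂ := hauptmodul ∘ ofComplex

lemma hauptC_coe (z : ℍ) : hauptC z = hauptmodul z := by simp [hauptC]

lemma hauptC_of_pos {z : ℂ} (hz : 0 < z.im) : hauptC z = hauptmodul ⟨z, hz⟩ :=
  hauptC_coe ⟨z, hz⟩

lemma differentiableOn_hauptC : DifferentiableOn ℂ hauptC {z | 0 < z.im} :=
  UpperHalfPlane.mdifferentiable_iff.mp mdifferentiable_hauptmodul

lemma analyticAt_hauptC {z : ℂ} (hz : 0 < z.im) : AnalyticAt ℂ hauptC z :=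
  differentiableOn_hauptC.analyticAt (isOpen_upperHalfPlaneSet.mem_nhds hz)

/-- By the identity theorem h would be constant on ℍ, against its pole 1/q at ∞. -/
lemma not_eventually_hauptC_eq {p : ℂ} (hp : 0 < p.im) : ¬ ∀ᶠ z in 𝓝 p, hauptC z = hauptC p := by
  intro h
  have hpre : IsPreconnected {z : ℂ | 0 < z.im} := (convex_halfSpace_im_gt 0).isPreconnected
  have hA : AnalyticOnNhd ℂ hauptC {z : ℂ | 0 < z.im} := fun z hz ↦ analyticAt_hauptC hz
  have heq := hA.eqOn_of_preconnected_of_eventuallyEq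
    (g := fun _ ↦ hauptC p) (fun _ _ ↦ analyticAt_const) hpre hp h
  have h1 : Tendsto (fun z : ℍ ↦ nome z * (hauptmodul z - (nome z)⁻¹)) atImInfty (𝓝 (0 * 16)) :=
    tendsto_nome.mul tendsto_hauptmodul_sub
  have h2 : Tendsto (fun z : ℍ ↦ nome z * hauptC p - 1) atImInfty (𝓝 (0 * hauptC p - 1)) :=
    (tendsto_nome.mul_const _).sub_const 1
  have h3 : (fun z : ℍ ↦ nome z * (hauptmodul z - (nome z)⁻¹)) =
      fun z : ℍ ↦ nome z * hauptC p - 1 := by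
    ext z
    have : hauptmodul z = hauptC p := by rw [← hauptC_coe]; exact heq z.2
    rw [this, mul_sub, mul_inv_cancel₀ (nome_ne_zero z)]
  rw [h3] at h1
  have := tendsto_nhds_unique h1 h2
  norm_num at this

/-- The interior of the left half of the fundamental domain. -/
def leftHalf : Set ℂ :=
  {z | 0 < z.im ∧ -1 / 2 < z.re ∧ z.re < 0 ∧ 1 / 5 < z.re ^ 2 + z.im ^ 2 ∧
    1 / 20 < (z.re + 1 / 2) ^ 2 + z.im ^ 2}

lemma isOpen_leftHalf : IsOpen leftHalf := by
  simp only [leftHalf, Set.ofPred_and]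
  refine .inter ?_ <| .inter ?_ <| .inter ?_ <| .inter ?_ ?_ <;>
    exact isOpen_lt (by fun_prop) (by fun_prop)

/-- The closed region does not touch the real axis: with y = 0 the first circle forces x ≤ −2/5, and
then (x + 1/2)² ≤ 1/100 < 1/20. This keeps h differentiable on the closure. -/
lemma im_pos_of_closed_conditions {x y : ℝ} (h0 : 0 ≤ y) (h1 : -1 / 2 ≤ x) (h2 : x ≤ 0)
    (h3 : 1 / 5 ≤ x ^ 2 + y ^ 2) (h4 : 1 / 20 ≤ (x + 1 / 2) ^ 2 + y ^ 2) : 0 < y := by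
  rcases h0.lt_or_eq with h | h
  · exact h
  · subst h
    have : -x ≥ 2 / 5 := by nlinarith
    nlinarith

lemma im_inv_nome_nonneg {z : ℍ} (h1 : -1 / 2 ≤ z.re) (h2 : z.re ≤ 0) : 0 ≤ ((nome z)⁻¹).im := by
  rw [nome, Function.Periodic.qParam, ← Complex.exp_neg, Complex.exp_im]
  have : (-(2 * Real.pi * Complex.I * (z : ℂ) / (1 : ℝ))).im = 2 * Real.pi * (-z.re) := by simp
  rw [this]
  refine mul_nonneg (Real.exp_pos _).le (Real.sin_nonneg_of_nonneg_of_le_pi ?_ ?_) <;>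
    nlinarith [Real.pi_pos]

lemma exists_im_hauptmodul_ge {ε : ℝ} (hε : 0 < ε) : ∃ Y : ℝ, ∀ z : ℍ, Y ≤ z.im →
    -1 / 2 ≤ z.re → z.re ≤ 0 → -ε ≤ (hauptmodul z).im := by
  have h := tendsto_hauptmodul_sub.eventually (Metric.ball_mem_nhds _ hε)
  obtain ⟨Y, hY⟩ := (atImInfty_mem _).mp h
  refine ⟨Y, fun z hz h1 h2 ↦ ?_⟩
  have h3 : ‖hauptmodul z - (nome z)⁻¹ - 16‖ < ε := by simpa [dist_eq_norm] using hY z hz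
  have h4 := (abs_le.mp ((Complex.abs_im_le_norm _).trans h3.le)).1
  have h5 := im_inv_nome_nonneg h1 h2
  simp only [Complex.sub_im, Complex.im_ofNat] at h4
  linarith

lemma hauptC_im_eq_zero_of_pos {w : ℂ} (hw : 0 < w.im)
    (h : w.re = -1 / 2 ∨ w.re = 0 ∨ w.re ^ 2 + w.im ^ 2 = 1 / 5 ∨
      (w.re + 1 / 2) ^ 2 + w.im ^ 2 = 1 / 20) : (hauptC w).im = 0 := by
  rw [hauptC_of_pos hw]
  rcases h with h | h | h | h
  · exact hauptmodul_im_of_re_eq_neg_half h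
  · exact hauptmodul_im_of_re_eq_zero h
  · exact hauptmodul_im_of_circle h
  · exact hauptmodul_im_of_circle' h

/-- Maximum principle for exp(ih), of modulus exp(−Im h), on the region cut off at a large height.
On the sides h is real; on the top edge h is close to 1/q + 16 with Im(1/q) ≥ 0, which costs an
arbitrarily small ε. -/
lemma hauptC_im_nonneg {z : ℂ} (hz : z ∈ leftHalf) : 0 ≤ (hauptC z).im := by
  refine le_of_forall_pos_sub_le fun ε hε ↦ ?_
  obtain ⟨Y₀, hY₀⟩ := exists_im_hauptmodul_ge hε
  set Y := max Y₀ (z.im + 1)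
  set U : Set ℂ := leftHalf ∩ {w | w.im < Y} with hU
  set C : Set ℂ := {w | 0 ≤ w.im ∧ -1 / 2 ≤ w.re ∧ w.re ≤ 0 ∧ 1 / 5 ≤ w.re ^ 2 + w.im ^ 2 ∧
    1 / 20 ≤ (w.re + 1 / 2) ^ 2 + w.im ^ 2 ∧ w.im ≤ Y} with hC
  have hUo : IsOpen U := isOpen_leftHalf.inter (isOpen_lt Complex.continuous_im continuous_const)
  have hCc : IsClosed C := by
    simp only [hC, Set.ofPred_and]
    refine .inter ?_ <| .inter ?_ <| .inter ?_ <| .inter ?_ <| .inter ?_ ?_ <;>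
      exact isClosed_le (by fun_prop) (by fun_prop)
  have hUC : closure U ⊆ C := closure_minimal
    (fun w hw ↦ ⟨hw.1.1.le, hw.1.2.1.le, hw.1.2.2.1.le, hw.1.2.2.2.1.le, hw.1.2.2.2.2.le, hw.2.le⟩)
    hCc
  have hpos : ∀ w ∈ closure U, 0 < w.im := fun w hw ↦ by
    obtain ⟨h1, h2, h3, h4, h5, -⟩ := hUC hw
    exact im_pos_of_closed_conditions h1 h2 h3 h4 h5
  have hbd : Bornology.IsBounded U := by
    refine (Metric.isBounded_closedBall (x := (0 : ℂ)) (r := 1 / 2 + Y)).subset fun w hw ↦ ?_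
    rw [mem_closedBall_zero_iff]
    refine (Complex.norm_le_abs_re_add_abs_im w).trans (add_le_add ?_ ?_)
    · exact abs_le.mpr ⟨by linarith [hw.1.2.1], by linarith [hw.1.2.2.1]⟩
    · exact abs_le.mpr ⟨by linarith [hw.1.1, show w.im < Y from hw.2], (show w.im < Y from hw.2).le⟩
  have hd : DiffContOnCl ℂ (fun w ↦ Complex.exp (Complex.I * hauptC w)) U := by
    refine DifferentiableOn.diffContOnCl ?_
    exact ((differentiableOn_hauptC.mono hpos).const_mul _).cexp
  have hnorm : ∀ w, ‖Complex.exp (Complex.I * hauptC w)‖ = Real.exp (-(hauptC w).im) := fun w ↦ by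
    rw [Complex.norm_exp]; simp
  have hfr : ∀ w ∈ frontier U, ‖Complex.exp (Complex.I * hauptC w)‖ ≤ Real.exp ε := by
    intro w hw
    rw [hUo.frontier_eq] at hw
    rw [hnorm, Real.exp_le_exp, neg_le]
    have hwp := hpos w hw.1
    obtain ⟨h1, h2, h3, h4, h5, h6⟩ := hUC hw.1
    by_cases hy : Y ≤ w.im
    · rw [hauptC_of_pos hwp]
      exact hY₀ _ ((le_max_left _ _).trans hy) h2 h3
    · rw [hauptC_im_eq_zero_of_pos hwp]
      · linarith
      · by_contra! hcon
        exact hw.2 ⟨⟨hwp, lt_of_le_of_ne h2 hcon.1.symm, lt_of_le_of_ne h3 hcon.2.1,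
          lt_of_le_of_ne h4 hcon.2.2.1.symm, lt_of_le_of_ne h5 hcon.2.2.2.symm⟩, not_le.mp hy⟩
  have hzU : z ∈ U := ⟨hz, lt_of_lt_of_le (lt_add_one z.im) (le_max_right Y₀ (z.im + 1))⟩
  have := Complex.norm_le_of_forall_mem_frontier_norm_le hbd hd hfr (subset_closure hzU)
  rw [hnorm, Real.exp_le_exp] at this
  linarith

/-- By the open mapping theorem a real value at an interior point would be accompanied by values in
the lower half plane. -/
lemma hauptC_im_pos {z : ℂ} (hz : z ∈ leftHalf) : 0 < (hauptC z).im := by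
  refine (hauptC_im_nonneg hz).lt_of_ne fun h0 ↦ ?_
  rcases (analyticAt_hauptC hz.1).eventually_constant_or_nhds_le_map_nhds with h | h
  · exact not_eventually_hauptC_eq hz.1 h
  · have h1 : {w : ℂ | 0 ≤ w.im} ∈ 𝓝 (hauptC z) := by
      refine h (mem_map.mpr ?_)
      exact mem_of_superset (isOpen_leftHalf.mem_nhds hz) fun w hw ↦ hauptC_im_nonneg hw
    rw [← mem_interior_iff_mem_nhds, Complex.interior_setOfPred_le_im] at h1
    exact h1.ne h0

/-! ### Local order and direction at boundary points -/

/-- Dividing Im f(p + εu) by εⁿ and letting ε → 0 turns a condition on f into one on its leading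
coefficient. -/
lemma im_pow_mul_nonneg {f g : ℂ → ℂ} {p u : ℂ} {n : ℕ} (hg : ContinuousAt g p)
    (hfg : ∀ᶠ z in 𝓝 p, f z - f p = (z - p) ^ n • g z) (him : (f p).im = 0)
    (h : ∀ᶠ ε : ℝ in 𝓝[>] 0, 0 ≤ (f (p + ε * u)).im) : 0 ≤ (u ^ n * g p).im := by
  have hc : Tendsto (fun ε : ℝ ↦ p + ε * u) (𝓝[>] 0) (𝓝 p) := by
    have : Continuous fun ε : ℝ ↦ p + ε * u := by fun_prop
    simpa using (this.tendsto 0).mono_left nhdsWithin_le_nhds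
  have hlim : Tendsto (fun ε : ℝ ↦ (u ^ n * g (p + ε * u)).im) (𝓝[>] 0) (𝓝 (u ^ n * g p).im) :=
    (Complex.continuous_im.tendsto _).comp ((hg.tendsto.comp hc).const_mul _)
  refine ge_of_tendsto hlim ?_
  filter_upwards [h, hc.eventually hfg, self_mem_nhdsWithin] with ε h1 h2 h3
  have hε : 0 < ε ^ n := pow_pos h3 n
  have h4 : (f (p + ε * u) - f p).im = ε ^ n * (u ^ n * g (p + ε * u)).im := by
    rw [h2, ← Complex.im_ofReal_mul, smul_eq_mul, add_sub_cancel_left, mul_pow, mul_assoc]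
    push_cast
    rfl
  rw [Complex.sub_im, him, sub_zero] at h4
  rw [h4] at h1
  exact nonneg_of_mul_nonneg_right h1 hε

/-- If `f` maps a sector of angle `β` at `p` into the closed upper half plane, and the boundary
point `p` to the real axis, then `f - f p` vanishes at `p` to order at most `π / β`. -/
lemma order_mul_le_pi {f : ℂ → ℂ} {p t : ℂ} {n : ℕ} {β : ℝ} (hf : AnalyticAt ℂ f p)
    (hn : analyticOrderAt (f · - f p) p = n) (him : (f p).im = 0) (ht : t ≠ 0)
    (h : ∀ φ ∈ Set.Ioo 0 β, ∀ᶠ ε : ℝ in 𝓝[>] 0,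
      0 ≤ (f (p + ε * (t * Complex.exp (φ * Complex.I)))).im) : n * β ≤ Real.pi := by
  obtain ⟨g, hg, hg0, hfg⟩ := (hf.sub analyticAt_const).analyticOrderAt_eq_natCast.mp hn
  by_contra! hlt
  have hn0 : 0 < n := by
    rcases n.eq_zero_or_pos with h0 | h0
    · subst h0; simp at hlt; linarith [Real.pi_pos]
    · exact h0
  have hn' : (0 : ℝ) < n := Nat.cast_pos.mpr hn0
  set c := t ^ n * g p
  have hc : c ≠ 0 := mul_ne_zero (pow_ne_zero _ ht) hg0
  have hval : ∀ θ ∈ Set.Ioo 0 (n * β), 0 ≤ Real.cos θ * c.im + Real.sin θ * c.re := by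
    intro θ hθ
    have h1 := im_pow_mul_nonneg hg.continuousAt hfg him
      (h (θ / n) ⟨div_pos hθ.1 hn', by rw [div_lt_iff₀ hn', mul_comm]; exact hθ.2⟩)
    have h2 : (t * Complex.exp ((θ / n : ℝ) * Complex.I)) ^ n * g p =
        Complex.exp (θ * Complex.I) * c := by
      rw [mul_pow, ← Complex.exp_nat_mul]
      have : (n : ℂ) * ((θ / n : ℝ) * Complex.I) = θ * Complex.I := by
        have : (n : ℂ) ≠ 0 := Nat.cast_ne_zero.mpr hn0.ne'
        push_cast; field_simp
      rw [this]; ring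
    rw [h2, Complex.mul_im, Complex.exp_ofReal_mul_I_re, Complex.exp_ofReal_mul_I_im] at h1
    exact h1
  -- If nβ > π, both θ and θ + π are admissible for small θ > 0, and they give opposite signs.
  have hzero : ∀ θ ∈ Set.Ioo 0 (n * β - Real.pi),
      Real.cos θ * c.im + Real.sin θ * c.re = 0 := by
    intro θ hθ
    have h1 := hval θ ⟨hθ.1, by linarith [hθ.2, Real.pi_pos]⟩
    have h2 := hval (θ + Real.pi) ⟨by linarith [hθ.1, Real.pi_pos], by linarith [hθ.2]⟩
    rw [Real.cos_add_pi, Real.sin_add_pi] at h2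
    linarith
  -- The angles δ and δ/2 give two linear equations for c with determinant sin(δ/2) ≠ 0, so c = 0.
  set δ := min (n * β - Real.pi) 1 / 2
  have hδ0 : 0 < δ := half_pos (lt_min (by linarith) one_pos)
  have hδ1 : δ ≤ 1 / 2 := div_le_div_of_nonneg_right (min_le_right _ _) (by norm_num)
  have hδ2 : δ < n * β - Real.pi :=
    (half_lt_self (lt_min (by linarith) one_pos)).trans_le (min_le_left _ _)
  have e1 := hzero δ ⟨hδ0, hδ2⟩
  have e2 := hzero (δ / 2) ⟨half_pos hδ0, by linarith⟩
  have hs : 0 < Real.sin (δ - δ / 2) :=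
    Real.sin_pos_of_pos_of_lt_pi (by linarith) (by linarith [Real.pi_gt_three])
  rw [Real.sin_sub] at hs
  have hre : c.re = 0 := by
    have : (Real.sin δ * Real.cos (δ / 2) - Real.cos δ * Real.sin (δ / 2)) * c.re = 0 := by
      linear_combination Real.cos (δ / 2) * e1 - Real.cos δ * e2
    exact (mul_eq_zero.mp this).resolve_left hs.ne'
  have hi : c.im = 0 := by
    have : (Real.sin δ * Real.cos (δ / 2) - Real.cos δ * Real.sin (δ / 2)) * c.im = 0 := by
      linear_combination -Real.sin (δ / 2) * e1 + Real.sin δ * e2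
    exact (mul_eq_zero.mp this).resolve_left hs.ne'
  exact hc (Complex.ext hre hi)

/-- If `f` maps the left side of a line through `p` in direction `t` into the closed upper half
plane, and `p` to the real axis, then `f` moves to the right in direction `t`. -/
lemma deriv_mul_re_pos {f : ℂ → ℂ} {p t : ℂ} (hf : AnalyticAt ℂ f p)
    (hn : analyticOrderAt (f · - f p) p ≠ ⊤) (him : (f p).im = 0) (ht : t ≠ 0)
    (h : ∀ φ ∈ Set.Ioo 0 Real.pi, ∀ᶠ ε : ℝ in 𝓝[>] 0,
      0 ≤ (f (p + ε * (t * Complex.exp (φ * Complex.I)))).im) :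
    analyticOrderAt (f · - f p) p = 1 ∧ 0 < (deriv f p * t).re := by
  obtain ⟨n, hn⟩ := ENat.ne_top_iff_exists.mp hn
  have h1 : n = 1 := by
    have h2 := order_mul_le_pi hf hn.symm him ht h
    have h3 : (n : ℝ) ≤ 1 := by
      by_contra! h4
      nlinarith [Real.pi_pos]
    have h4 : n ≠ 0 := by
      rintro rfl
      have := analyticOrderAt_ne_zero.mpr
        (⟨hf.sub analyticAt_const, sub_self _⟩ : AnalyticAt ℂ (f · - f p) p ∧ f p - f p = 0)
      exact this hn.symm
    have : n ≤ 1 := by exact_mod_cast h3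
    omega
  subst h1
  refine ⟨hn.symm, ?_⟩
  obtain ⟨g, hg, hg0, hfg⟩ := (hf.sub analyticAt_const).analyticOrderAt_eq_natCast.mp hn.symm
  have hder : deriv f p = g p := by
    have h1 : HasDerivAt (fun z ↦ (z - p) ^ 1 • g z + f p) (g p) p := by
      have := (((hasDerivAt_id p).sub_const p).mul hg.differentiableAt.hasDerivAt).add_const (f p)
      simpa using this
    refine (h1.congr_of_eventuallyEq ?_).deriv
    filter_upwards [hfg] with z hz
    rw [← hz]
    exact (sub_add_cancel (f z) (f p)).symm
  rw [hder, mul_comm]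
  set c := t * g p
  have hc : c ≠ 0 := mul_ne_zero ht hg0
  have hval : ∀ φ ∈ Set.Ioo 0 Real.pi, 0 ≤ Real.cos φ * c.im + Real.sin φ * c.re := by
    intro φ hφ
    have h1 := im_pow_mul_nonneg hg.continuousAt hfg him (h φ hφ)
    have h2 : (t * Complex.exp (φ * Complex.I)) ^ 1 * g p = Complex.exp (φ * Complex.I) * c := by
      simp only [c]; ring
    rw [h2, Complex.mul_im, Complex.exp_ofReal_mul_I_re, Complex.exp_ofReal_mul_I_im] at h1
    exact h1
  -- By continuity the end points are admissible too: φ = 0 and φ = π give Im c = 0, and φ = π/2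
  -- gives Re c ≥ 0.
  have hcl : ∀ φ ∈ Set.Icc 0 Real.pi, 0 ≤ Real.cos φ * c.im + Real.sin φ * c.re := by
    intro φ hφ
    rw [← closure_Ioo Real.pi_pos.ne] at hφ
    have hcl : IsClosed {φ : ℝ | 0 ≤ Real.cos φ * c.im + Real.sin φ * c.re} :=
      isClosed_le (by fun_prop) (by fun_prop)
    exact closure_minimal hval hcl hφ
  have e0 := hcl 0 ⟨le_rfl, Real.pi_pos.le⟩
  have e1 := hcl Real.pi ⟨Real.pi_pos.le, le_rfl⟩
  have e2 := hcl (Real.pi / 2) ⟨by linarith [Real.pi_pos], by linarith [Real.pi_pos]⟩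
  simp only [Real.cos_zero, Real.sin_zero, Real.cos_pi, Real.sin_pi, Real.cos_pi_div_two,
    Real.sin_pi_div_two] at e0 e1 e2
  have him : c.im = 0 := by linarith
  refine lt_of_le_of_ne (by linarith) fun h ↦ hc (Complex.ext h.symm him)

/-- Along a ray p + εu each inequality that defines `leftHalf` is a polynomial of degree at most 2
in ε. -/
lemma eventually_quadratic_pos {a b c : ℝ} (h : 0 < a ∨ (0 ≤ a ∧ 0 < b)) :
    ∀ᶠ ε : ℝ in 𝓝[>] 0, 0 < a + b * ε + c * ε ^ 2 := by
  rcases h with h | ⟨ha, hb⟩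
  · have : Continuous fun ε : ℝ ↦ a + b * ε + c * ε ^ 2 := by fun_prop
    exact ((this.tendsto 0).mono_left nhdsWithin_le_nhds).eventually_const_lt (by simpa using h)
  · have : Continuous fun ε : ℝ ↦ b + c * ε := by fun_prop
    have h1 := ((this.tendsto 0).mono_left (nhdsWithin_le_nhds (s := Set.Ioi 0))).eventually_const_lt
      (u := 0) (by simpa using hb)
    filter_upwards [h1, self_mem_nhdsWithin] with ε h2 h3
    have : 0 < ε * (b + c * ε) := mul_pos h3 h2
    nlinarith

lemma eventually_mem_leftHalf {p u : ℂ} (h1 : 0 < p.im)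
    (h2 : -1 / 2 < p.re ∨ (-1 / 2 ≤ p.re ∧ 0 < u.re))
    (h3 : p.re < 0 ∨ (p.re ≤ 0 ∧ u.re < 0))
    (h4 : 1 / 5 < p.re ^ 2 + p.im ^ 2 ∨
      (1 / 5 ≤ p.re ^ 2 + p.im ^ 2 ∧ 0 < p.re * u.re + p.im * u.im))
    (h5 : 1 / 20 < (p.re + 1 / 2) ^ 2 + p.im ^ 2 ∨
      (1 / 20 ≤ (p.re + 1 / 2) ^ 2 + p.im ^ 2 ∧ 0 < (p.re + 1 / 2) * u.re + p.im * u.im)) :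
    ∀ᶠ ε : ℝ in 𝓝[>] 0, p + ε * u ∈ leftHalf := by
  filter_upwards [eventually_quadratic_pos (a := p.im) (b := u.im) (c := 0) (.inl h1),
    eventually_quadratic_pos (a := p.re + 1 / 2) (b := u.re) (c := 0)
      (h2.imp (fun h ↦ by linarith) fun h ↦ ⟨by linarith, h.2⟩),
    eventually_quadratic_pos (a := -p.re) (b := -u.re) (c := 0)
      (h3.imp (fun h ↦ by linarith) fun h ↦ ⟨by linarith, by linarith⟩),
    eventually_quadratic_pos (a := p.re ^ 2 + p.im ^ 2 - 1 / 5)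
      (b := 2 * (p.re * u.re + p.im * u.im)) (c := u.re ^ 2 + u.im ^ 2)
      (h4.imp (fun h ↦ by linarith) fun h ↦ ⟨by linarith, by linarith⟩),
    eventually_quadratic_pos (a := (p.re + 1 / 2) ^ 2 + p.im ^ 2 - 1 / 20)
      (b := 2 * ((p.re + 1 / 2) * u.re + p.im * u.im)) (c := u.re ^ 2 + u.im ^ 2)
      (h5.imp (fun h ↦ by linarith) fun h ↦ ⟨by linarith, by linarith⟩)]
    with ε e1 e2 e3 e4 e5
  have hre : (p + ε * u).re = p.re + ε * u.re := by simp
  have him : (p + ε * u).im = p.im + ε * u.im := by simp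
  refine ⟨?_, ?_, ?_, ?_, ?_⟩ <;> simp only [hre, him] <;> linarith

/-- The sector of angle `β` to the left of the direction `t` at `p` lies in `leftHalf`. -/
def SectorIn (p t : ℂ) (β : ℝ) : Prop :=
  ∀ φ ∈ Set.Ioo 0 β, ∀ᶠ ε : ℝ in 𝓝[>] 0, p + ε * (t * Complex.exp (φ * Complex.I)) ∈ leftHalf

lemma order_hauptC_ne_top {p : ℂ} (hp : 0 < p.im) :
    analyticOrderAt (hauptC · - hauptC p) p ≠ ⊤ := fun h ↦
  not_eventually_hauptC_eq hp ((analyticOrderAt_eq_top.mp h).mono fun _ hz ↦ sub_eq_zero.mp hz)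

lemma SectorIn.order_le_two {p t : ℂ} (h : SectorIn p t (Real.pi / 2)) (hp : 0 < p.im)
    (him : (hauptC p).im = 0) (ht : t ≠ 0) : analyticOrderAt (hauptC · - hauptC p) p ≤ 2 := by
  obtain ⟨n, hn⟩ := ENat.ne_top_iff_exists.mp (order_hauptC_ne_top hp)
  have h2 := order_mul_le_pi (analyticAt_hauptC hp) hn.symm him ht fun φ hφ ↦
    (h φ hφ).mono fun ε hε ↦ hauptC_im_nonneg hε
  have h3 : (n : ℝ) ≤ 2 := by
    by_contra! h4
    nlinarith [Real.pi_pos]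
  rw [← hn]
  exact_mod_cast h3

lemma SectorIn.order_eq_one {p t : ℂ} (h : SectorIn p t Real.pi) (hp : 0 < p.im)
    (him : (hauptC p).im = 0) (ht : t ≠ 0) :
    analyticOrderAt (hauptC · - hauptC p) p = 1 ∧ 0 < (deriv hauptC p * t).re :=
  deriv_mul_re_pos (analyticAt_hauptC hp) (order_hauptC_ne_top hp) him ht fun φ hφ ↦
    (h φ hφ).mono fun _ hε ↦ hauptC_im_nonneg hε

/-! ### Sectors along the boundary of the left half -/

lemma mul_exp_re (t : ℂ) (φ : ℝ) :
    (t * Complex.exp (φ * Complex.I)).re = t.re * Real.cos φ - t.im * Real.sin φ := by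
  rw [Complex.mul_re, Complex.exp_ofReal_mul_I_re, Complex.exp_ofReal_mul_I_im]

lemma mul_exp_im (t : ℂ) (φ : ℝ) :
    (t * Complex.exp (φ * Complex.I)).im = t.re * Real.sin φ + t.im * Real.cos φ := by
  rw [Complex.mul_im, Complex.exp_ofReal_mul_I_re, Complex.exp_ofReal_mul_I_im]

lemma sectorIn_of_re_eq_zero {p : ℂ} (h0 : 0 < p.im) (hre : p.re = 0) (h : 1 / 5 < p.im ^ 2) :
    SectorIn p Complex.I Real.pi := by
  intro φ hφ
  have hs := Real.sin_pos_of_mem_Ioo hφ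
  apply eventually_mem_leftHalf h0 <;> rw [mul_exp_re]
  · left; rw [hre]; norm_num
  · right; simp [hre, hs]
  · left; simpa [hre] using h
  · left; rw [hre]; norm_num; linarith

lemma sectorIn_of_re_eq_neg_half {p : ℂ} (h0 : 0 < p.im) (hre : p.re = -1 / 2)
    (h : 1 / 20 < p.im ^ 2) : SectorIn p (-Complex.I) Real.pi := by
  intro φ hφ
  have hs := Real.sin_pos_of_mem_Ioo hφ
  apply eventually_mem_leftHalf h0 <;> rw [mul_exp_re]
  · right; simp [hre, hs]
  · left; rw [hre]; norm_num
  · left; rw [hre]; linarith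
  · left; rw [hre]; linarith

/-- The direction −i(p − c) is the clockwise tangent, so the directions to its left point out of the
disc with center c. -/
lemma sectorIn_of_circle {p : ℂ} (h0 : 0 < p.im) (hp : p.re ^ 2 + p.im ^ 2 = 1 / 5)
    (h1 : -2 / 5 < p.re) (h2 : p.re < 0) : SectorIn p (-Complex.I * (p - (0 : ℝ))) Real.pi := by
  intro φ hφ
  have hs := Real.sin_pos_of_mem_Ioo hφ
  apply eventually_mem_leftHalf h0 <;> rw [mul_exp_re]
  · left; linarith
  · left; exact h2
  · right
    refine ⟨hp.ge, ?_⟩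
    rw [mul_exp_im]
    have : 0 < (p.re ^ 2 + p.im ^ 2) * Real.sin φ := by rw [hp]; positivity
    simp; nlinarith
  · left; linarith

lemma sectorIn_of_circle' {p : ℂ} (h0 : 0 < p.im) (hp : (p.re + 1 / 2) ^ 2 + p.im ^ 2 = 1 / 20)
    (h1 : -1 / 2 < p.re) (h2 : p.re < -2 / 5) :
    SectorIn p (-Complex.I * (p - (-1 / 2 : ℝ))) Real.pi := by
  intro φ hφ
  have hs := Real.sin_pos_of_mem_Ioo hφ
  apply eventually_mem_leftHalf h0 <;> rw [mul_exp_re]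
  · left; exact h1
  · left; linarith
  · left; linarith
  · right
    refine ⟨hp.ge, ?_⟩
    rw [mul_exp_im]
    have : 0 < ((p.re + 1 / 2) ^ 2 + p.im ^ 2) * Real.sin φ := by rw [hp]; positivity
    simp; nlinarith

lemma pointI_re : pointI.re = 0 := rfl
lemma pointI_im : pointI.im = 1 / √5 := rfl
lemma rho1_re : rho1.re = -1 / 2 := rfl
lemma rho1_im : rho1.im = 1 / (2 * √5) := rfl
lemma rho2_re : rho2.re = -2 / 5 := rfl
lemma rho2_im : rho2.im = 1 / 5 := rfl

lemma pointI_im_sq : pointI.im ^ 2 = 1 / 5 := by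
  rw [pointI_im, div_pow, Real.sq_sqrt (by norm_num)]; norm_num

lemma rho1_im_sq : rho1.im ^ 2 = 1 / 20 := by
  rw [rho1_im, div_pow, mul_pow, Real.sq_sqrt (by norm_num)]; norm_num

lemma sectorIn_pointI : SectorIn pointI Complex.I (Real.pi / 2) := by
  intro φ hφ
  have hs := Real.sin_pos_of_mem_Ioo (x := φ) ⟨hφ.1, by linarith [hφ.2, Real.pi_pos]⟩
  have hc := Real.cos_pos_of_mem_Ioo (x := φ) ⟨by linarith [hφ.1, Real.pi_pos], hφ.2⟩
  apply eventually_mem_leftHalf pointI.im_pos <;> rw [mul_exp_re] <;>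
    rw [coe_re, pointI_re] <;> try rw [coe_im, pointI_im_sq]
  · left; norm_num
  · right; simpa using hs
  · right
    refine ⟨by norm_num, ?_⟩
    rw [mul_exp_im]
    simpa using mul_pos pointI.im_pos hc
  · left; norm_num

lemma sectorIn_rho1 : SectorIn rho1 1 (Real.pi / 2) := by
  intro φ hφ
  have hs := Real.sin_pos_of_mem_Ioo (x := φ) ⟨hφ.1, by linarith [hφ.2, Real.pi_pos]⟩
  have hc := Real.cos_pos_of_mem_Ioo (x := φ) ⟨by linarith [hφ.1, Real.pi_pos], hφ.2⟩
  apply eventually_mem_leftHalf rho1.im_pos <;> rw [mul_exp_re] <;>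
    rw [coe_re, rho1_re] <;> try rw [coe_im, rho1_im_sq]
  · right; simpa using hc
  · left; norm_num
  · left; norm_num
  · right
    refine ⟨by norm_num, ?_⟩
    rw [mul_exp_im]
    have := mul_pos rho1.im_pos hs
    norm_num
    exact this

/-- The two arcs meet at a right angle here: 1 + 2i is tangent to the first arc, and i(1 + 2i) = −2
+ i is tangent to the second. -/
lemma sectorIn_rho2 : SectorIn rho2 (1 + 2 * Complex.I) (Real.pi / 2) := by
  intro φ hφ
  have hs := Real.sin_pos_of_mem_Ioo (x := φ) ⟨hφ.1, by linarith [hφ.2, Real.pi_pos]⟩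
  have hc := Real.cos_pos_of_mem_Ioo (x := φ) ⟨by linarith [hφ.1, Real.pi_pos], hφ.2⟩
  apply eventually_mem_leftHalf rho2.im_pos <;> rw [mul_exp_re] <;>
    rw [coe_re, rho2_re] <;> try rw [coe_im, rho2_im]
  · left; norm_num
  · left; norm_num
  · right
    refine ⟨by norm_num, ?_⟩
    rw [mul_exp_im]
    simp; linarith
  · right
    refine ⟨by norm_num, ?_⟩
    rw [mul_exp_im]
    simp; linarith

/-! ### Monotonicity along the boundary -/

/-- If `γ` is positively proportional to directions in which `hauptC` moves to the right, then
`hauptC` increases along `γ`. -/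
lemma strictMonoOn_hauptC_re {γ γ' : ℝ → ℂ} {D : Set ℝ} (hD : Convex ℝ D)
    (hγ : ContinuousOn γ D) (hpos : ∀ s ∈ D, 0 < (γ s).im)
    (hder : ∀ s ∈ interior D, HasDerivAt γ (γ' s) s)
    (h : ∀ s ∈ interior D, 0 < (deriv hauptC (γ s) * γ' s).re) :
    StrictMonoOn (fun s ↦ (hauptC (γ s)).re) D := by
  refine strictMonoOn_of_deriv_pos hD ?_ fun s hs ↦ ?_
  · exact Complex.continuous_re.comp_continuousOn
      (differentiableOn_hauptC.continuousOn.comp hγ hpos)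
  · have h1 := (analyticAt_hauptC (hpos s (interior_subset hs))).differentiableAt.hasDerivAt
    have h2 : HasDerivAt (fun s ↦ hauptC (γ s)) (deriv hauptC (γ s) * γ' s) s := by
      exact h1.comp s (hder s hs)
    have h3 : HasDerivAt (fun s ↦ (hauptC (γ s)).re) (deriv hauptC (γ s) * γ' s).re s :=
      Complex.reCLM.hasFDerivAt.comp_hasDerivAt s h2
    rw [h3.deriv]
    exact h s hs

/-- The upper half of the circle with center `c` and radius `√R`, parametrized by the real part. -/
def circleArc (c R x : ℝ) : ℂ := ⟨x, √(R - (x - c) ^ 2)⟩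

lemma continuous_circleArc (c R : ℝ) : Continuous (circleArc c R) := by
  have : circleArc c R = fun x : ℝ ↦ (x : ℂ) + (√(R - (x - c) ^ 2) : ℝ) * Complex.I := by
    ext x; apply Complex.ext <;> simp [circleArc]
  rw [this]
  fun_prop

/-- The derivative is written as a positive multiple of the clockwise tangent, the direction that
occurs in `sectorIn_of_circle`. -/
lemma hasDerivAt_circleArc {c R x : ℝ} (h : 0 < R - (x - c) ^ 2) :
    HasDerivAt (circleArc c R)
      (((√(R - (x - c) ^ 2))⁻¹ : ℝ) * (-Complex.I * (circleArc c R x - c))) x := by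
  have e : circleArc c R = fun x : ℝ ↦ (x : ℂ) + (√(R - (x - c) ^ 2) : ℝ) * Complex.I := by
    ext x; apply Complex.ext <;> simp [circleArc]
  have hy := Real.sqrt_pos.mpr h
  have h1 : HasDerivAt (fun x : ℝ ↦ R - (x - c) ^ 2) (-(2 * (x - c))) x := by
    have := (((hasDerivAt_id x).sub_const c).pow 2).const_sub R
    simpa using this
  have h2 := (h1.sqrt h.ne').ofReal_comp
  have h3 := (Complex.ofRealCLM.hasDerivAt (x := x)).add (h2.mul_const Complex.I)
  rw [e]
  refine h3.congr_deriv ?_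
  have hd : -(2 * (x - c)) / (2 * √(R - (x - c) ^ 2)) = -((√(R - (x - c) ^ 2))⁻¹ * (x - c)) := by
    field_simp
  rw [hd]
  apply Complex.ext
  · rw [Complex.re_ofReal_mul]
    simp [hy.ne']
  · rw [Complex.im_ofReal_mul, Complex.add_im, Complex.im_ofReal_mul]
    simp
    ring

lemma circleArc_conditions {c R x : ℝ} (h : 0 ≤ R - (x - c) ^ 2) :
    ((circleArc c R x).re - c) ^ 2 + (circleArc c R x).im ^ 2 = R := by
  simp only [circleArc]
  rw [Real.sq_sqrt h]; ring

lemma circleArc_re_eq {c R : ℝ} {z : ℂ} (h : (z.re - c) ^ 2 + z.im ^ 2 = R) (h0 : 0 < z.im) :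
    circleArc c R z.re = z := by
  apply Complex.ext
  · rfl
  · simp only [circleArc]
    rw [← h, add_sub_cancel_left, Real.sqrt_sq h0.le]

/-- `hauptC` increases along a circular arc on which it is real and whose exterior is mapped to the
upper half plane. -/
lemma strictMonoOn_circleArc {c R a b : ℝ}
    (hpos : ∀ x ∈ Set.Icc a b, 0 < R - (x - c) ^ 2)
    (hreal : ∀ x ∈ Set.Ioo a b, (hauptC (circleArc c R x)).im = 0)
    (hs : ∀ x ∈ Set.Ioo a b,
      SectorIn (circleArc c R x) (-Complex.I * (circleArc c R x - c)) Real.pi) :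
    StrictMonoOn (fun x ↦ (hauptC (circleArc c R x)).re) (Set.Icc a b) := by
  have him : ∀ x ∈ Set.Icc a b, 0 < (circleArc c R x).im := fun x hx ↦
    Real.sqrt_pos.mpr (hpos x hx)
  refine strictMonoOn_hauptC_re (convex_Icc a b) (continuous_circleArc c R).continuousOn him
    (γ' := fun x ↦ ((√(R - (x - c) ^ 2))⁻¹ : ℝ) * (-Complex.I * (circleArc c R x - c)))
    (fun x hx ↦ hasDerivAt_circleArc (hpos x (interior_subset hx))) fun x hx ↦ ?_
  have hx' := interior_subset hx
  rw [interior_Icc] at hx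
  have h1 : -Complex.I * (circleArc c R x - c) ≠ 0 := by
    refine mul_ne_zero (neg_ne_zero.mpr Complex.I_ne_zero) fun h ↦ (him x hx').ne' ?_
    simpa using congrArg Complex.im h
  have h2 := ((hs x hx).order_eq_one (him x hx') (hreal x hx) h1).2
  rw [mul_left_comm, Complex.re_ofReal_mul]
  exact mul_pos (inv_pos.mpr (him x hx')) h2

lemma strictMonoOn_arc1 :
    StrictMonoOn (fun x ↦ (hauptC (circleArc 0 (1 / 5) x)).re) (Set.Icc (-2 / 5) 0) := by
  have hpos : ∀ x ∈ Set.Icc (-2 / 5 : ℝ) 0, 0 < (1 / 5 : ℝ) - (x - 0) ^ 2 := fun x hx ↦ by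
    nlinarith [hx.1, hx.2]
  have h1 : ∀ x ∈ Set.Ioo (-2 / 5 : ℝ) 0, 0 < (circleArc 0 (1 / 5) x).im := fun x hx ↦
    Real.sqrt_pos.mpr (hpos x ⟨hx.1.le, hx.2.le⟩)
  have h2 : ∀ x ∈ Set.Ioo (-2 / 5 : ℝ) 0, (circleArc 0 (1 / 5) x).re ^ 2 +
      (circleArc 0 (1 / 5) x).im ^ 2 = 1 / 5 := fun x hx ↦ by
    simpa using circleArc_conditions (hpos x ⟨hx.1.le, hx.2.le⟩).le
  refine strictMonoOn_circleArc hpos (fun x hx ↦ ?_) fun x hx ↦ ?_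
  · exact hauptC_im_eq_zero_of_pos (h1 x hx) (.inr (.inr (.inl (h2 x hx))))
  · exact sectorIn_of_circle (h1 x hx) (h2 x hx) hx.1 hx.2

lemma strictMonoOn_arc2 :
    StrictMonoOn (fun x ↦ (hauptC (circleArc (-1 / 2) (1 / 20) x)).re)
      (Set.Icc (-1 / 2) (-2 / 5)) := by
  have hpos : ∀ x ∈ Set.Icc (-1 / 2 : ℝ) (-2 / 5), 0 < (1 / 20 : ℝ) - (x - -1 / 2) ^ 2 :=
    fun x hx ↦ by nlinarith [hx.1, hx.2]
  have h1 : ∀ x ∈ Set.Ioo (-1 / 2 : ℝ) (-2 / 5), 0 < (circleArc (-1 / 2) (1 / 20) x).im :=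
    fun x hx ↦ Real.sqrt_pos.mpr (hpos x ⟨hx.1.le, hx.2.le⟩)
  have h2 : ∀ x ∈ Set.Ioo (-1 / 2 : ℝ) (-2 / 5), ((circleArc (-1 / 2) (1 / 20) x).re + 1 / 2) ^ 2 +
      (circleArc (-1 / 2) (1 / 20) x).im ^ 2 = 1 / 20 := fun x hx ↦ by
    linear_combination circleArc_conditions (hpos x ⟨hx.1.le, hx.2.le⟩).le
  refine strictMonoOn_circleArc hpos (fun x hx ↦ ?_) fun x hx ↦ ?_
  · exact hauptC_im_eq_zero_of_pos (h1 x hx) (.inr (.inr (.inr (h2 x hx))))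
  · exact sectorIn_of_circle' (h1 x hx) (h2 x hx) hx.1 hx.2

lemma strictMonoOn_imag_axis :
    StrictMonoOn (fun y ↦ (hauptC ⟨0, y⟩).re) (Set.Ici pointI.im) := by
  have hpos : ∀ y ∈ Set.Ici pointI.im, 0 < y := fun y hy ↦ pointI.im_pos.trans_le hy
  have hγ : (fun y : ℝ ↦ (⟨0, y⟩ : ℂ)) = fun y : ℝ ↦ (y : ℂ) * Complex.I := by
    ext y; apply Complex.ext <;> simp
  have hd : ∀ y : ℝ, HasDerivAt (fun y : ℝ ↦ (⟨0, y⟩ : ℂ)) Complex.I y := fun y ↦ by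
    rw [hγ]; simpa using (Complex.ofRealCLM.hasDerivAt (x := y)).mul_const Complex.I
  refine strictMonoOn_hauptC_re (γ := fun y ↦ ⟨0, y⟩) (convex_Ici _)
    (fun y _ ↦ (hd y).continuousAt.continuousWithinAt) hpos (fun y _ ↦ hd y) fun y hy ↦ ?_
  rw [interior_Ici] at hy
  have hy0 := pointI.im_pos.trans hy
  refine ((sectorIn_of_re_eq_zero (p := ⟨0, y⟩) hy0 rfl ?_).order_eq_one hy0
    (hauptC_im_eq_zero_of_pos hy0 (.inr (.inl rfl))) Complex.I_ne_zero).2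
  rw [← pointI_im_sq]
  exact pow_lt_pow_left₀ hy pointI.im_pos.le two_ne_zero

/-- The parameter is minus the height, so that it runs downwards with the region on its left. -/
lemma strictMonoOn_left_line :
    StrictMonoOn (fun y ↦ (hauptC ⟨-1 / 2, -y⟩).re) (Set.Iic (-rho1.im)) := by
  have hpos : ∀ y ∈ Set.Iic (-rho1.im), 0 < -y := fun y hy ↦ by
    have := rho1.im_pos
    rw [Set.mem_Iic] at hy
    linarith
  have hγ : (fun y : ℝ ↦ (⟨-1 / 2, -y⟩ : ℂ)) = fun y : ℝ ↦ -1 / 2 + (y : ℂ) * -Complex.I := by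
    ext y; apply Complex.ext <;> simp
  have hd : ∀ y : ℝ, HasDerivAt (fun y : ℝ ↦ (⟨-1 / 2, -y⟩ : ℂ)) (-Complex.I) y := fun y ↦ by
    rw [hγ]
    simpa using ((Complex.ofRealCLM.hasDerivAt (x := y)).mul_const (-Complex.I)).const_add (-1 / 2)
  refine strictMonoOn_hauptC_re (γ := fun y ↦ ⟨-1 / 2, -y⟩) (convex_Iic _)
    (fun y _ ↦ (hd y).continuousAt.continuousWithinAt) hpos (fun y _ ↦ hd y) fun y hy ↦ ?_
  rw [interior_Iic] at hy
  have hy1 : rho1.im < -y := by rw [Set.mem_Iio] at hy; linarith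
  have hy0 := rho1.im_pos.trans hy1
  refine ((sectorIn_of_re_eq_neg_half (p := ⟨-1 / 2, -y⟩) hy0 rfl ?_).order_eq_one hy0
    (hauptC_im_eq_zero_of_pos hy0 (.inl rfl)) (neg_ne_zero.mpr Complex.I_ne_zero)).2
  rw [← rho1_im_sq]
  exact pow_lt_pow_left₀ hy1 rho1.im_pos.le two_ne_zero

lemma circleArc_eq_pointI : circleArc 0 (1 / 5) 0 = pointI :=
  circleArc_re_eq (z := pointI) (by rw [coe_re, coe_im, pointI_im_sq, pointI_re]; norm_num)
    pointI.im_pos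

lemma circleArc_eq_rho2 : circleArc 0 (1 / 5) (-2 / 5) = rho2 :=
  circleArc_re_eq (z := rho2) (by rw [coe_re, coe_im, rho2_im, rho2_re]; norm_num) rho2.im_pos

lemma circleArc_eq_rho2' : circleArc (-1 / 2) (1 / 20) (-2 / 5) = rho2 :=
  circleArc_re_eq (z := rho2) (by rw [coe_re, coe_im, rho2_im, rho2_re]; norm_num) rho2.im_pos

lemma circleArc_eq_rho1 : circleArc (-1 / 2) (1 / 20) (-1 / 2) = rho1 :=
  circleArc_re_eq (z := rho1) (by rw [coe_re, coe_im, rho1_im_sq, rho1_re]; norm_num) rho1.im_pos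

/-! ### Values at the corners -/

lemma hauptmodul_im_pointI : (hauptmodul pointI).im = 0 :=
  hauptmodul_im_of_re_eq_zero pointI_re

lemma hauptmodul_im_rho1 : (hauptmodul rho1).im = 0 :=
  hauptmodul_im_of_re_eq_neg_half rho1_re

lemma hauptmodul_im_rho2 : (hauptmodul rho2).im = 0 :=
  hauptmodul_im_of_circle (by rw [rho2_re, rho2_im]; norm_num)

lemma hauptmodul_rho2_lt_pointI : (hauptmodul rho2).re < (hauptmodul pointI).re := by
  have h := strictMonoOn_arc1 (a := -2 / 5) (b := 0) (by norm_num) (by norm_num) (by norm_num)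
  simpa only [circleArc_eq_pointI, circleArc_eq_rho2, hauptC_coe] using h

lemma hauptmodul_rho1_lt_rho2 : (hauptmodul rho1).re < (hauptmodul rho2).re := by
  have h := strictMonoOn_arc2 (a := -1 / 2) (b := -2 / 5) (by norm_num) (by norm_num) (by norm_num)
  simpa only [circleArc_eq_rho1, circleArc_eq_rho2', hauptC_coe] using h

lemma hauptmodul_root {z : ℍ} (h6 : eisensteinFricke 5 (k := 6) (by norm_num) z = 0)
    (him : (hauptmodul z).im = 0) :
    (hauptmodul z).re * ((hauptmodul z).re ^ 2 - 44 * (hauptmodul z).re - 16) = 0 := by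
  have h := eisensteinFricke_six_sq_eq z
  rw [h6, zero_pow two_ne_zero, eq_comm] at h
  have h2 := (mul_eq_zero.mp h).resolve_left (pow_ne_zero _ (etaForm_ne_zero z))
  have h3 : hauptmodul z = ((hauptmodul z).re : ℂ) := Complex.ext rfl (by simpa using him)
  rw [h3] at h2
  exact_mod_cast h2

/-- All three values are roots of x(x² − 44x − 16), and monotonicity on the arcs makes them strictly
increasing. Three distinct roots of a cubic in a known order leave a single assignment. -/
lemma hauptmodul_corner_values : hauptmodul rho1 = ((22 - 10 * √5 : ℝ) : ℂ) ∧ hauptmodul rho2 = 0 ∧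
    hauptmodul pointI = ((22 + 10 * √5 : ℝ) : ℂ) := by
  have hF := isFrickeForm_eisensteinFricke (k := 6) (by norm_num) (by decide)
  have e1 := hauptmodul_root hF.apply_rho1 hauptmodul_im_rho1
  have e2 := hauptmodul_root hF.apply_rho2 hauptmodul_im_rho2
  have e3 := hauptmodul_root hF.apply_pointI hauptmodul_im_pointI
  have l1 := hauptmodul_rho1_lt_rho2
  have l2 := hauptmodul_rho2_lt_pointI
  have key : ∀ x : ℝ, x * (x ^ 2 - 44 * x - 16) = 0 →
      x = 22 - 10 * √5 ∨ x = 0 ∨ x = 22 + 10 * √5 := by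
    intro x hx
    have h5 : √5 ^ 2 = (5 : ℝ) := Real.sq_sqrt (by norm_num)
    have h : (x - (22 - 10 * √5)) * (x * (x - (22 + 10 * √5))) = 0 := by
      linear_combination hx - 100 * x * h5
    rcases mul_eq_zero.mp h with h | h
    · left; linarith
    rcases mul_eq_zero.mp h with h | h
    · right; left; exact h
    · right; right; linarith
  have h5 : (2 : ℝ) < √5 := (Real.lt_sqrt (by norm_num)).mpr (by norm_num)
  have h6 : √5 < (3 : ℝ) := (Real.sqrt_lt' (by norm_num)).mpr (by norm_num)
  have h22 : (22 / 10 : ℝ) < √5 := (Real.lt_sqrt (by norm_num)).mpr (by norm_num)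
  have hval : ∀ (z : ℍ) (x : ℝ), (hauptmodul z).im = 0 → (hauptmodul z).re = x →
      hauptmodul z = x := fun z x h1 h2 ↦ Complex.ext (by simpa using h2) (by simpa using h1)
  rcases key _ e1 with h1 | h1 | h1 <;> rcases key _ e2 with h2 | h2 | h2 <;>
    rcases key _ e3 with h3 | h3 | h3 <;> first | (exfalso; linarith) | skip
  refine ⟨hval _ _ hauptmodul_im_rho1 h1, ?_, hval _ _ hauptmodul_im_pointI h3⟩
  simpa using hval _ _ hauptmodul_im_rho2 h2

lemma hauptmodul_rho1_re : (hauptmodul rho1).re = 22 - 10 * √5 := by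
  rw [hauptmodul_corner_values.1, Complex.ofReal_re]

lemma hauptmodul_rho2_re : (hauptmodul rho2).re = 0 := by
  rw [hauptmodul_corner_values.2.1, Complex.zero_re]

lemma hauptmodul_pointI_re : (hauptmodul pointI).re = 22 + 10 * √5 := by
  rw [hauptmodul_corner_values.2.2, Complex.ofReal_re]

/-! ### The arcs and the fundamental domain in coordinates -/

lemma arg_mem_Icc {w : ℂ} (hw : 0 < w.im) : w.arg ∈ Set.Icc 0 Real.pi :=
  ⟨Complex.arg_nonneg_iff.mpr hw.le, Complex.arg_le_pi w⟩

/-- The cosine decreases on [0, π], so bounds on the argument become bounds on the real part. -/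
lemma lt_arg_iff {w : ℂ} (hw : 0 < w.im) {θ : ℝ} (hθ : θ ∈ Set.Icc 0 Real.pi) :
    θ < w.arg ↔ w.re < ‖w‖ * Real.cos θ := by
  have h0 : w ≠ 0 := fun h ↦ by simp [h] at hw
  rw [← Real.strictAntiOn_cos.lt_iff_gt (arg_mem_Icc hw) hθ, Complex.cos_arg h0,
    div_lt_iff₀' (norm_pos_iff.mpr h0)]

lemma arg_lt_iff {w : ℂ} (hw : 0 < w.im) {θ : ℝ} (hθ : θ ∈ Set.Icc 0 Real.pi) :
    w.arg < θ ↔ ‖w‖ * Real.cos θ < w.re := by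
  have h0 : w ≠ 0 := fun h ↦ by simp [h] at hw
  rw [← Real.strictAntiOn_cos.lt_iff_gt hθ (arg_mem_Icc hw), Complex.cos_arg h0,
    lt_div_iff₀' (norm_pos_iff.mpr h0)]

lemma le_norm_iff {w : ℂ} {r : ℝ} (hr : 0 ≤ r) : r ≤ ‖w‖ ↔ r ^ 2 ≤ w.re ^ 2 + w.im ^ 2 := by
  rw [← pow_le_pow_iff_left₀ hr (norm_nonneg w) two_ne_zero, Complex.sq_norm, Complex.normSq_apply,
    sq w.re, sq w.im]

lemma lt_norm_iff {w : ℂ} {r : ℝ} (hr : 0 ≤ r) : r < ‖w‖ ↔ r ^ 2 < w.re ^ 2 + w.im ^ 2 := by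
  rw [← pow_lt_pow_iff_left₀ hr (norm_nonneg w) two_ne_zero, Complex.sq_norm, Complex.normSq_apply,
    sq w.re, sq w.im]

lemma norm_eq_iff {w : ℂ} {r : ℝ} (hr : 0 ≤ r) : ‖w‖ = r ↔ w.re ^ 2 + w.im ^ 2 = r ^ 2 := by
  rw [← pow_left_inj₀ (norm_nonneg w) hr two_ne_zero, Complex.sq_norm, Complex.normSq_apply,
    sq w.re, sq w.im]

lemma one_div_sqrt_five_sq : (1 / √5 : ℝ) ^ 2 = 1 / 5 := pointI_im_sq

lemma one_div_two_mul_sqrt_five_sq : (1 / (2 * √5) : ℝ) ^ 2 = 1 / 20 := rho1_im_sq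

lemma alpha_mem : alpha ∈ Set.Ioo 0 (Real.pi / 2) :=
  ⟨Real.arctan_pos.mpr two_pos, Real.arctan_lt_pi_div_two 2⟩

lemma cos_alpha : Real.cos alpha = 1 / √5 := by
  rw [alpha, Real.cos_arctan]; norm_num

lemma sin_alpha : Real.sin alpha = 2 / √5 := by
  rw [alpha, Real.sin_arctan]; norm_num

lemma mem_arc1_iff {z : ℍ} :
    z ∈ arc1 ↔ z.re ^ 2 + z.im ^ 2 = 1 / 5 ∧ -2 / 5 < z.re ∧ z.re < 0 := by
  have hα := alpha_mem
  have hπ := Real.pi_pos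
  have h5 : (√5 : ℝ) ^ 2 = 5 := Real.sq_sqrt (by norm_num)
  have h1 : ‖(z : ℂ)‖ = 1 / √5 ↔ z.re ^ 2 + z.im ^ 2 = 1 / 5 := by
    rw [norm_eq_iff (by positivity), one_div_sqrt_five_sq]; rfl
  rw [arc1, Set.mem_ofPred_eq, h1, and_congr_right_iff]
  intro h
  rw [lt_arg_iff z.im_pos ⟨by linarith, by linarith⟩,
    arg_lt_iff z.im_pos ⟨by linarith [hα.1], by linarith [hα.2]⟩, h1.mpr h, Real.cos_pi_div_two,
    add_comm, Real.cos_add_pi_div_two, sin_alpha, mul_zero]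
  -- From cos(π/2 + α) = −sin α: the end of the arc has the real part of ρ₂.
  have : 1 / √5 * -(2 / √5) = -2 / 5 := by field_simp; rw [h5]
  rw [this, and_comm]
  rfl

lemma mem_arc2_iff {z : ℍ} : z ∈ arc2 ↔
    (z.re + 1 / 2) ^ 2 + z.im ^ 2 = 1 / 20 ∧ -1 / 2 < z.re ∧ z.re < -2 / 5 := by
  have hα := alpha_mem
  have hπ := Real.pi_pos
  have h5 : (√5 : ℝ) ^ 2 = 5 := Real.sq_sqrt (by norm_num)
  have hre : ((z : ℂ) + 1 / 2).re = z.re + 1 / 2 := by simp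
  have him : ((z : ℂ) + 1 / 2).im = z.im := by simp
  have him' : 0 < ((z : ℂ) + 1 / 2).im := him ▸ z.im_pos
  have h1 : ‖(z : ℂ) + 1 / 2‖ = 1 / (2 * √5) ↔ (z.re + 1 / 2) ^ 2 + z.im ^ 2 = 1 / 20 := by
    rw [norm_eq_iff (by positivity), one_div_two_mul_sqrt_five_sq, hre, him]
  rw [arc2, Set.mem_ofPred_eq, h1, and_congr_right_iff]
  intro h
  rw [lt_arg_iff him' ⟨hα.1.le, by linarith [hα.2]⟩, arg_lt_iff him' ⟨by linarith, by linarith⟩,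
    h1.mpr h, Real.cos_pi_div_two, cos_alpha, mul_zero, hre]
  have : 1 / (2 * √5) * (1 / √5) = 1 / 10 := by field_simp; rw [h5]; norm_num
  rw [this, and_comm]
  constructor <;> rintro ⟨h2, h3⟩ <;> constructor <;> linarith

lemma hauptmodul_eq_re_of_im {z : ℍ} (h : (hauptmodul z).im = 0) :
    hauptmodul z = ((hauptmodul z).re : ℂ) := Complex.ext rfl (by simpa using h)

lemma circleArc_of_mem_arc1 {z : ℍ} (hz : z ∈ arc1) : circleArc 0 (1 / 5) z.re = z :=
  circleArc_re_eq (z := z) (by simpa using (mem_arc1_iff.mp hz).1) z.im_pos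

lemma circleArc_of_mem_arc2 {z : ℍ} (hz : z ∈ arc2) : circleArc (-1 / 2) (1 / 20) z.re = z :=
  circleArc_re_eq (z := z) (by
    rw [← (mem_arc2_iff.mp hz).1, coe_re, coe_im]; ring) z.im_pos

lemma hauptmodul_im_of_mem_arc1 {z : ℍ} (hz : z ∈ arc1) : (hauptmodul z).im = 0 :=
  hauptmodul_im_of_circle (mem_arc1_iff.mp hz).1

lemma hauptmodul_im_of_mem_arc2 {z : ℍ} (hz : z ∈ arc2) : (hauptmodul z).im = 0 :=
  hauptmodul_im_of_circle' (mem_arc2_iff.mp hz).1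

lemma hauptmodul_re_of_mem_arc1 {z : ℍ} (hz : z ∈ arc1) :
    (hauptmodul z).re ∈ Set.Ioo 0 (22 + 10 * √5) := by
  obtain ⟨-, h1, h2⟩ := mem_arc1_iff.mp hz
  have e1 := strictMonoOn_arc1 (a := -2 / 5) (b := z.re) (by norm_num) ⟨h1.le, h2.le⟩ h1
  have e2 := strictMonoOn_arc1 (a := z.re) (b := 0) ⟨h1.le, h2.le⟩ (by norm_num) h2
  simp only [circleArc_eq_pointI, circleArc_eq_rho2, circleArc_of_mem_arc1 hz, hauptC_coe] at e1 e2
  rw [hauptmodul_rho2_re] at e1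
  rw [hauptmodul_pointI_re] at e2
  exact ⟨e1, e2⟩

lemma hauptmodul_re_of_mem_arc2 {z : ℍ} (hz : z ∈ arc2) :
    (hauptmodul z).re ∈ Set.Ioo (22 - 10 * √5) 0 := by
  obtain ⟨-, h1, h2⟩ := mem_arc2_iff.mp hz
  have e1 := strictMonoOn_arc2 (a := -1 / 2) (b := z.re) (by norm_num) ⟨h1.le, h2.le⟩ h1
  have e2 := strictMonoOn_arc2 (a := z.re) (b := -2 / 5) ⟨h1.le, h2.le⟩ (by norm_num) h2
  simp only [circleArc_eq_rho1, circleArc_eq_rho2', circleArc_of_mem_arc2 hz, hauptC_coe] at e1 e2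
  rw [hauptmodul_rho1_re] at e1
  rw [hauptmodul_rho2_re] at e2
  exact ⟨e1, e2⟩

/-- Existence by the intermediate value theorem between the corner values, uniqueness by strict
monotonicity. -/
lemma exists_arc1_eq_singleton {x : ℝ} (hx : x ∈ Set.Ioo 0 (22 + 10 * √5)) :
    ∃ w ∈ arc1, {z ∈ arc1 | hauptmodul z = x} = {w} := by
  have hpos : ∀ s ∈ Set.Icc (-2 / 5 : ℝ) 0, 0 < (1 / 5 : ℝ) - (s - 0) ^ 2 := fun s hs ↦ by
    nlinarith [hs.1, hs.2]
  have him : ∀ s ∈ Set.Icc (-2 / 5 : ℝ) 0, 0 < (circleArc 0 (1 / 5) s).im :=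
    fun s hs ↦ Real.sqrt_pos.mpr (hpos s hs)
  have hcont : ContinuousOn (fun s ↦ (hauptC (circleArc 0 (1 / 5) s)).re) (Set.Icc (-2 / 5) 0) :=
    Complex.continuous_re.comp_continuousOn
      (differentiableOn_hauptC.continuousOn.comp (continuous_circleArc _ _).continuousOn him)
  have h := intermediate_value_Ioo (by norm_num) hcont
  simp only [circleArc_eq_pointI, circleArc_eq_rho2, hauptC_coe, hauptmodul_rho2_re,
    hauptmodul_pointI_re] at h
  obtain ⟨s, hs, hsx⟩ := h hx
  have hs' : s ∈ Set.Icc (-2 / 5 : ℝ) 0 := ⟨hs.1.le, hs.2.le⟩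
  set w : ℍ := ⟨circleArc 0 (1 / 5) s, him s hs'⟩
  have hw : w ∈ arc1 := mem_arc1_iff.mpr ⟨by
    have := circleArc_conditions (hpos s hs').le
    rw [sub_zero] at this
    exact this, hs.1, hs.2⟩
  refine ⟨w, hw, Set.eq_singleton_iff_unique_mem.mpr ⟨⟨hw, ?_⟩, ?_⟩⟩
  · rw [hauptmodul_eq_re_of_im (hauptmodul_im_of_mem_arc1 hw), ← hauptC_coe]
    exact congrArg _ hsx
  · rintro z ⟨hz, hzx⟩
    obtain ⟨-, h1, h2⟩ := mem_arc1_iff.mp hz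
    have : z.re = s := by
      refine strictMonoOn_arc1.injOn ⟨h1.le, h2.le⟩ hs' ?_
      rw [circleArc_of_mem_arc1 hz, hauptC_coe, hzx, Complex.ofReal_re]
      exact hsx.symm
    ext
    rw [← circleArc_of_mem_arc1 hz, this]

lemma exists_arc2_eq_singleton {x : ℝ} (hx : x ∈ Set.Ioo (22 - 10 * √5) 0) :
    ∃ w ∈ arc2, {z ∈ arc2 | hauptmodul z = x} = {w} := by
  have hpos : ∀ s ∈ Set.Icc (-1 / 2 : ℝ) (-2 / 5), 0 < (1 / 20 : ℝ) - (s - -1 / 2) ^ 2 :=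
    fun s hs ↦ by nlinarith [hs.1, hs.2]
  have him : ∀ s ∈ Set.Icc (-1 / 2 : ℝ) (-2 / 5), 0 < (circleArc (-1 / 2) (1 / 20) s).im :=
    fun s hs ↦ Real.sqrt_pos.mpr (hpos s hs)
  have hcont : ContinuousOn (fun s ↦ (hauptC (circleArc (-1 / 2) (1 / 20) s)).re)
      (Set.Icc (-1 / 2) (-2 / 5)) :=
    Complex.continuous_re.comp_continuousOn
      (differentiableOn_hauptC.continuousOn.comp (continuous_circleArc _ _).continuousOn him)
  have h := intermediate_value_Ioo (by norm_num) hcont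
  simp only [circleArc_eq_rho1, circleArc_eq_rho2', hauptC_coe, hauptmodul_rho2_re,
    hauptmodul_rho1_re] at h
  obtain ⟨s, hs, hsx⟩ := h hx
  have hs' : s ∈ Set.Icc (-1 / 2 : ℝ) (-2 / 5) := ⟨hs.1.le, hs.2.le⟩
  set w : ℍ := ⟨circleArc (-1 / 2) (1 / 20) s, him s hs'⟩
  have hw : w ∈ arc2 := mem_arc2_iff.mpr ⟨by
    have : (w.re - -1 / 2) ^ 2 + w.im ^ 2 = 1 / 20 := circleArc_conditions (hpos s hs').le
    linear_combination this, hs.1, hs.2⟩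
  refine ⟨w, hw, Set.eq_singleton_iff_unique_mem.mpr ⟨⟨hw, ?_⟩, ?_⟩⟩
  · rw [hauptmodul_eq_re_of_im (hauptmodul_im_of_mem_arc2 hw), ← hauptC_coe]
    exact congrArg _ hsx
  · rintro z ⟨hz, hzx⟩
    obtain ⟨-, h1, h2⟩ := mem_arc2_iff.mp hz
    have : z.re = s := by
      refine strictMonoOn_arc2.injOn ⟨h1.le, h2.le⟩ hs' ?_
      rw [circleArc_of_mem_arc2 hz, hauptC_coe, hzx, Complex.ofReal_re]
      exact hsx.symm
    ext
    rw [← circleArc_of_mem_arc2 hz, this]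

/-- A point of the left half of the fundamental domain where the Hauptmodul is real is on the
boundary, and it is on the two arcs if the value is between those at the end points. -/
lemma mem_arc_of_left {z : ℍ} {x : ℝ} (h1 : 1 / 5 ≤ z.re ^ 2 + z.im ^ 2)
    (h2 : 1 / 20 ≤ (z.re + 1 / 2) ^ 2 + z.im ^ 2) (h3 : -1 / 2 ≤ z.re) (h4 : z.re ≤ 0)
    (hx : hauptmodul z = x) (hx1 : 22 - 10 * √5 ≤ x) (hx2 : x ≤ 22 + 10 * √5) :
    z = pointI ∨ z = rho1 ∨ z = rho2 ∨ z ∈ arc1 ∨ z ∈ arc2 := by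
  have hext : ∀ w : ℍ, z.re = w.re → z.im ^ 2 = w.im ^ 2 → z = w := fun w hr hi ↦ by
    ext
    exact Complex.ext hr ((pow_left_inj₀ z.im_pos.le w.im_pos.le two_ne_zero).mp hi)
  have hre : (hauptmodul z).re = x := by rw [hx, Complex.ofReal_re]
  rcases h4.lt_or_eq with h4 | h4
  · rcases h3.lt_or_eq with h3 | h3
    · rcases h1.lt_or_eq with h1 | h1
      · rcases h2.lt_or_eq with h2 | h2
        · have : (z : ℂ) ∈ leftHalf := ⟨z.im_pos, h3, h4, h1, h2⟩
          have := hauptC_im_pos this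
          rw [hauptC_coe, hx, Complex.ofReal_im] at this
          exact absurd this (lt_irrefl _)
        · right; right; right; right
          exact mem_arc2_iff.mpr ⟨h2.symm, h3, by nlinarith⟩
      · have h5 : -2 / 5 ≤ z.re := by nlinarith
        rcases h5.lt_or_eq with h5 | h5
        · right; right; right; left
          exact mem_arc1_iff.mpr ⟨h1.symm, h5, h4⟩
        · right; right; left
          refine hext _ h5.symm ?_
          rw [← h5] at h1
          rw [rho2_im]; linarith
    · right; left
      rw [← h3] at h2
      have h5 : rho1.im ≤ z.im := by
        rw [← pow_le_pow_iff_left₀ rho1.im_pos.le z.im_pos.le two_ne_zero, rho1_im_sq]; linarith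
      rcases h5.lt_or_eq with h5 | h5
      -- Above ρ₁ on the left line the values lie below 22 − 10√5, against the lower bound on x.
      · have h6 := strictMonoOn_left_line (a := -z.im) (b := -rho1.im)
          (neg_le_neg h5.le) (Set.mem_Iic.mpr le_rfl) (neg_lt_neg h5)
        simp only [neg_neg] at h6
        have e1 : (⟨-1 / 2, z.im⟩ : ℂ) = z := Complex.ext h3 rfl
        have e2 : (⟨-1 / 2, rho1.im⟩ : ℂ) = rho1 := rfl
        rw [e1, e2, hauptC_coe, hauptC_coe, hauptmodul_rho1_re, hre] at h6
        linarith
      · exact hext _ h3.symm (by rw [h5])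
  · left
    rw [h4] at h1
    have h5 : pointI.im ≤ z.im := by
      rw [← pow_le_pow_iff_left₀ pointI.im_pos.le z.im_pos.le two_ne_zero, pointI_im_sq]; linarith
    rcases h5.lt_or_eq with h5 | h5
    · have h6 := strictMonoOn_imag_axis (a := pointI.im) (b := z.im) (Set.mem_Ici.mpr le_rfl) h5.le h5
      have e1 : (⟨0, z.im⟩ : ℂ) = z := Complex.ext h4.symm rfl
      have e2 : (⟨0, pointI.im⟩ : ℂ) = pointI := rfl
      simp only at h6
      rw [e1, e2, hauptC_coe, hauptC_coe, hauptmodul_pointI_re, hre] at h6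
      linarith
    · exact hext _ h4 (by rw [h5])

/-- The open right part is the mirror image of points of `leftHalf`, where h is conjugated and so
has negative imaginary part; points with real part 0 belong to the left half. -/
lemma mem_arc_of_mem_fundDomain {z : ℍ} {x : ℝ} (hz : z ∈ fundDomain)
    (hx : hauptmodul z = x) (hx1 : 22 - 10 * √5 ≤ x) (hx2 : x ≤ 22 + 10 * √5) :
    z = pointI ∨ z = rho1 ∨ z = rho2 ∨ z ∈ arc1 ∨ z ∈ arc2 := by
  rcases hz with ⟨h1, h2, h3, h4⟩ | ⟨h1, h2, h3, h4⟩
  · rw [le_norm_iff (by positivity), one_div_sqrt_five_sq] at h1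
    rw [le_norm_iff (by positivity), one_div_two_mul_sqrt_five_sq] at h2
    have hre : ((z : ℂ) + 1 / 2).re = z.re + 1 / 2 := by simp
    have him : ((z : ℂ) + 1 / 2).im = z.im := by simp
    rw [hre, him] at h2
    exact mem_arc_of_left h1 h2 h3 h4 hx hx1 hx2
  · rw [lt_norm_iff (by positivity), one_div_sqrt_five_sq] at h1
    rw [lt_norm_iff (by positivity), one_div_two_mul_sqrt_five_sq] at h2
    have hre : ((z : ℂ) - 1 / 2).re = z.re - 1 / 2 := by simp
    have him : ((z : ℂ) - 1 / 2).im = z.im := by simp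
    rw [hre, him] at h2
    have hmr : (mirror z).re = -z.re := by rw [← coe_re, coe_mirror]; simp
    have hmi : (mirror z).im = z.im := by rw [← coe_im, coe_mirror]; simp
    rcases h3.lt_or_eq with h3 | h3
    · have hm : ((mirror z : ℍ) : ℂ) ∈ leftHalf := by
        refine ⟨(mirror z).im_pos, ?_, ?_, ?_, ?_⟩ <;> simp only [coe_re, coe_im, hmr, hmi]
        · linarith
        · linarith
        · rw [neg_sq]; exact h1
        · rw [← neg_sq]; convert h2 using 3; ring
      have := hauptC_im_pos hm
      rw [hauptC_coe, hauptmodul_mirror, hx, Complex.conj_ofReal, Complex.ofReal_im] at this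
      exact absurd this (lt_irrefl _)
    · refine mem_arc_of_left h1.le ?_ ?_ h3.ge hx hx1 hx2
      · rw [coe_re, coe_im, ← h3] at h1
        rw [← h3]; linarith
      · rw [← h3]; norm_num

/-! ### Orders of vanishing and counting of simple zeros -/

lemma analyticAt_comp_ofComplex {f : ℍ → ℂ} (hf : MDiff f) (z : ℍ) :
    AnalyticAt ℂ (f ∘ ofComplex) z :=
  (UpperHalfPlane.mdifferentiable_iff.mp hf).analyticAt
    (isOpen_upperHalfPlaneSet.mem_nhds z.im_pos)

lemma hasOrderAt_iff {f : ℍ → ℂ} (hf : MDiff f) {z : ℍ} {n : ℕ} :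
    HasOrderAt f z n ↔ analyticOrderAt (f ∘ ofComplex) (z : ℂ) = n :=
  and_iff_right (analyticAt_comp_ofComplex hf z)

lemma HasOrderAt.mul {f g : ℍ → ℂ} {z : ℍ} {m n : ℕ} (hf : HasOrderAt f z m)
    (hg : HasOrderAt g z n) : HasOrderAt (f * g) z (m + n) := by
  refine ⟨hf.1.mul hg.1, ?_⟩
  have := analyticOrderAt_mul hf.1 hg.1
  rw [hf.2, hg.2] at this
  exact_mod_cast this

lemma hasOrderAt_zero_iff {f : ℍ → ℂ} (hf : MDiff f) {z : ℍ} : HasOrderAt f z 0 ↔ f z ≠ 0 := by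
  have h := analyticAt_comp_ofComplex hf z
  rw [hasOrderAt_iff hf, Nat.cast_zero, h.analyticOrderAt_eq_zero, Function.comp_apply,
    ofComplex_apply]

lemma HasOrderAt.apply_eq_zero {f : ℍ → ℂ} {z : ℍ} {n : ℕ} (h : HasOrderAt f z n) (hn : n ≠ 0) :
    f z = 0 := by
  have := apply_eq_zero_of_analyticOrderAt_ne_zero (f := f ∘ ofComplex) (z₀ := (z : ℂ))
    (by rw [h.2]; exact_mod_cast hn)
  simpa using this

lemma mdifferentiable_hauptmodul_sub (c : ℂ) : MDiff fun z ↦ hauptmodul z - c :=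
  mdifferentiable_hauptmodul.sub mdifferentiable_const

lemma analyticOrderAt_hauptmodul_sub (z : ℍ) :
    analyticOrderAt ((fun w ↦ hauptmodul w - hauptmodul z) ∘ ofComplex) (z : ℂ) =
      analyticOrderAt (hauptC · - hauptC z) (z : ℂ) := by
  rw [hauptC_coe]; rfl

lemma hasOrderAt_of_mem_arc1 {z : ℍ} (hz : z ∈ arc1) :
    HasOrderAt (fun w ↦ hauptmodul w - hauptmodul z) z 1 := by
  obtain ⟨h1, h2, h3⟩ := mem_arc1_iff.mp hz
  rw [hasOrderAt_iff (mdifferentiable_hauptmodul_sub _), analyticOrderAt_hauptmodul_sub]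
  refine ((sectorIn_of_circle z.im_pos h1 h2 h3).order_eq_one z.im_pos ?_ ?_).1
  · rw [hauptC_coe]; exact hauptmodul_im_of_mem_arc1 hz
  · simpa using z.ne_zero

lemma hasOrderAt_of_mem_arc2 {z : ℍ} (hz : z ∈ arc2) :
    HasOrderAt (fun w ↦ hauptmodul w - hauptmodul z) z 1 := by
  obtain ⟨h1, h2, h3⟩ := mem_arc2_iff.mp hz
  rw [hasOrderAt_iff (mdifferentiable_hauptmodul_sub _), analyticOrderAt_hauptmodul_sub]
  refine ((sectorIn_of_circle' z.im_pos h1 h2 h3).order_eq_one z.im_pos ?_ ?_).1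
  · rw [hauptC_coe]; exact hauptmodul_im_of_mem_arc2 hz
  · refine mul_ne_zero (neg_ne_zero.mpr Complex.I_ne_zero) fun h ↦ z.im_pos.ne' ?_
    simpa using congrArg Complex.im h

lemma hasOrderAt_of_mem_arc {z : ℍ} (hz : z ∈ arc1 ∨ z ∈ arc2) :
    HasOrderAt (fun w ↦ hauptmodul w - hauptmodul z) z 1 :=
  hz.elim hasOrderAt_of_mem_arc1 hasOrderAt_of_mem_arc2

/-- A simple zero of `hauptmodul - c` which is not a zero of `G` is simple for the product. -/
lemma hasOrderAt_one_of_eq {f G : ℍ → ℂ} {c : ℂ} {z : ℍ}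
    (hfG : ∀ w, f w = G w * (hauptmodul w - c)) (hG : MDiff G) (hGz : G z ≠ 0)
    (hz : hauptmodul z = c) (h1 : HasOrderAt (fun w ↦ hauptmodul w - hauptmodul z) z 1) :
    HasOrderAt f z 1 := by
  have : f = G * fun w ↦ hauptmodul w - hauptmodul z := by
    ext w; rw [hz]; exact hfG w
  rw [this]
  simpa using ((hasOrderAt_zero_iff hG).mpr hGz).mul h1

/-- If `f = G (hauptmodul - c)` where `G` has no zero on `A` and `hauptmodul` takes the value `c`
exactly once on `A`, then `f` has exactly one simple zero on `A`. -/
lemma encard_simple_zeros_eq_one {A : Set ℍ} {f G : ℍ → ℂ} {c : ℂ}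
    (hA : ∃ w ∈ A, {z ∈ A | hauptmodul z = c} = {w})
    (hA1 : ∀ z ∈ A, HasOrderAt (fun w ↦ hauptmodul w - hauptmodul z) z 1)
    (hfG : ∀ w, f w = G w * (hauptmodul w - c)) (hG : MDiff G) (hGA : ∀ z ∈ A, G z ≠ 0) :
    {z ∈ A | HasOrderAt f z 1}.encard = 1 := by
  obtain ⟨w, -, hw⟩ := hA
  rw [← Set.encard_singleton w, ← hw]
  congr 1
  ext z
  refine and_congr_right fun hz ↦ ⟨fun h ↦ ?_, fun h ↦ ?_⟩
  · have := h.apply_eq_zero one_ne_zero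
    rw [hfG] at this
    exact sub_eq_zero.mp ((mul_eq_zero.mp this).resolve_left (hGA z hz))
  · exact hasOrderAt_one_of_eq hfG hG (hGA z hz) h (hA1 z hz)

lemma encard_simple_zeros_eq_zero {A : Set ℍ} {f : ℍ → ℂ} (hf : ∀ z ∈ A, f z ≠ 0) :
    {z ∈ A | HasOrderAt f z 1}.encard = 0 := by
  rw [Set.encard_eq_zero, Set.eq_empty_iff_forall_notMem]
  exact fun z hz ↦ hf z hz.1 (hz.2.apply_eq_zero one_ne_zero)

/-- Periodicity and boundedness make the cusp function analytic at q = 0, with the nonzero limit c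
as its value. -/
lemma IsFrickeForm.hasOrderAtInfty_zero {k : ℕ} {F : ℍ → ℂ} (hF : IsFrickeForm k F) {c : ℂ}
    (hc : c ≠ 0) (h : Tendsto F atImInfty (𝓝 c)) : HasOrderAtInfty F 0 := by
  have hT : ∀ z : ℍ, F (ModularGroup.T • z) = F z := fun z ↦ by
    rw [hF.gamma0 _ T_mem]; simp [ModularGroup.T]
  have hper : Function.Periodic (F ∘ ofComplex) ((1 : ℝ) : ℂ) := by
    intro w
    by_cases hw : 0 < w.im
    · have hw' : 0 < (w + (1 : ℝ)).im := by simpa using hw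
      simp only [Function.comp_apply, ofComplex_apply_of_im_pos hw, ofComplex_apply_of_im_pos hw']
      rw [← hT ⟨w, hw⟩]
      congr 1
      ext
      rw [coe_SL_smul]
      simp [ModularGroup.T]
    -- Off the upper half plane `ofComplex` takes one default value, so periodicity is trivial
    -- there.
    · have hw' : ¬ 0 < (w + (1 : ℝ)).im := by simpa using hw
      simp only [Function.comp_apply, ofComplex_apply_of_im_nonpos (not_lt.mp hw),
        ofComplex_apply_of_im_nonpos (not_lt.mp hw')]
  have hbdd : IsBoundedAtImInfty F := h.isBigO_one ℝ
  have hA := analyticAt_cuspFunction_zero one_pos hper hF.mdiff hbdd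
  refine ⟨by simpa using hper, hA, ?_⟩
  rw [Nat.cast_zero, hA.analyticOrderAt_eq_zero, cuspFunction_apply_zero one_pos hA hper,
    valueAtInfty, h.limUnder_eq]
  exact hc

lemma hasOrderAtInfty_eisensteinFricke {k : ℕ} (hk : 3 ≤ k) (hk2 : Even k) {b c d : ℂ}
    (h : HasExpansion (eisensteinFricke 5 hk) 1 b c d) :
    HasOrderAtInfty (eisensteinFricke 5 hk) 0 :=
  (isFrickeForm_eisensteinFricke hk hk2).hasOrderAtInfty_zero one_ne_zero h.tendsto

lemma sqrt_five_bounds : (223 / 100 : ℝ) < √5 ∧ √5 < 9 / 4 :=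
  ⟨(Real.lt_sqrt (by norm_num)).mpr (by norm_num), (Real.sqrt_lt' (by norm_num)).mpr (by norm_num)⟩

lemma hauptmodul_ne_of_mem_arc1 {z : ℍ} (hz : z ∈ arc1) {x : ℝ} (hx : x ≤ 0) :
    hauptmodul z ≠ x := fun h ↦ by
  have := (hauptmodul_re_of_mem_arc1 hz).1
  rw [h, Complex.ofReal_re] at this
  linarith

lemma hauptmodul_ne_of_mem_arc2 {z : ℍ} (hz : z ∈ arc2) {x : ℝ} (hx : 0 ≤ x) :
    hauptmodul z ≠ x := fun h ↦ by
  have := (hauptmodul_re_of_mem_arc2 hz).2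
  rw [h, Complex.ofReal_re] at this
  linarith

lemma hauptmodul_corner_ne {x : ℝ} (h1 : x ≠ 22 - 10 * √5) (h2 : x ≠ 0) (h3 : x ≠ 22 + 10 * √5) :
    hauptmodul pointI - x ≠ 0 ∧ hauptmodul rho1 - x ≠ 0 ∧ hauptmodul rho2 - x ≠ 0 := by
  obtain ⟨e1, e2, e3⟩ := hauptmodul_corner_values
  refine ⟨fun h ↦ h3 ?_, fun h ↦ h1 ?_, fun h ↦ h2 ?_⟩
  · rw [sub_eq_zero, e3] at h; exact_mod_cast h.symm
  · rw [sub_eq_zero, e1] at h; exact_mod_cast h.symm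
  · rw [sub_eq_zero, e2] at h; exact_mod_cast h.symm

lemma zero_location {f : ℍ → ℂ} {z : ℍ}
    (hz : z = pointI ∨ z = rho1 ∨ z = rho2 ∨ z ∈ arc1 ∨ z ∈ arc2)
    (h : z ∈ arc1 ∨ z ∈ arc2 → HasOrderAt f z 1) :
    z = pointI ∨ z = rho1 ∨ z = rho2 ∨ ((z ∈ arc1 ∨ z ∈ arc2) ∧ HasOrderAt f z 1) :=
  hz.imp_right <| Or.imp_right <| Or.imp_right fun h' ↦ ⟨h', h h'⟩

/-! ### The zero tables -/

lemma hasZeroTable_four :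
    HasZeroTable (eisensteinFricke 5 (k := 4) (by norm_num)) 0 0 0 0 1 0 := by
  obtain ⟨hs1, hs2⟩ := sqrt_five_bounds
  have hm := (isFrickeForm_eisensteinFricke (k := 4) (by norm_num) (by decide)).mdiff
  have hf : ∀ w, eisensteinFricke 5 (k := 4) (by norm_num) w =
      etaForm w * (hauptmodul w - (36 / 13 : ℝ)) := fun w ↦ by
    rw [eisensteinFricke_four_eq]; push_cast; rfl
  have hne : ∀ w, hauptmodul w - (36 / 13 : ℝ) ≠ 0 →
      eisensteinFricke 5 (k := 4) (by norm_num) w ≠ 0 := fun w h ↦ by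
    rw [hf]; exact mul_ne_zero (etaForm_ne_zero w) h
  obtain ⟨c1, c2, c3⟩ := hauptmodul_corner_ne (x := 36 / 13) (by linarith) (by norm_num)
    (by linarith)
  refine ⟨hasOrderAtInfty_eisensteinFricke _ (by decide) hasExpansion_eisensteinFricke_four,
    (hasOrderAt_zero_iff hm).mpr (hne _ c1), (hasOrderAt_zero_iff hm).mpr (hne _ c2),
    (hasOrderAt_zero_iff hm).mpr (hne _ c3), ?_, ?_, fun z hz h0 ↦ ?_⟩
  · exact encard_simple_zeros_eq_one
      (exists_arc1_eq_singleton (x := 36 / 13) ⟨by norm_num, by linarith⟩)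
      (fun z hz ↦ hasOrderAt_of_mem_arc1 hz) hf mdifferentiable_etaForm fun z _ ↦ etaForm_ne_zero z
  · exact encard_simple_zeros_eq_zero fun z hz ↦
      hne z (sub_ne_zero.mpr (hauptmodul_ne_of_mem_arc2 hz (by norm_num)))
  · rw [hf] at h0
    have hz1 := sub_eq_zero.mp ((mul_eq_zero.mp h0).resolve_left (etaForm_ne_zero z))
    exact zero_location (mem_arc_of_mem_fundDomain hz hz1 (by linarith) (by linarith)) fun h ↦
      hasOrderAt_one_of_eq hf mdifferentiable_etaForm (etaForm_ne_zero z) hz1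
        (hasOrderAt_of_mem_arc h)

lemma exists_eight_roots : ∃ r₁ r₂ : ℝ, r₁ ∈ Set.Ioo (22 - 10 * √5) 0 ∧
    r₂ ∈ Set.Ioo 0 (22 + 10 * √5) ∧
    ∀ w, eisensteinFricke 5 (k := 8) (by norm_num) w =
      etaForm w ^ 2 * ((hauptmodul w - r₁) * (hauptmodul w - r₂)) := by
  obtain ⟨hs1, hs2⟩ := sqrt_five_bounds
  -- The roots of the quadratic in h are 3636/313 ± s with s² = (3636² + 1008·313)/313². The bounds
  -- 11.75 < s < 11.8 place one root in each interval.
  obtain ⟨s, hs⟩ : ∃ s : ℝ, s = √(13536000 / 97969) := ⟨_, rfl⟩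
  have h1 : (1175 / 100 : ℝ) < s := hs ▸ (Real.lt_sqrt (by norm_num)).mpr (by norm_num)
  have h2 : s < (118 / 10 : ℝ) := hs ▸ (Real.sqrt_lt' (by norm_num)).mpr (by norm_num)
  have h3 : s ^ 2 = 13536000 / 97969 := hs ▸ Real.sq_sqrt (by norm_num)
  have h4 : (s : ℂ) ^ 2 = 13536000 / 97969 := by
    rw [← Complex.ofReal_pow, h3]; push_cast; rfl
  refine ⟨3636 / 313 - s, 3636 / 313 + s, ⟨by linarith, by linarith⟩, ⟨by linarith, by linarith⟩,
    fun w ↦ ?_⟩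
  rw [eisensteinFricke_eight_eq]
  push_cast
  linear_combination etaForm w ^ 2 * h4

lemma hasZeroTable_eight :
    HasZeroTable (eisensteinFricke 5 (k := 8) (by norm_num)) 0 0 0 0 1 1 := by
  obtain ⟨r₁, r₂, hr₁, hr₂, hf⟩ := exists_eight_roots
  have hm := (isFrickeForm_eisensteinFricke (k := 8) (by norm_num) (by decide)).mdiff
  have hη : ∀ w, etaForm w ^ 2 ≠ 0 := fun w ↦ pow_ne_zero _ (etaForm_ne_zero w)
  have hG : ∀ r : ℝ, MDiff (etaForm * etaForm * fun w ↦ hauptmodul w - r) := fun r ↦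
    (mdifferentiable_etaForm.mul mdifferentiable_etaForm).mul (mdifferentiable_hauptmodul_sub r)
  have hG0 : ∀ (r : ℝ) (w : ℍ), hauptmodul w ≠ r →
      (etaForm * etaForm * fun w ↦ hauptmodul w - r) w ≠ 0 := fun r w h ↦
    mul_ne_zero (mul_ne_zero (etaForm_ne_zero w) (etaForm_ne_zero w)) (sub_ne_zero.mpr h)
  have hf₁ : ∀ w, eisensteinFricke 5 (k := 8) (by norm_num) w =
      (etaForm * etaForm * fun w ↦ hauptmodul w - r₂) w * (hauptmodul w - r₁) := fun w ↦ by
    rw [hf]; simp only [Pi.mul_apply]; ring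
  have hf₂ : ∀ w, eisensteinFricke 5 (k := 8) (by norm_num) w =
      (etaForm * etaForm * fun w ↦ hauptmodul w - r₁) w * (hauptmodul w - r₂) := fun w ↦ by
    rw [hf]; simp only [Pi.mul_apply]; ring
  have hne : ∀ w, hauptmodul w - r₁ ≠ 0 → hauptmodul w - r₂ ≠ 0 →
      eisensteinFricke 5 (k := 8) (by norm_num) w ≠ 0 := fun w h h' ↦ by
    rw [hf]; exact mul_ne_zero (hη w) (mul_ne_zero h h')
  have h12 : (r₁ : ℂ) ≠ r₂ := by
    exact_mod_cast (hr₁.2.trans hr₂.1).ne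
  have h5 : (0 : ℝ) < √5 := by positivity
  obtain ⟨c1, c2, c3⟩ := hauptmodul_corner_ne hr₁.1.ne' hr₁.2.ne (by linarith [hr₁.2])
  obtain ⟨d1, d2, d3⟩ := hauptmodul_corner_ne (by linarith [hr₂.1, sqrt_five_bounds.1])
    hr₂.1.ne' hr₂.2.ne
  refine ⟨hasOrderAtInfty_eisensteinFricke _ (by decide) hasExpansion_eisensteinFricke_eight,
    (hasOrderAt_zero_iff hm).mpr (hne _ c1 d1), (hasOrderAt_zero_iff hm).mpr (hne _ c2 d2),
    (hasOrderAt_zero_iff hm).mpr (hne _ c3 d3), ?_, ?_, fun z hz h0 ↦ ?_⟩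
  · exact encard_simple_zeros_eq_one (exists_arc1_eq_singleton hr₂)
      (fun z hz ↦ hasOrderAt_of_mem_arc1 hz) hf₂ (hG r₁) fun z hz ↦
        hG0 r₁ z (hauptmodul_ne_of_mem_arc1 hz hr₁.2.le)
  · exact encard_simple_zeros_eq_one (exists_arc2_eq_singleton hr₁)
      (fun z hz ↦ hasOrderAt_of_mem_arc2 hz) hf₁ (hG r₂) fun z hz ↦
        hG0 r₂ z (hauptmodul_ne_of_mem_arc2 hz hr₂.1.le)
  · have h0' := h0
    rw [hf] at h0'
    rcases mul_eq_zero.mp ((mul_eq_zero.mp h0').resolve_left (hη z)) with h | h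
    · have hz1 := sub_eq_zero.mp h
      exact zero_location (mem_arc_of_mem_fundDomain hz hz1 hr₁.1.le (by linarith [hr₁.2]))
        fun h ↦ hasOrderAt_one_of_eq hf₁ (hG r₂) (hG0 _ _ (hz1 ▸ h12)) hz1
          (hasOrderAt_of_mem_arc h)
    · have hz1 := sub_eq_zero.mp h
      exact zero_location (mem_arc_of_mem_fundDomain hz hz1
        (by linarith [hr₂.1, sqrt_five_bounds.1]) hr₂.2.le)
        fun h ↦ hasOrderAt_one_of_eq hf₂ (hG r₁) (hG0 _ _ (hz1 ▸ h12.symm)) hz1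
          (hasOrderAt_of_mem_arc h)

lemma eisensteinFricke_six_sq_eq_prod (w : ℍ) :
    eisensteinFricke 5 (k := 6) (by norm_num) w ^ 2 =
      etaForm w ^ 3 * ((hauptmodul w - hauptmodul pointI) * (hauptmodul w - hauptmodul rho1) *
        (hauptmodul w - hauptmodul rho2)) := by
  obtain ⟨e1, e2, e3⟩ := hauptmodul_corner_values
  have h5 : ((√5 : ℝ) : ℂ) ^ 2 = 5 := by
    exact_mod_cast congrArg (fun x : ℝ ↦ (x : ℂ)) (Real.sq_sqrt (show (0 : ℝ) ≤ 5 by norm_num))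
  rw [eisensteinFricke_six_sq_eq, e1, e2, e3]
  push_cast
  linear_combination 100 * etaForm w ^ 3 * hauptmodul w * h5

/-- By the factorization, twice the order of E*₆ at z is the order of h − h(z). This is at most 2,
and E*₆(z) = 0, so the order of E*₆ is 1. -/
lemma hasOrderAt_eisensteinFricke_six {z a b : ℍ} (hza : hauptmodul z ≠ hauptmodul a)
    (hzb : hauptmodul z ≠ hauptmodul b)
    (hsq : ∀ w, eisensteinFricke 5 (k := 6) (by norm_num) w ^ 2 =
      etaForm w ^ 3 * ((hauptmodul w - hauptmodul a) * (hauptmodul w - hauptmodul b) *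
        (hauptmodul w - hauptmodul z)))
    (hord : analyticOrderAt (hauptC · - hauptC z) (z : ℂ) ≤ 2) :
    HasOrderAt (eisensteinFricke 5 (k := 6) (by norm_num)) z 1 := by
  set f := eisensteinFricke 5 (k := 6) (by norm_num) with hf
  have hm : MDiff f := (isFrickeForm_eisensteinFricke (k := 6) (by norm_num) (by decide)).mdiff
  have hA := analyticAt_comp_ofComplex hm z
  set G : ℍ → ℂ := etaForm * etaForm * etaForm * (fun w ↦ hauptmodul w - hauptmodul a) *
    fun w ↦ hauptmodul w - hauptmodul b with hGdef
  have hG : MDiff G := ((((mdifferentiable_etaForm.mul mdifferentiable_etaForm).mul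
    mdifferentiable_etaForm).mul (mdifferentiable_hauptmodul_sub _)).mul
      (mdifferentiable_hauptmodul_sub _))
  have hGz : G z ≠ 0 := by
    have := etaForm_ne_zero z
    simp only [hGdef, Pi.mul_apply]
    exact mul_ne_zero (mul_ne_zero (mul_ne_zero (mul_ne_zero this this) this)
      (sub_ne_zero.mpr hza)) (sub_ne_zero.mpr hzb)
  have hmul : f * f = G * fun w ↦ hauptmodul w - hauptmodul z := by
    ext w
    simp only [Pi.mul_apply, hGdef]
    rw [← sq, hsq]; ring
  have h1 := analyticOrderAt_mul hA hA
  have h2 := analyticOrderAt_mul (analyticAt_comp_ofComplex hG z)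
    (analyticAt_comp_ofComplex (mdifferentiable_hauptmodul_sub (hauptmodul z)) z)
  rw [((hasOrderAt_zero_iff hG).mpr hGz).2, analyticOrderAt_hauptmodul_sub, Nat.cast_zero,
    zero_add] at h2
  have h3 : (f ∘ ofComplex) * (f ∘ ofComplex) =
      (G ∘ ofComplex) * ((fun w ↦ hauptmodul w - hauptmodul z) ∘ ofComplex) :=
    congrArg (· ∘ ofComplex) hmul
  rw [← h3, h1] at h2
  rw [← h2] at hord
  have h0 : f z = 0 := by
    have := hsq z
    rw [sub_self, mul_zero, mul_zero] at this
    exact pow_eq_zero_iff two_ne_zero |>.mp this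
  have hne : analyticOrderAt (f ∘ ofComplex) (z : ℂ) ≠ 0 :=
    analyticOrderAt_ne_zero.mpr ⟨hA, by simpa using h0⟩
  rw [hasOrderAt_iff hm]
  generalize analyticOrderAt (f ∘ ofComplex) (z : ℂ) = n at hord hne ⊢
  induction n using ENat.recTopCoe with
  | top => simp at hord
  | coe n =>
    have h4 : n + n ≤ 2 := by exact_mod_cast hord
    have h5 : n ≠ 0 := by exact_mod_cast hne
    have : n = 1 := by omega
    rw [this]

lemma hasOrderAt_eisensteinFricke_six_corners :
    HasOrderAt (eisensteinFricke 5 (k := 6) (by norm_num)) pointI 1 ∧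
    HasOrderAt (eisensteinFricke 5 (k := 6) (by norm_num)) rho1 1 ∧
    HasOrderAt (eisensteinFricke 5 (k := 6) (by norm_num)) rho2 1 := by
  have l1 := hauptmodul_rho1_lt_rho2
  have l2 := hauptmodul_rho2_lt_pointI
  have n12 : hauptmodul rho1 ≠ hauptmodul rho2 := fun h ↦ l1.ne (congrArg _ h)
  have n23 : hauptmodul rho2 ≠ hauptmodul pointI := fun h ↦ l2.ne (congrArg _ h)
  have n13 : hauptmodul rho1 ≠ hauptmodul pointI := fun h ↦ (l1.trans l2).ne (congrArg _ h)
  refine ⟨hasOrderAt_eisensteinFricke_six (a := rho1) (b := rho2) n13.symm n23.symm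
      (fun w ↦ by rw [eisensteinFricke_six_sq_eq_prod]; ring) ?_,
    hasOrderAt_eisensteinFricke_six (a := pointI) (b := rho2) n13 n12
      (fun w ↦ by rw [eisensteinFricke_six_sq_eq_prod]; ring) ?_,
    hasOrderAt_eisensteinFricke_six (a := pointI) (b := rho1) n23 n12.symm
      (fun w ↦ by rw [eisensteinFricke_six_sq_eq_prod]) ?_⟩
  · exact sectorIn_pointI.order_le_two pointI.im_pos
      (by rw [hauptC_coe]; exact hauptmodul_im_pointI) Complex.I_ne_zero
  · exact sectorIn_rho1.order_le_two rho1.im_pos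
      (by rw [hauptC_coe]; exact hauptmodul_im_rho1) one_ne_zero
  · refine sectorIn_rho2.order_le_two rho2.im_pos
      (by rw [hauptC_coe]; exact hauptmodul_im_rho2) fun h ↦ ?_
    simpa using congrArg Complex.re h

lemma hauptmodul_re_of_eisensteinFricke_six_eq_zero {z : ℍ}
    (h : eisensteinFricke 5 (k := 6) (by norm_num) z = 0) :
    hauptmodul z = ((22 + 10 * √5 : ℝ) : ℂ) ∨ hauptmodul z = ((22 - 10 * √5 : ℝ) : ℂ) ∨
      hauptmodul z = ((0 : ℝ) : ℂ) := by
  obtain ⟨e1, e2, e3⟩ := hauptmodul_corner_values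
  have h2 := eisensteinFricke_six_sq_eq_prod z
  rw [h, zero_pow two_ne_zero, eq_comm] at h2
  have h3 := (mul_eq_zero.mp h2).resolve_left (pow_ne_zero _ (etaForm_ne_zero z))
  rw [e1, e2, e3, mul_eq_zero, mul_eq_zero, sub_eq_zero, sub_eq_zero, sub_eq_zero, or_assoc] at h3
  simpa using h3

lemma eisensteinFricke_six_ne_zero_of_mem_arc {z : ℍ} (hz : z ∈ arc1 ∨ z ∈ arc2) :
    eisensteinFricke 5 (k := 6) (by norm_num) z ≠ 0 := fun h ↦ by
  obtain ⟨hs1, hs2⟩ := sqrt_five_bounds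
  have h1 := hauptmodul_re_of_eisensteinFricke_six_eq_zero h
  rcases hz with hz | hz
  · have h2 := hauptmodul_re_of_mem_arc1 hz
    rcases h1 with h1 | h1 | h1 <;> rw [h1, Complex.ofReal_re] at h2 <;>
      linarith [h2.1, h2.2]
  · have h2 := hauptmodul_re_of_mem_arc2 hz
    rcases h1 with h1 | h1 | h1 <;> rw [h1, Complex.ofReal_re] at h2 <;>
      linarith [h2.1, h2.2]

lemma mem_arc_of_eisensteinFricke_six_eq_zero {z : ℍ} (hz : z ∈ fundDomain)
    (h : eisensteinFricke 5 (k := 6) (by norm_num) z = 0) :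
    z = pointI ∨ z = rho1 ∨ z = rho2 ∨ z ∈ arc1 ∨ z ∈ arc2 := by
  obtain ⟨hs1, hs2⟩ := sqrt_five_bounds
  rcases hauptmodul_re_of_eisensteinFricke_six_eq_zero h with h1 | h1 | h1 <;>
    exact mem_arc_of_mem_fundDomain hz h1 (by linarith) (by linarith)

lemma hasZeroTable_six :
    HasZeroTable (eisensteinFricke 5 (k := 6) (by norm_num)) 0 1 1 1 0 0 := by
  obtain ⟨h1, h2, h3⟩ := hasOrderAt_eisensteinFricke_six_corners
  exact ⟨hasOrderAtInfty_eisensteinFricke _ (by decide) hasExpansion_eisensteinFricke_six, h1, h2,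
    h3,
    encard_simple_zeros_eq_zero fun z hz ↦ eisensteinFricke_six_ne_zero_of_mem_arc (.inl hz),
    encard_simple_zeros_eq_zero fun z hz ↦ eisensteinFricke_six_ne_zero_of_mem_arc (.inr hz),
    fun z hz h0 ↦ zero_location (mem_arc_of_eisensteinFricke_six_eq_zero hz h0) fun h ↦
      absurd h0 (eisensteinFricke_six_ne_zero_of_mem_arc h)⟩

lemma hasZeroTable_ten :
    HasZeroTable (eisensteinFricke 5 (k := 10) (by norm_num)) 0 1 1 1 1 0 := by
  obtain ⟨hs1, hs2⟩ := sqrt_five_bounds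
  obtain ⟨h1, h2, h3⟩ := hasOrderAt_eisensteinFricke_six_corners
  obtain ⟨c1, c2, c3⟩ := hauptmodul_corner_ne (x := 4212 / 521) (by linarith) (by norm_num)
    (by linarith)
  have hm6 := (isFrickeForm_eisensteinFricke (k := 6) (by norm_num) (by decide)).mdiff
  set G : ℍ → ℂ := eisensteinFricke 5 (k := 6) (by norm_num) * etaForm with hGdef
  have hG : MDiff G := hm6.mul mdifferentiable_etaForm
  have hf : ∀ w, eisensteinFricke 5 (k := 10) (by norm_num) w =
      G w * (hauptmodul w - (4212 / 521 : ℝ)) := fun w ↦ by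
    rw [eisensteinFricke_ten_eq]
    simp only [hGdef, Pi.mul_apply]
    push_cast; ring
  have hGA : ∀ z, z ∈ arc1 ∨ z ∈ arc2 → G z ≠ 0 := fun z hz ↦
    mul_ne_zero (eisensteinFricke_six_ne_zero_of_mem_arc hz) (etaForm_ne_zero z)
  set H : ℍ → ℂ := etaForm * fun w ↦ hauptmodul w - (4212 / 521 : ℝ) with hHdef
  have hH : MDiff H := mdifferentiable_etaForm.mul (mdifferentiable_hauptmodul_sub _)
  -- The factor E*₆ accounts for the corner zeros; the cofactor D(h − 4212/521) does not vanish
  -- there.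
  have hcorner : ∀ z, hauptmodul z - (4212 / 521 : ℝ) ≠ 0 →
      HasOrderAt (eisensteinFricke 5 (k := 6) (by norm_num)) z 1 →
      HasOrderAt (eisensteinFricke 5 (k := 10) (by norm_num)) z 1 := fun z hz h ↦ by
    have h0 : HasOrderAt H z 0 :=
      (hasOrderAt_zero_iff hH).mpr (mul_ne_zero (etaForm_ne_zero z) hz)
    have e : eisensteinFricke 5 (k := 10) (by norm_num) =
        eisensteinFricke 5 (k := 6) (by norm_num) * H := by
      ext w
      rw [hf]
      simp only [hGdef, hHdef, Pi.mul_apply, mul_assoc]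
    rw [e]
    exact h.mul h0
  refine ⟨hasOrderAtInfty_eisensteinFricke _ (by decide) hasExpansion_eisensteinFricke_ten,
    hcorner _ c1 h1, hcorner _ c2 h2, hcorner _ c3 h3, ?_, ?_, fun z hz h0 ↦ ?_⟩
  · exact encard_simple_zeros_eq_one
      (exists_arc1_eq_singleton (x := 4212 / 521) ⟨by norm_num, by linarith⟩)
      (fun z hz ↦ hasOrderAt_of_mem_arc1 hz) hf hG fun z hz ↦ hGA z (.inl hz)
  · refine encard_simple_zeros_eq_zero fun z hz ↦ ?_
    rw [hf]
    exact mul_ne_zero (hGA z (.inr hz))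
      (sub_ne_zero.mpr (hauptmodul_ne_of_mem_arc2 hz (by norm_num)))
  · rw [hf] at h0
    rcases mul_eq_zero.mp h0 with h | h
    · have h6 := (mul_eq_zero.mp h).resolve_right (etaForm_ne_zero z)
      exact zero_location (mem_arc_of_eisensteinFricke_six_eq_zero hz h6) fun h' ↦
        absurd h6 (eisensteinFricke_six_ne_zero_of_mem_arc h')
    · have hz1 := sub_eq_zero.mp h
      exact zero_location (mem_arc_of_mem_fundDomain hz hz1 (by linarith) (by linarith))
        fun h' ↦ hasOrderAt_one_of_eq hf hG (hGA z h') hz1 (hasOrderAt_of_mem_arc h')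

end FrickeEisenstein

end

theorem mainTheorem11 :
    FrickeEisenstein.HasZeroTable
      (FrickeEisenstein.eisensteinFricke 5 (k := 4) (by norm_num)) 0 0 0 0 1 0 ∧
    FrickeEisenstein.HasZeroTable
      (FrickeEisenstein.eisensteinFricke 5 (k := 6) (by norm_num)) 0 1 1 1 0 0 ∧
    FrickeEisenstein.HasZeroTable
      (FrickeEisenstein.eisensteinFricke 5 (k := 8) (by norm_num)) 0 0 0 0 1 1 ∧
    FrickeEisenstein.HasZeroTable
      (FrickeEisenstein.eisensteinFricke 5 (k := 10) (by norm_num)) 0 1 1 1 1 0 := by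
  exact ⟨FrickeEisenstein.hasZeroTable_four, FrickeEisenstein.hasZeroTable_six,
    FrickeEisenstein.hasZeroTable_eight, FrickeEisenstein.hasZeroTable_ten⟩
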